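/- **Setting.** Let $n\ge 0$ and let $\Gamma$ be an $n$-crystallographic group, i.e. a subgroup of $O(n)\ltimes\mathbb R^n=\mathrm{Isom}(\mathbb R^n)$ acting properly discontinuously and cocompactly on $\mathbb R^n$. For $\gamma\in\Gamma$ write $\gamma x=(p\gamma)x+b$ with $p\gamma\in O(n)$, and let $H=\{h\in\mathbb R^n:\ (x\mapsto x+h)\in\Gamma\}$. Let $C^n=\mathbb R^n/(x\sim\pm x)$ with the quotient topology (for $n\ge1$ this is the open cone on $\mathbb{RP}^{n-1}$). The group $\Gamma$ acts on $C^n$ by $\gamma[x]=[(p\gamma)x]$ and diagonally on $C^n\times\mathbb R^n$. For $0\ne h\in H$ let $\mathcal L_h$ be the set of all affine lines in $\mathbb R^n$ parallel to $\mathbb Rh$. Put $\mathcal L=\bigcup_{0\ne h\in H}\mathcal L_h$ and $\Lambda=\{\mathcal L_h: 0\neq h\in H\}$; $\Gamma$ acts on $\Lambda$ by $\gamma\mathcal L_h=\mathcal L_{(p\gamma)h}$. Given an enumeration $\Lambda_1,\Lambda_2,\dots$ (finite or infinite, without repetitions) of the $\Gamma$-orbits in $\Lambda$, define the height of a line $l\in\mathcal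 L_h$, $\mathcal L_h\in\Lambda_k$, by $c(l)=\left[\frac{k\,h}{\|h\|}\right]\in C^n$, and let $\bar l=\{c(l)\}\times l\subset C^n\times\mathbb R^n$. Let $A$ be the quotient space of $C^n\times\mathbb R^n$ obtained by collapsing each of the (pairwise disjoint) lifted lines $\bar l$, $l\in\mathcal L$, to a point, with the induced $\Gamma$-action. A group is *virtually cyclic* if it is finite or contains an infinite cyclic subgroup of finite index; $VC(\Gamma)$ is the family of virtually cyclic subgroups of $\Gamma$. **Theorem 2.1.** The $\Gamma$-orbits in $\Lambda$ can be enumerated as above, and for every such enumeration $A$ is a universal $(\Gamma,VC(\Gamma))$-space. That is, $A$ is Hausdorff, $\Gamma$ acts on it by homeomorphisms, and: 1. $A$ has a CW structure $K$ such that every $\gamma\in\Gamma$ maps open cells of $K$ onto open cells of $K$ of the same dimension, and $\gamma(\sigma)=\sigma$ for an open cell $\sigma$ implies that $\gamma$ fixes $\sigma$ pointwise; and for every $G\in VC(\Gamma)$ the fixed set $A^G$ is a subcomplex of $K$. 2. For every $a\in A$ the isotropy group $\Gamma^a$ is in $VC(\Gamma)$. 3. For every $G\in VC(\Gamma)$ the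 fixed set $A^G$ is nonempty and contractible. -/

import Mathlib

noncomputable section

namespace Crystal

open Set Topology

/-! ### Universal spaces for a family of subgroups -/

section Universal

/-- A group is virtually cyclic if it is finite or contains an infinite cyclic subgroup of
finite index. -/
def IsVirtuallyCyclic (G : Type*) [Group G] : Prop :=
  Finite G ∨ ∃ g : G, ¬ IsOfFinOrder g ∧ (Subgroup.zpowers g).FiniteIndex

/-- The family of all virtually cyclic subgroups of a group. -/
def virtuallyCyclicSubgroups (G : Type*) [Group G] : Set (Subgroup G) :=
  {V | IsVirtuallyCyclic V}

/-- The action of `G` on `X` is cellular for the given CW structure on `X`: every group element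
carries open cells onto open cells (of the same dimension), and an element which maps an open cell
onto itself fixes this cell pointwise.  For a discrete group acting by homeomorphisms this says
that `X` is a `G`-CW complex. -/
def IsCellularAction (G X : Type*) [Group G] [TopologicalSpace X] [MulAction G X]
    [CWComplex (univ : Set X)] : Prop :=
  ∀ (g : G) (k : ℕ) (i : RelCWComplex.cell (univ : Set X) k),
    (∃ j : RelCWComplex.cell (univ : Set X) k,
      (fun x : X => g • x) '' RelCWComplex.openCell k i = RelCWComplex.openCell k j) ∧
    ((fun x : X => g • x) '' RelCWComplex.openCell k i = RelCWComplex.openCell k i →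
      ∀ x ∈ RelCWComplex.openCell (C := (univ : Set X)) k i, g • x = x)

/-- `X` is a universal `(G, 𝓕)`-space for the discrete group `G` and the family `𝓕` of subgroups:
`X` is a (Hausdorff) `G`-CW complex, all isotropy groups belong to `𝓕`, and for every `V ∈ 𝓕` the
fixed point set of `V` is a nonempty contractible subcomplex. -/
structure IsUniversalSpace (G : Type*) [Group G] (𝓕 : Set (Subgroup G))
    (X : Type*) [TopologicalSpace X] [MulAction G X] : Prop where
  t2 : T2Space X
  continuous_smul : ContinuousConstSMul G X
  exists_cw : ∃ _K : CWComplex (univ : Set X), IsCellularAction G X ∧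
    ∀ V ∈ 𝓕, ∃ S : CWComplex.Subcomplex (univ : Set X),
      (S : Set X) = MulAction.fixedPoints V X
  stabilizer_mem : ∀ x : X, MulAction.stabilizer G x ∈ 𝓕
  fixed_nonempty : ∀ V ∈ 𝓕, (MulAction.fixedPoints V X).Nonempty
  fixed_contractible : ∀ V ∈ 𝓕, ContractibleSpace (MulAction.fixedPoints V X)

end Universal

/-! ### Crystallographic groups -/

/-- Euclidean space `ℝⁿ`. -/
abbrev Euc (n : ℕ) : Type := EuclideanSpace ℝ (Fin n)

/-- The group `O(n) ⋉ ℝⁿ` of all isometries `x ↦ J x + b` of `ℝⁿ`. -/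
abbrev Isom (n : ℕ) : Type := Euc n ≃ᵃⁱ[ℝ] Euc n

variable {n : ℕ}

instance : MulAction (Isom n) (Euc n) where
  smul γ x := γ x
  one_smul _ := rfl
  mul_smul _ _ _ := rfl

theorem isom_smul_def (γ : Isom n) (x : Euc n) : γ • x = γ x := rfl

theorem subgroup_smul_def (Γ : Subgroup (Isom n)) (γ : Γ) (x : Euc n) :
    γ • x = (γ : Isom n) x := rfl

/-- `Γ` is an `n`-crystallographic group: it acts properly discontinuously and cocompactly
on `ℝⁿ`. -/
structure IsCrystallographic (Γ : Subgroup (Isom n)) : Prop where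
  properlyDiscontinuous : ProperlyDiscontinuousSMul Γ (Euc n)
  cocompact : ∃ K : Set (Euc n), IsCompact K ∧ ∀ x : Euc n, ∃ γ : Γ, γ • x ∈ K

/-- The linear part `p γ = J` of `γ x = J x + b`. -/
def linearPart : Isom n →* (Euc n ≃ₗᵢ[ℝ] Euc n) where
  toFun γ := γ.linearIsometryEquiv
  map_one' := rfl
  map_mul' _ _ := rfl

theorem isom_add (γ : Isom n) (v x : Euc n) : γ (v + x) = linearPart γ v + γ x :=
  γ.map_vadd x v

/-- The set `H` of all `h` such that the translation `x ↦ h + x` lies in `Γ`. -/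
def translationVectors (Γ : Subgroup (Isom n)) : Set (Euc n) :=
  {h | AffineIsometryEquiv.constVAdd ℝ (Euc n) h ∈ Γ}

theorem linearPart_mem (Γ : Subgroup (Isom n)) (γ : Γ) {h : Euc n}
    (hh : h ∈ translationVectors Γ) : linearPart (γ : Isom n) h ∈ translationVectors Γ := by
  have key : AffineIsometryEquiv.constVAdd ℝ (Euc n) (linearPart (γ : Isom n) h)
      = (γ : Isom n) * AffineIsometryEquiv.constVAdd ℝ (Euc n) h * (γ : Isom n)⁻¹ := by
    ext1 x
    have e1 := isom_add (γ : Isom n) h (((γ : Isom n)⁻¹ : Isom n) x)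
    have e2 : (γ : Isom n) (((γ : Isom n)⁻¹ : Isom n) x) = x :=
      (γ : Isom n).apply_symm_apply x
    rw [e2] at e1
    exact e1.symm
  change _ ∈ Γ
  rw [key]
  exact Γ.mul_mem (Γ.mul_mem γ.2 hh) (Γ.inv_mem γ.2)

/-! ### The cone `Cⁿ = ℝⁿ / ±1` -/

/-- The equivalence relation `x ∼ y ↔ x = ± y` on `ℝⁿ`. -/
def coneSetoid (n : ℕ) : Setoid (Euc n) where
  r x y := x = y ∨ x = -y
  iseqv :=
    { refl := fun _ => Or.inl rfl
      symm := by
        rintro x y (h | h)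
        · exact Or.inl h.symm
        · exact Or.inr (by rw [h, neg_neg])
      trans := by
        rintro x y z (h | h) (h' | h')
        · exact Or.inl (h.trans h')
        · exact Or.inr (h.trans h')
        · exact Or.inr (by rw [h, h'])
        · exact Or.inl (by rw [h, h', neg_neg]) }

/-- `Cⁿ = ℝⁿ / ±1`, with the quotient topology. -/
def Cone (n : ℕ) : Type := Quotient (coneSetoid n)

instance : TopologicalSpace (Cone n) :=
  inferInstanceAs (TopologicalSpace (Quotient (coneSetoid n)))

/-- The class `[x] ∈ Cⁿ` of `x ∈ ℝⁿ`. -/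
def Cone.mk (x : Euc n) : Cone n := Quotient.mk (coneSetoid n) x

theorem Cone.mk_eq_iff {x y : Euc n} : Cone.mk x = Cone.mk y ↔ x = y ∨ x = -y :=
  Quotient.eq (r := coneSetoid n)

/-- Isometries act on `Cⁿ` through their linear parts, `γ [x] = [(p γ) x]`. -/
instance : MulAction (Isom n) (Cone n) where
  smul γ := Quotient.map (fun x => linearPart γ x) (by
    rintro x y (h | h)
    · exact Or.inl (by rw [h])
    · exact Or.inr (by rw [h, map_neg]))
  one_smul c := by
    induction c using Quotient.inductionOn with
    | h x => rfl
  mul_smul γ γ' c := by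
    induction c using Quotient.inductionOn with
    | h x => rfl

theorem smul_cone_mk (γ : Isom n) (x : Euc n) :
    γ • Cone.mk x = Cone.mk (linearPart γ x) := rfl

/-! ### Directions of translations, and lines having such a direction -/

section Model

variable (Γ : Subgroup (Isom n))

/-- The linear subspace `D` is one of the lines `ℝ h`, `0 ≠ h ∈ H`. -/
def IsDirection (D : Submodule ℝ (Euc n)) : Prop :=
  ∃ h ∈ translationVectors Γ, h ≠ 0 ∧ D = Submodule.span ℝ {h}

/-- The set `Λ` of translation directions.  The class of all lines parallel to `ℝ h` is
represented by its unique member `ℝ h` through the origin. -/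
def Direction : Type := {D : Submodule ℝ (Euc n) // IsDirection Γ D}

variable {Γ}

theorem map_span_singleton (J : Euc n ≃ₗᵢ[ℝ] Euc n) (h : Euc n) :
    (Submodule.span ℝ {h}).map (J.toLinearEquiv : Euc n →ₗ[ℝ] Euc n)
      = Submodule.span ℝ {J h} := by
  rw [Submodule.map_span, Set.image_singleton]
  rfl

theorem IsDirection.map {D : Submodule ℝ (Euc n)} (hD : IsDirection Γ D) (γ : Γ) :
    IsDirection Γ
      (D.map ((linearPart (γ : Isom n)).toLinearEquiv : Euc n →ₗ[ℝ] Euc n)) := by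
  obtain ⟨h, hh, h0, rfl⟩ := hD
  refine ⟨_, linearPart_mem Γ γ hh, ?_, map_span_singleton _ _⟩
  simpa using h0

/-- `Γ` acts on the directions by `γ (ℝ h) = ℝ (p γ) h`. -/
instance : MulAction Γ (Direction Γ) where
  smul γ D := ⟨D.1.map ((linearPart (γ : Isom n)).toLinearEquiv : Euc n →ₗ[ℝ] Euc n), D.2.map γ⟩
  one_smul D := Subtype.ext (Submodule.map_id D.1)
  mul_smul γ γ' D := Subtype.ext (Submodule.map_comp
    ((linearPart (γ' : Isom n)).toLinearEquiv : Euc n →ₗ[ℝ] Euc n)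
    ((linearPart (γ : Isom n)).toLinearEquiv : Euc n →ₗ[ℝ] Euc n) D.1)

theorem smul_direction_val (γ : Γ) (D : Direction Γ) : (γ • D).1 =
    D.1.map ((linearPart (γ : Isom n)).toLinearEquiv : Euc n →ₗ[ℝ] Euc n) := rfl

variable (Γ)

/-- An enumeration `Λ₁, Λ₂, …` (finite or infinite, without repetition) of the `Γ`-orbits of
directions, recorded as the function sending a direction to the number `k ≥ 1` of its orbit. -/
structure OrbitEnumeration where
  index : Direction Γ → ℕ
  one_le_index : ∀ D, 1 ≤ index D
  index_eq_iff : ∀ D D', index D = index D' ↔ D ∈ MulAction.orbit Γ D'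
  no_gaps : ∀ D k, 1 ≤ k → k ≤ index D → ∃ D', index D' = k

/-- The set `𝓛` of all (affine) lines in `ℝⁿ` which are parallel to `ℝ h` for some
`0 ≠ h ∈ H`. -/
def Line : Type :=
  {l : AffineSubspace ℝ (Euc n) // (l : Set (Euc n)).Nonempty ∧ IsDirection Γ l.direction}

variable {Γ}

/-- The direction of a line. -/
def Line.dir (l : Line Γ) : Direction Γ := ⟨l.1.direction, l.2.2⟩

/-- `Γ` maps the lines of `𝓛` to lines of `𝓛`. -/
def Line.map (γ : Γ) (l : Line Γ) : Line Γ :=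
  ⟨l.1.map ((γ : Isom n).toAffineEquiv : Euc n →ᵃ[ℝ] Euc n),
    by
      rw [AffineSubspace.coe_map]
      exact l.2.1.image _,
    by
      rw [AffineSubspace.map_direction]
      exact l.2.2.map γ⟩

theorem Line.dir_map (γ : Γ) (l : Line Γ) : (l.map γ).dir = γ • l.dir :=
  Subtype.ext (AffineSubspace.map_direction _ _)

theorem Line.smul_mem_map {γ : Γ} {l : Line Γ} {x : Euc n} (hx : x ∈ l.1) :
    γ • x ∈ (l.map γ).1 :=
  AffineSubspace.mem_map.2 ⟨x, hx, rfl⟩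

/-! ### The heights and the lifted lines -/

/-- The height `[k h / ‖h‖] ∈ Cⁿ` of the lines parallel to `ℝ h`, where `k` is the number of the
orbit of the direction `ℝ h`. -/
def OrbitEnumeration.height (e : OrbitEnumeration Γ) (D : Direction Γ) : Cone n :=
  Cone.mk (((e.index D : ℝ) / ‖D.2.choose‖) • D.2.choose)

/-- The height does not depend on the vector `h` spanning the direction. -/
theorem OrbitEnumeration.height_eq (e : OrbitEnumeration Γ) (D : Direction Γ) {h : Euc n}
    (h0 : h ≠ 0) (hD : D.1 = Submodule.span ℝ {h}) :
    e.height D = Cone.mk (((e.index D : ℝ) / ‖h‖) • h) := by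
  obtain ⟨-, g0, hg⟩ := D.2.choose_spec
  unfold OrbitEnumeration.height
  set g := D.2.choose with hgdef
  have hmem : g ∈ Submodule.span ℝ {h} := by
    rw [← hD, hg]
    exact Submodule.mem_span_singleton_self g
  obtain ⟨t, ht⟩ := Submodule.mem_span_singleton.1 hmem
  have t0 : t ≠ 0 := by
    rintro rfl
    exact g0 (by rw [← ht, zero_smul])
  have hn : ‖h‖ ≠ 0 := norm_ne_zero_iff.2 h0
  rw [← ht, norm_smul, smul_smul, Cone.mk_eq_iff, Real.norm_eq_abs]
  rcases lt_or_gt_of_ne t0 with ht' | ht'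
  · right
    rw [abs_of_neg ht', ← neg_smul]
    congr 1
    field_simp
  · left
    rw [abs_of_pos ht']
    congr 1
    field_simp

/-- Heights are equivariant. -/
theorem OrbitEnumeration.smul_height (e : OrbitEnumeration Γ) (γ : Γ) (D : Direction Γ) :
    γ • e.height D = e.height (γ • D) := by
  obtain ⟨h, -, h0, hD⟩ := D.2
  have hi : e.index (γ • D) = e.index D :=
    (e.index_eq_iff _ _).2 (MulAction.mem_orbit D γ)
  have hJ : (γ • D).1 = Submodule.span ℝ {linearPart (γ : Isom n) h} := by
    rw [smul_direction_val, hD, map_span_singleton]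
  rw [e.height_eq D h0 hD, e.height_eq (γ • D) (by simpa using h0) hJ, hi,
    LinearIsometryEquiv.norm_map]
  change (γ : Isom n) • (Cone.mk _ : Cone n) = _
  rw [smul_cone_mk, map_smul]

/-- The height determines the direction. -/
theorem OrbitEnumeration.height_injective (e : OrbitEnumeration Γ) :
    Function.Injective e.height := by
  intro D D' hDD
  obtain ⟨h, -, h0, hD⟩ := D.2
  obtain ⟨h', -, h0', hD'⟩ := D'.2
  rw [e.height_eq D h0 hD, e.height_eq D' h0' hD', Cone.mk_eq_iff] at hDD
  have c : IsUnit ((e.index D : ℝ) / ‖h‖) := by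
    have := e.one_le_index D
    exact IsUnit.mk0 _ (div_ne_zero (by exact_mod_cast (by omega)) (norm_ne_zero_iff.2 h0))
  have c' : IsUnit ((e.index D' : ℝ) / ‖h'‖) := by
    have := e.one_le_index D'
    exact IsUnit.mk0 _ (div_ne_zero (by exact_mod_cast (by omega)) (norm_ne_zero_iff.2 h0'))
  apply Subtype.ext
  rw [hD, hD', ← Submodule.span_singleton_smul_eq c h, ← Submodule.span_singleton_smul_eq c' h']
  rcases hDD with hDD | hDD
  · rw [hDD]
  · rw [hDD, ← Set.neg_singleton, Submodule.span_neg]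

/-- The lifted line `{c(l)} × l ⊆ Cⁿ × ℝⁿ`. -/
def OrbitEnumeration.liftedLine (e : OrbitEnumeration Γ) (l : Line Γ) : Set (Cone n × Euc n) :=
  {e.height l.dir} ×ˢ (l.1 : Set (Euc n))

/-- Distinct lifted lines are disjoint. -/
theorem OrbitEnumeration.line_eq_of_mem (e : OrbitEnumeration Γ) {l l' : Line Γ}
    {x : Cone n × Euc n} (hx : x ∈ e.liftedLine l) (hx' : x ∈ e.liftedLine l') : l = l' := by
  have hd : l.dir = l'.dir := e.height_injective (hx.1.symm.trans hx'.1)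
  exact Subtype.ext
    ((AffineSubspace.eq_iff_direction_eq_of_mem hx.2 hx'.2).2 (congrArg Subtype.val hd))

theorem OrbitEnumeration.smul_mem_liftedLine (e : OrbitEnumeration Γ) (γ : Γ) {l : Line Γ}
    {x : Cone n × Euc n} (hx : x ∈ e.liftedLine l) : γ • x ∈ e.liftedLine (l.map γ) := by
  refine ⟨?_, Line.smul_mem_map hx.2⟩
  change γ • x.1 = e.height _
  rw [Line.dir_map, ← e.smul_height]
  exact congrArg (fun c => γ • c) hx.1

/-! ### The space `A` -/

/-- `x ≅ y` if `x = y` or `x` and `y` lie on the same lifted line. -/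
def OrbitEnumeration.setoid (e : OrbitEnumeration Γ) : Setoid (Cone n × Euc n) where
  r x y := x = y ∨ ∃ l : Line Γ, x ∈ e.liftedLine l ∧ y ∈ e.liftedLine l
  iseqv :=
    { refl := fun _ => Or.inl rfl
      symm := by
        rintro x y (h | ⟨l, h, h'⟩)
        · exact Or.inl h.symm
        · exact Or.inr ⟨l, h', h⟩
      trans := by
        rintro x y z (rfl | ⟨l, h, h'⟩) (rfl | ⟨l', k, k'⟩)
        · exact Or.inl rfl
        · exact Or.inr ⟨l', k, k'⟩
        · exact Or.inr ⟨l, h, h'⟩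
        · obtain rfl := e.line_eq_of_mem h' k
          exact Or.inr ⟨l, h, k'⟩ }

/-- The space `A`: the quotient of `Cⁿ × ℝⁿ`, with the quotient topology, obtained by collapsing
every lifted line to a point. -/
def ModelSpace (e : OrbitEnumeration Γ) : Type := Quotient e.setoid

instance (e : OrbitEnumeration Γ) : TopologicalSpace (ModelSpace e) :=
  inferInstanceAs (TopologicalSpace (Quotient e.setoid))

/-- The collapsing map `Cⁿ × ℝⁿ → A`. -/
def ModelSpace.mk (e : OrbitEnumeration Γ) (x : Cone n × Euc n) : ModelSpace e :=
  Quotient.mk e.setoid x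

/-- The action of `Γ` on `A` induced by the diagonal action on `Cⁿ × ℝⁿ`. -/
instance (e : OrbitEnumeration Γ) : MulAction Γ (ModelSpace e) where
  smul γ := Quotient.map (fun x => γ • x) (by
    rintro x y (h | ⟨l, h, h'⟩)
    · exact Or.inl (by rw [h])
    · exact Or.inr ⟨l.map γ, e.smul_mem_liftedLine γ h, e.smul_mem_liftedLine γ h'⟩)
  one_smul a := by
    induction a using Quotient.inductionOn with
    | h x => exact congrArg (Quotient.mk e.setoid) (one_smul Γ x)
  mul_smul γ γ' a := by
    induction a using Quotient.inductionOn with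
    | h x => exact congrArg (Quotient.mk e.setoid) (mul_smul γ γ' x)

theorem ModelSpace.smul_mk (e : OrbitEnumeration Γ) (γ : Γ) (x : Cone n × Euc n) :
    γ • ModelSpace.mk e x = ModelSpace.mk e (γ • x) := rfl

end Model

end Crystal

end

/-! Isotropy groups. Off the lifted lines, a point of `A` is fixed only by elements fixing a point
of Euclidean space, and proper discontinuity leaves finitely many of these. A collapsed line is
stabilised by elements preserving a line along which some translation of `Γ` acts; modulo that
translation only finitely many remain (`IsCrystallographic.isVirtuallyCyclic_of_line`).

Fixed sets. A finite group fixes some `y₀`, an average of an orbit; the fixed set contracts by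
sliding the Euclidean coordinate to `y₀` and then shrinking the cone coordinate to the apex. An
infinite virtually cyclic group contains a translation by some `h ≠ 0` generating a subgroup of
finite index. This translation fixes only collapsed lines parallel to `h`, which all have the same
height. Averaging modulo `h` gives one line fixed by the whole group, and the lines fixed by it form
a convex family.

CW structure. Bieberbach's theorem (finitely many linear parts, translations spanning) yields a
finite family `T` of functionals, stable under the linear parts and integral on all translation
vectors and on all displacements of a suitable origin (`IsCrystallographic.exists_functionals`). A
radial rescaling turns the heights into translation vectors, so `A` becomes a quotient of `E × E`
(`CollapseModel`): `(u, y)` is identified with `(-u, y)`, and lines are collapsed over a set `Z` of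
points at which `T` is integral. The hyperplanes on which a functional is an integer cut `E × E`
into bounded convex boxes. Boxes not over `Z` give cells directly; over `z ∈ Z` the lines parallel
to `z` are parametrised by the orthogonal complement of `z`, which is cut up by functionals derived
from `T`. Using the differences `T - T` makes the action rigid: an affine map with linear part of
finite order which returns a point to its own box fixes the point (`map_add_eq_of_mem_openBox`).
Local finiteness gives the weak topology. -/

namespace Crystal

open Set Topology Metric

/-! ### CW structures from cell decompositions, and fixed sets as subcomplexes -/

/-- A decomposition of a Hausdorff space into cells, given by a family of sets `c i` of dimension
`d i` which has repetitions, yields a CW structure. -/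
theorem exists_cwComplex_of_cells {X : Type*} [TopologicalSpace X] [T2Space X] {ι : Type*}
    (c : ι → Set X) (d : ι → ℕ)
    (hdisj : ∀ i j, (c i ∩ c j).Nonempty → c i = c j ∧ d i = d j)
    (hcover : ∀ x, ∃ i, x ∈ c i)
    (hchar : ∀ i, ∃ f : (Fin (d i) → ℝ) → X, ContinuousOn f (closedBall 0 1) ∧
      InjOn f (ball 0 1) ∧ f '' ball 0 1 = c i ∧
      ∃ J : Set ι, (c '' J).Finite ∧ (∀ j ∈ J, d j < d i) ∧ f '' sphere 0 1 ⊆ ⋃ j ∈ J, c j)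
    (hweak : ∀ B : Set X, (∀ i, IsClosed (B ∩ closure (c i))) → IsClosed B) :
    ∃ _K : CWComplex (univ : Set X),
      (∀ k (a : RelCWComplex.cell (univ : Set X) k),
        ∃ i, d i = k ∧ RelCWComplex.openCell k a = c i) ∧
      (∀ i, ∃ a : RelCWComplex.cell (univ : Set X) (d i), RelCWComplex.openCell (d i) a = c i) := by
  classical
  -- Cells of dimension `k` are indexed by the sets themselves rather than by `ι`; this removes the
  -- repetitions.
  have hchar' : ∀ k, ∀ S : {S : Set X // ∃ i, d i = k ∧ c i = S},
      ∃ f : (Fin k → ℝ) → X, ContinuousOn f (closedBall 0 1) ∧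
      InjOn f (ball 0 1) ∧ f '' ball 0 1 = S.1 ∧
      ∃ J : Set ι, (c '' J).Finite ∧ (∀ j ∈ J, d j < k) ∧ f '' sphere 0 1 ⊆ ⋃ j ∈ J, c j := by
    rintro k ⟨S, i, rfl, rfl⟩
    exact hchar i
  choose f hcont hinj himg J hJfin hJlt hJ using hchar'
  have hclosed : ∀ k S, f k S '' closedBall 0 1 = closure S.1 := by
    intro k S
    refine Subset.antisymm ?_ ?_
    · rw [← himg k S, ← closure_ball (0 : Fin k → ℝ) one_ne_zero]
      exact ContinuousOn.image_closure (by
        rw [closure_ball (0 : Fin k → ℝ) one_ne_zero]; exact hcont k S)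
    · refine closure_minimal ?_ ((isCompact_closedBall _ _).image_of_continuousOn
        (hcont k S)).isClosed
      rw [← himg k S]
      exact image_mono ball_subset_closedBall
  have hoff : ∀ k S x, x ∈ sphere (0 : Fin k → ℝ) 1 → f k S x ∉ S.1 := by
    rintro k ⟨S, i, rfl, rfl⟩ x hx hxS
    obtain ⟨j, hj⟩ := mem_iUnion.1 (hJ _ _ (mem_image_of_mem _ hx))
    obtain ⟨hjJ, hj⟩ := mem_iUnion.1 hj
    have := (hdisj _ _ ⟨_, hxS, hj⟩).2
    exact absurd (hJlt _ _ _ hjJ) (by omega)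
  -- The image of a closed subset of the closed ball is compact, hence closed. Restricting it to the
  -- open cell loses exactly the sphere points, since `hoff` keeps these out of the cell.
  have hinv : ∀ k S, ContinuousOn ((hinj k S).toPartialEquiv (f k S) _).symm
      ((hinj k S).toPartialEquiv (f k S) _).target := by
    intro k S
    rw [continuousOn_iff_isClosed]
    intro t ht
    refine ⟨f k S '' (t ∩ closedBall 0 1), ?_, ?_⟩
    · exact (((isCompact_closedBall _ _).inter_left ht).image_of_continuousOn
        ((hcont k S).mono inter_subset_right)).isClosed
    · ext y
      constructor
      · rintro ⟨hy1, hy2⟩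
        refine ⟨⟨_, ⟨hy1, ball_subset_closedBall
          (((hinj k S).toPartialEquiv (f k S) _).map_target hy2)⟩, ?_⟩, hy2⟩
        exact ((hinj k S).toPartialEquiv (f k S) _).right_inv hy2
      · rintro ⟨⟨x, ⟨hxt, hxb⟩, rfl⟩, hy2⟩
        refine ⟨?_, hy2⟩
        have hxb' : x ∈ ball (0 : Fin k → ℝ) 1 := by
          by_contra hx
          refine hoff k S x ?_ ?_
          · rw [mem_sphere]
            exact le_antisymm hxb (not_lt.1 hx)
          · rw [← himg k S]; exact hy2
        have := ((hinj k S).toPartialEquiv (f k S) _).left_inv hxb'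
        change ((hinj k S).toPartialEquiv (f k S) _).symm (f k S x) ∈ t
        exact mem_of_eq_of_mem this hxt
  let K : CWComplex (univ : Set X) :=
    { cell := fun k => {S : Set X // ∃ i, d i = k ∧ c i = S}
      map := fun k S => (hinj k S).toPartialEquiv (f k S) _
      source_eq := fun k S => rfl
      continuousOn := hcont
      continuousOn_symm := hinv
      pairwiseDisjoint' := by
        rintro ⟨k, S, i, rfl, rfl⟩ - ⟨k', S', i', rfl, rfl⟩ - hne
        refine disjoint_iff_inter_eq_empty.2 (not_nonempty_iff_eq_empty.1 fun h => hne ?_)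
        change ((f _ _ '' ball 0 1) ∩ (f _ _ '' ball 0 1)).Nonempty at h
        rw [himg, himg] at h
        obtain ⟨h1, h2⟩ := hdisj _ _ h
        exact Sigma.subtype_ext h2 h1
      mapsTo' := by
        intro k S
        have hfin : ∀ m, {s : {S : Set X // ∃ i, d i = m ∧ c i = S} | s.1 ∈ c '' J k S}.Finite :=
          fun m => (hJfin k S).preimage Subtype.val_injective.injOn
        refine ⟨fun m => (hfin m).toFinset, fun x hx => ?_⟩
        obtain ⟨j, hj⟩ := mem_iUnion.1 (hJ _ _ (mem_image_of_mem (f k S) hx))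
        obtain ⟨hjJ, hj⟩ := mem_iUnion.1 hj
        simp only [mem_iUnion]
        refine ⟨d j, hJlt _ _ _ hjJ, ⟨c j, j, rfl, rfl⟩, ?_, ?_⟩
        · simpa using ⟨j, hjJ, rfl⟩
        · change _ ∈ f _ _ '' closedBall 0 1
          rw [hclosed]
          exact subset_closure hj
      closed' := by
        intro B _ hB
        refine hweak B fun i => ?_
        have := hB (d i) ⟨c i, i, rfl, rfl⟩
        change IsClosed (B ∩ f _ _ '' closedBall 0 1) at this
        rwa [hclosed] at this
      union' := by
        refine eq_univ_of_forall fun x => ?_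
        obtain ⟨i, hi⟩ := hcover x
        simp only [mem_iUnion]
        refine ⟨d i, ⟨c i, i, rfl, rfl⟩, ?_⟩
        change _ ∈ f _ _ '' closedBall 0 1
        rw [hclosed]
        exact subset_closure hi }
  refine ⟨K, ?_, ?_⟩
  · rintro k ⟨S, i, rfl, rfl⟩
    exact ⟨i, rfl, himg _ _⟩
  · intro i
    exact ⟨⟨c i, i, rfl, rfl⟩, himg _ _⟩

/-- For a cellular action by homeomorphisms, all fixed point sets are subcomplexes. -/
theorem IsCellularAction.exists_subcomplex {G X : Type*} [Group G] [TopologicalSpace X]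
    [T2Space X] [MulAction G X] [ContinuousConstSMul G X] [CWComplex (univ : Set X)]
    (h : IsCellularAction G X) (V : Subgroup G) :
    ∃ S : CWComplex.Subcomplex (univ : Set X), (S : Set X) = MulAction.fixedPoints V X := by
  -- If an element of `V` fixes a point of an open cell, the image cell shares this point with the
  -- cell, so the two coincide by disjointness and cellularity makes the element fix the whole cell.
  have hfix : ∀ k (i : RelCWComplex.cell (univ : Set X) k) (x : X),
      x ∈ RelCWComplex.openCell k i → x ∈ MulAction.fixedPoints V X →
      RelCWComplex.openCell k i ⊆ MulAction.fixedPoints V X := by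
    intro k i x hx hxV y hy g
    obtain ⟨⟨j, hj⟩, hg⟩ := h (g : G) k i
    refine hg ?_ y hy
    have hxj : x ∈ RelCWComplex.openCell k j := by
      rw [← hj]
      exact ⟨x, hx, hxV g⟩
    rw [hj]
    by_cases hij : j = i
    · rw [hij]
    · exact (disjoint_left.1 (RelCWComplex.disjoint_openCell_of_ne (C := univ)
        (by simpa using hij)) hxj hx).elim
  refine ⟨⟨MulAction.fixedPoints V X,
    fun k => {i | RelCWComplex.openCell k i ⊆ MulAction.fixedPoints V X}, ?_, ?_⟩, rfl⟩
  · have : MulAction.fixedPoints V X = ⋂ g : V, {x : X | (g : G) • x = x} := by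
      ext x; simp [MulAction.mem_fixedPoints]
    rw [this]
    exact isClosed_iInter fun g => isClosed_eq (continuous_const_smul _) continuous_id
  · rw [empty_union]
    refine Subset.antisymm ?_ ?_
    · simp only [iUnion_subset_iff]
      exact fun k i => i.2
    · intro x hx
      have : x ∈ (univ : Set X) := mem_univ x
      rw [← CWComplex.iUnion_openCell_eq_complex (C := (univ : Set X))] at this
      simp only [mem_iUnion] at this ⊢
      obtain ⟨k, i, hi⟩ := this
      exact ⟨k, ⟨i, hfix k i x hi hx⟩, hi⟩

end Crystal

namespace Crystal

open Set Topology Metric Module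
open scoped Pointwise

/-! ### Boxes of an integral hyperplane arrangement -/

section Box

variable {E : Type*} [NormedAddCommGroup E] [NormedSpace ℝ E]

/-- The open cell of `x` in the arrangement of all hyperplanes `f = k`, `f ∈ F`, `k ∈ ℤ`. -/
def openBox (F : Set (Dual ℝ E)) (x : E) : Set E :=
  {y | ∀ f ∈ F, ⌊f y⌋ = ⌊f x⌋ ∧ ⌈f y⌉ = ⌈f x⌉}

/-- The direction of the affine span of `openBox F x`. -/
def dirSpace (F : Set (Dual ℝ E)) (x : E) : Submodule ℝ E where
  carrier := {w | ∀ f ∈ F, (∃ k : ℤ, f x = k) → f w = 0}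
  zero_mem' := fun f _ _ => map_zero f
  add_mem' := fun ha hb f hf hk => by rw [map_add, ha f hf hk, hb f hf hk, add_zero]
  smul_mem' := fun c a ha f hf hk => by rw [map_smul, ha f hf hk, smul_zero]

/-- The dimension of `openBox F x`. -/
noncomputable def boxDim (F : Set (Dual ℝ E)) (x : E) : ℕ := finrank ℝ (dirSpace F x)

/-- The functionals in `F` separate the points of `E`. -/
def Separating (F : Set (Dual ℝ E)) : Prop := ∀ w, (∀ f ∈ F, f w = 0) → w = 0

variable {F F' T : Set (Dual ℝ E)} {x y z : E}

theorem Separating.mono (hF : Separating F) (h : F ⊆ F') : Separating F' :=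
  fun w hw => hF w fun f hf => hw f (h hf)

theorem subset_sub_self (h : 0 ∈ T) : T ⊆ T - T :=
  fun f hf => ⟨f, hf, 0, h, sub_zero f⟩

theorem comp_mem_sub_self {E' : Type*} [NormedAddCommGroup E'] [NormedSpace ℝ E']
    {T' : Set (Dual ℝ E')} {L : E →ₗ[ℝ] E'} (h : ∀ f ∈ T', f ∘ₗ L ∈ T) :
    ∀ f ∈ T' - T', f ∘ₗ L ∈ T - T := by
  rintro _ ⟨f, hf, g, hg, rfl⟩
  exact ⟨_, h f hf, _, h g hg, by ext; simp⟩

theorem exists_int_of_mem_sub_self (h : ∀ f ∈ T, ∃ k : ℤ, f x = k) :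
    ∀ f ∈ T - T, ∃ k : ℤ, f x = k := by
  rintro _ ⟨f, hf, g, hg, rfl⟩
  obtain ⟨k, hk⟩ := h f hf
  obtain ⟨l, hl⟩ := h g hg
  exact ⟨k - l, by simp [hk, hl]⟩

theorem mem_openBox_self : x ∈ openBox F x := fun _ _ => ⟨rfl, rfl⟩

theorem openBox_eq_of_mem (h : y ∈ openBox F x) : openBox F y = openBox F x := by
  ext z
  exact ⟨fun hz f hf => ⟨(hz f hf).1.trans (h f hf).1, (hz f hf).2.trans (h f hf).2⟩,
    fun hz f hf => ⟨(hz f hf).1.trans (h f hf).1.symm, (hz f hf).2.trans (h f hf).2.symm⟩⟩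

theorem eq_int_iff_of_floor_ceil {s t : ℝ} (h1 : ⌊s⌋ = ⌊t⌋) (h2 : ⌈s⌉ = ⌈t⌉) (k : ℤ) :
    s = k ↔ t = k := by
  constructor
  · rintro rfl
    simp only [Int.floor_intCast, Int.ceil_intCast] at h1 h2
    exact le_antisymm (Int.ceil_le.1 h2.ge) (Int.le_floor.1 h1.le)
  · rintro rfl
    simp only [Int.floor_intCast, Int.ceil_intCast] at h1 h2
    exact le_antisymm (Int.ceil_le.1 h2.le) (Int.le_floor.1 h1.ge)

theorem boxDim_eq_of_mem (h : y ∈ openBox F x) : boxDim F y = boxDim F x := by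
  suffices dirSpace F y = dirSpace F x by rw [boxDim, boxDim, this]
  ext w
  have (f) (hf : f ∈ F) : (∃ k : ℤ, f y = k) ↔ ∃ k : ℤ, f x = k :=
    exists_congr fun k => eq_int_iff_of_floor_ceil (h f hf).1 (h f hf).2 k
  exact forall₂_congr fun f hf => by rw [this f hf]

theorem abs_sub_le_one_of_floor {s t : ℝ} (h1 : ⌊s⌋ = ⌊t⌋) : |s - t| ≤ 1 := by
  have a1 := Int.floor_le s
  have a2 := Int.lt_floor_add_one s
  have b1 := Int.floor_le t
  have b2 := Int.lt_floor_add_one t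
  rw [h1] at a1 a2
  rw [abs_le]
  constructor <;> linarith

theorem convex_openBox (F : Set (Dual ℝ E)) (x : E) : Convex ℝ (openBox F x) := by
  have : openBox F x = ⋂ f ∈ F, f ⁻¹' (Int.floor ⁻¹' {⌊f x⌋} ∩ Int.ceil ⁻¹' {⌈f x⌉}) := by
    ext y; simp [openBox, Int.floor_eq_iff, Int.ceil_eq_iff]
  rw [this]
  refine convex_iInter₂ fun f _ => Convex.linear_preimage ?_ f
  rw [Int.preimage_floor_singleton, Int.preimage_ceil_singleton]
  exact (convex_Ico _ _).inter (convex_Ioc _ _)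

theorem sub_mem_dirSpace (h : y ∈ openBox F x) : y - x ∈ dirSpace F x := by
  rintro f hf ⟨k, hk⟩
  rw [map_sub, hk, (eq_int_iff_of_floor_ceil (h f hf).1 (h f hf).2 k).2 hk, sub_self]

/-- Functionals integral at `x` do not see `w`, and the others only impose strict inequalities. For
finite `F` this makes the box relatively open in `x + dirSpace F x`. -/
theorem add_mem_openBox_iff {w : E} (hw : w ∈ dirSpace F x) :
    x + w ∈ openBox F x ↔ ∀ f ∈ F, (¬ ∃ k : ℤ, f x = k) →
      f x + f w ∈ Ioo (⌊f x⌋ : ℝ) ⌈f x⌉ := by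
  have key (f : Dual ℝ E) (hk : ¬ ∃ k : ℤ, f x = k) : ⌈f x⌉ = ⌊f x⌋ + 1 := by
    refine (Int.ceil_eq_floor_add_one_iff_notMem _).2 ?_
    rintro ⟨k, hk'⟩
    exact hk ⟨k, hk'.symm⟩
  constructor
  · intro h f hf hk
    have h1 := (h f hf).1
    have h2 := (h f hf).2
    rw [map_add] at h1 h2
    constructor
    · refine lt_of_le_of_ne (h1 ▸ Int.floor_le _) fun h => hk ⟨⌊f x⌋, ?_⟩
      exact (eq_int_iff_of_floor_ceil h1 h2 _).1 h.symm
    · refine lt_of_le_of_ne (h2 ▸ Int.le_ceil _) fun h => hk ⟨⌈f x⌉, ?_⟩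
      exact (eq_int_iff_of_floor_ceil h1 h2 _).1 h
  · intro h f hf
    rw [map_add]
    by_cases hk : ∃ k : ℤ, f x = k
    · rw [hw f hf hk, add_zero]
      exact ⟨rfl, rfl⟩
    · have := h f hf hk
      rw [key f hk] at this
      push_cast at this
      rw [key f hk, Int.floor_eq_iff, Int.ceil_eq_iff]
      push_cast
      exact ⟨⟨this.1.le, this.2⟩, by linarith [this.1], this.2.le⟩

section Finite

variable [FiniteDimensional ℝ E]

theorem isBounded_of_separating (hfin : F.Finite) (hF : Separating F) (C : ℝ) :
    Bornology.IsBounded {w : E | ∀ f ∈ F, |f w| ≤ C} := by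
  have := hfin.fintype
  let Λ : E →ₗ[ℝ] (F → ℝ) := LinearMap.pi fun f => f.1
  have hker : LinearMap.ker Λ = ⊥ := by
    rw [LinearMap.ker_eq_bot']
    exact fun w hw => hF w fun f hf => congrFun hw ⟨f, hf⟩
  obtain ⟨K, -, hK⟩ := LinearMap.exists_antilipschitzWith Λ hker
  refine (hK.isBounded_preimage (isBounded_closedBall (x := (0 : F → ℝ)) (r := |C|))).subset ?_
  intro w hw
  rw [mem_preimage, mem_closedBall_zero_iff, pi_norm_le_iff_of_nonneg (abs_nonneg C)]
  exact fun f => (hw f.1 f.2).trans (le_abs_self C)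

theorem isBounded_openBox (hfin : F.Finite) (hF : Separating F) (x : E) :
    Bornology.IsBounded (openBox F x) := by
  refine ((isBounded_of_separating hfin hF 1).vadd x).subset fun y hy => ?_
  refine ⟨y - x, fun f hf => ?_, by simp⟩
  rw [map_sub]
  exact abs_sub_le_one_of_floor (hy f hf).1

/-- Open boxes are open cells. -/
theorem exists_charMap (hfin : F.Finite) (hF : Separating F) (x : E) :
    ∃ f : (Fin (boxDim F x) → ℝ) → E, Continuous f ∧ Function.Injective f ∧
      f '' ball 0 1 = openBox F x ∧ f '' sphere 0 1 ⊆ closure (openBox F x) \ openBox F x := by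
  set k := boxDim F x
  have e : (Fin k → ℝ) ≃L[ℝ] dirSpace F x := ContinuousLinearEquiv.ofFinrankEq (by rw [finrank_fin_fun]; rfl)
  let j : (Fin k → ℝ) →ₗ[ℝ] E := (dirSpace F x).subtype ∘ₗ (e : (Fin k → ℝ) →ₗ[ℝ] dirSpace F x)
  have hj : Function.Injective j := Subtype.val_injective.comp e.injective
  have hjc : Continuous j := LinearMap.continuous_of_finiteDimensional j
  have hjmem (w) : j w ∈ dirSpace F x := (e w).2
  have hjsurj (w) (hw : w ∈ dirSpace F x) : ∃ v, j v = w :=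
    ⟨e.symm ⟨w, hw⟩, by simp [j]⟩
  -- In linear coordinates on `dirSpace F x` the box is a bounded convex open neighbourhood of the
  -- origin. Some homeomorphism of the coordinate space therefore takes it to the unit ball and its
  -- frontier to the sphere.
  let S : Set (Fin k → ℝ) := {w | x + j w ∈ openBox F x}
  have hSopen : IsOpen S := by
    have : S = ⋂ f ∈ F, {w | (¬ ∃ k : ℤ, f x = k) →
        f x + f (j w) ∈ Ioo (⌊f x⌋ : ℝ) ⌈f x⌉} := by
      ext w
      simp only [S, mem_ofPred_eq, mem_iInter]
      exact add_mem_openBox_iff (hjmem w)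
    rw [this]
    refine hfin.isOpen_biInter fun f _ => ?_
    by_cases hk : ∃ k : ℤ, f x = k
    · simp [hk]
    · simp only [hk, not_false_eq_true, forall_const]
      exact isOpen_Ioo.preimage (continuous_const.add
        ((LinearMap.continuous_of_finiteDimensional f).comp hjc))
  have hSconv : Convex ℝ S := by
    have : S = j ⁻¹' ((fun y => x + y) ⁻¹' openBox F x) := rfl
    rw [this]
    exact ((convex_openBox F x).translate_preimage_right x).linear_preimage j
  have hSb : Bornology.IsBounded S := by
    obtain ⟨K, -, hK⟩ := LinearMap.exists_antilipschitzWith j (LinearMap.ker_eq_bot.2 hj)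
    refine (hK.isBounded_preimage ((isBounded_openBox hfin hF x).vadd (-x))).subset ?_
    intro w hw
    exact ⟨x + j w, hw, by simp⟩
  have h0 : (0 : Fin k → ℝ) ∈ S := by
    change x + j 0 ∈ openBox F x
    rw [map_zero, add_zero]
    exact mem_openBox_self
  obtain ⟨h, h1, h2, h3⟩ := exists_homeomorph_image_interior_closure_frontier_eq_unitBall hSconv
    (by rw [hSopen.interior_eq]; exact ⟨0, h0⟩) hSb
  rw [hSopen.interior_eq] at h1
  let φ : (Fin k → ℝ) → E := fun v => x + j v
  have hφc : Continuous φ := continuous_const.add hjc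
  have hφS : φ '' S = openBox F x := by
    refine Subset.antisymm (by rintro _ ⟨w, hw, rfl⟩; exact hw) fun y hy => ?_
    obtain ⟨v, hv⟩ := hjsurj _ (sub_mem_dirSpace hy)
    have : φ v = y := by simp [φ, hv]
    exact ⟨v, by change φ v ∈ openBox F x; rwa [this], this⟩
  have hcomp (U V : Set (Fin k → ℝ)) (hUV : h '' U = V) : (φ ∘ h.symm) '' V = φ '' U := by
    rw [← hUV, image_comp, image_image h.symm]
    simp
  refine ⟨φ ∘ h.symm, hφc.comp h.symm.continuous, ?_, ?_, ?_⟩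
  · exact ((add_right_injective x).comp hj).comp h.symm.injective
  · rw [hcomp _ _ h1, hφS]
  · rw [hcomp _ _ h3]
    rintro _ ⟨v, hv, rfl⟩
    rw [hSopen.frontier_eq] at hv
    refine ⟨?_, hv.2⟩
    rw [← hφS]
    exact image_closure_subset_closure_image hφc ⟨v, hv.1, rfl⟩

theorem mem_Icc_of_mem_closure {f : Dual ℝ E} (hf : f ∈ F) (hy : y ∈ closure (openBox F x)) :
    f y ∈ Icc (⌊f x⌋ : ℝ) ⌈f x⌉ := by
  have hc : IsClosed (f ⁻¹' Icc (⌊f x⌋ : ℝ) ⌈f x⌉) :=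
    isClosed_Icc.preimage (LinearMap.continuous_of_finiteDimensional f)
  refine closure_minimal (fun z hz => ?_) hc hy
  exact ⟨(hz f hf).1 ▸ Int.floor_le _, (hz f hf).2 ▸ Int.le_ceil _⟩

theorem eq_int_of_mem_closure {f : Dual ℝ E} (hf : f ∈ F) (hy : y ∈ closure (openBox F x))
    {k : ℤ} (hk : f x = k) : f y = k := by
  have := mem_Icc_of_mem_closure hf hy
  rw [hk] at this
  simpa using this

/-- The boundary of an open box consists of points with boxes of smaller dimension. -/
theorem boxDim_lt (hy : y ∈ closure (openBox F x)) (hyx : y ∉ openBox F x) :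
    boxDim F y < boxDim F x := by
  have hle : dirSpace F y ≤ dirSpace F x := by
    rintro w hw f hf ⟨k, hk⟩
    exact hw f hf ⟨k, eq_int_of_mem_closure hf hy hk⟩
  -- If the two direction spaces agreed, any `f` integral at `y` would vanish on `y - x` and so be
  -- integral at `x`. The weak bounds valid on the closure would then be strict wherever `x` needs
  -- it, putting `y` into the box.
  refine Submodule.finrank_lt_finrank_of_lt (lt_of_le_of_ne hle fun heq => hyx ?_)
  have hmem : y - x ∈ dirSpace F x := by
    rintro f hf ⟨k, hk⟩
    rw [map_sub, hk, eq_int_of_mem_closure hf hy hk, sub_self]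
  rw [← add_sub_cancel x y, add_mem_openBox_iff hmem]
  intro f hf hk
  have h1 := mem_Icc_of_mem_closure hf hy
  have h2 : ¬ ∃ k : ℤ, f y = k := by
    rintro ⟨k, hk'⟩
    have := (heq ▸ hmem : y - x ∈ dirSpace F y) f hf ⟨k, hk'⟩
    rw [map_sub, sub_eq_zero] at this
    exact hk ⟨k, this ▸ hk'⟩
  rw [map_sub, add_sub_cancel]
  exact ⟨lt_of_le_of_ne h1.1 fun h => h2 ⟨_, h.symm⟩, lt_of_le_of_ne h1.2 fun h => h2 ⟨_, h⟩⟩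

/-- A bounded set meets only finitely many open boxes. -/
theorem finite_image_openBox (hfin : F.Finite) {B : Set E} (hB : Bornology.IsBounded B) :
    (openBox F '' B).Finite := by
  have := hfin.fintype
  -- A box is determined by the integers recorded in `pat`, and these are bounded on a bounded set.
  let pat : E → F → ℤ × ℤ := fun x f => (⌊f.1 x⌋, ⌈f.1 x⌉)
  have hpat : (pat '' B).Finite := by
    have hf (f : F) : ∃ C : ℤ, ∀ x ∈ B, |f.1 x| ≤ C := by
      let g : E →L[ℝ] ℝ := LinearMap.toContinuousLinearMap f.1
      obtain ⟨R, hR⟩ := hB.exists_norm_le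
      refine ⟨⌈‖g‖ * R⌉, fun x hx => ((g.le_opNorm x).trans ?_).trans (Int.le_ceil _)⟩
      exact mul_le_mul_of_nonneg_left (hR x hx) (norm_nonneg g)
    choose C hC using hf
    refine (Set.Finite.pi' (t := fun f : F => Icc (-C f) (C f) ×ˢ Icc (-C f) (C f))
      fun f => (finite_Icc _ _).prod (finite_Icc _ _)).subset ?_
    rintro _ ⟨x, hx, rfl⟩ f
    have := abs_le.1 (hC f x hx)
    refine ⟨⟨?_, ?_⟩, ?_, ?_⟩
    · exact Int.le_floor.2 (by push_cast; exact this.1)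
    · exact Int.floor_le_iff.2 (by linarith [this.2])
    · exact Int.le_ceil_iff.2 (by push_cast; linarith [this.1])
    · exact Int.ceil_le.2 this.2
  refine Set.Finite.subset (hpat.image fun p => {y | ∀ f : F, ⌊f.1 y⌋ = (p f).1 ∧
    ⌈f.1 y⌉ = (p f).2}) ?_
  rintro _ ⟨x, hx, rfl⟩
  refine ⟨pat x, ⟨x, hx, rfl⟩, ?_⟩
  ext y
  simp [openBox, pat]

end Finite

/-- A point at which all functionals in a separating family are integral is a vertex. -/
theorem eq_of_mem_openBox_of_int (hF : Separating F) (hx : ∀ f ∈ F, ∃ k : ℤ, f x = k)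
    (hy : y ∈ openBox F x) : y = x := by
  refine sub_eq_zero.1 (hF _ fun f hf => ?_)
  exact sub_mem_dirSpace hy f hf (hx f hf)

section Equivariance

variable {E' : Type*} [NormedAddCommGroup E'] [NormedSpace ℝ E'] {G : Set (Dual ℝ E')}

theorem map_add_mem_openBox {L : E →ₗ[ℝ] E'} {m : E'} (hL : ∀ f ∈ G, f ∘ₗ L ∈ F)
    (hm : ∀ f ∈ G, ∃ k : ℤ, f m = k) (h : y ∈ openBox F x) :
    L y + m ∈ openBox G (L x + m) := by
  intro f hf
  obtain ⟨k, hk⟩ := hm f hf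
  have := h _ (hL f hf)
  simp only [LinearMap.comp_apply] at this
  simp [hk, this]

/-- An integral translation shifts every floor and ceiling by the same integer, and the linear part
exchanges the two families of functionals; the inverse affine map has the same form. -/
theorem openBox_image (L : E ≃ₗ[ℝ] E') {m : E'} (hL : ∀ f ∈ G, f ∘ₗ (L : E →ₗ[ℝ] E') ∈ F)
    (hL' : ∀ f ∈ F, f ∘ₗ (L.symm : E' →ₗ[ℝ] E) ∈ G)
    (hm : ∀ f ∈ G, ∃ k : ℤ, f m = k) (x : E) :
    (fun y => L y + m) '' openBox F x = openBox G (L x + m) := by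
  refine Subset.antisymm ?_ fun z hz => ⟨L.symm z - L.symm m, ?_, by simp⟩
  · rintro _ ⟨y, hy, rfl⟩
    exact map_add_mem_openBox (L := (L : E →ₗ[ℝ] E')) hL hm hy
  · have hm' : ∀ f ∈ F, ∃ k : ℤ, f (-L.symm m) = k := by
      intro f hf
      obtain ⟨k, hk⟩ := hm _ (hL' f hf)
      exact ⟨-k, by simpa using hk⟩
    have := map_add_mem_openBox (L := (L.symm : E' →ₗ[ℝ] E)) hL' hm' hz
    simpa [sub_eq_add_neg] using this

theorem boxDim_image (L : E ≃ₗ[ℝ] E') {m : E'}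
    (hL : ∀ f ∈ G, f ∘ₗ (L : E →ₗ[ℝ] E') ∈ F)
    (hL' : ∀ f ∈ F, f ∘ₗ (L.symm : E' →ₗ[ℝ] E) ∈ G)
    (hm : ∀ f ∈ G, ∃ k : ℤ, f m = k) (x : E) :
    boxDim G (L x + m) = boxDim F x := by
  have : (dirSpace F x).map (L : E →ₗ[ℝ] E') = dirSpace G (L x + m) := by
    ext w
    rw [Submodule.mem_map]
    constructor
    · rintro ⟨v, hv, rfl⟩ f hf ⟨k, hk⟩
      obtain ⟨l, hl⟩ := hm f hf
      refine hv _ (hL f hf) ⟨k - l, ?_⟩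
      rw [map_add, hl] at hk
      push_cast
      rw [← hk]
      simp
    · intro hw
      refine ⟨L.symm w, ?_, by simp⟩
      rintro f hf ⟨k, hk⟩
      obtain ⟨l, hl⟩ := hm _ (hL' f hf)
      refine hw _ (hL' f hf) ⟨k + l, ?_⟩
      rw [map_add, hl]
      simp [hk]
  rw [boxDim, ← this]
  exact LinearEquiv.finrank_map_eq L _

end Equivariance

theorem exists_iterate_add (L : E →ₗ[ℝ] E) (m : E) (N : ℕ) :
    ∃ c, ∀ x, (fun x => L x + m)^[N] x = (L ^ N) x + c := by
  induction N with
  | zero => exact ⟨0, fun x => by simp⟩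
  | succ N ih =>
    obtain ⟨c, hc⟩ := ih
    refine ⟨L c + m, fun x => ?_⟩
    rw [Function.iterate_succ_apply', hc, pow_succ']
    simp [add_assoc]

/-- If the family of functionals contains differences, then an affine map with linear part of
finite order can only map a point into the open box of this point if it fixes the point. -/
theorem map_add_eq_of_mem_openBox (h0 : 0 ∈ T) (hT : Separating T) {L : E →ₗ[ℝ] E} {m : E}
    (hL : ∀ f ∈ T, f ∘ₗ L ∈ T) (hm : ∀ f ∈ T, ∃ k : ℤ, f m = k) {N : ℕ} (hN : 0 < N)
    (hLN : L ^ N = 1) {a : E} (ha : L a + m ∈ openBox (T - T) a) : L a + m = a := by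
  set g : E → E := fun x => L x + m with hg
  -- The map permutes boxes and fixes the box of `a`, so the whole forward orbit of `a` stays in
  -- this box.
  have hiter (i : ℕ) : g^[i] a ∈ openBox (T - T) a := by
    induction i with
    | zero => exact mem_openBox_self
    | succ i ih =>
      rw [Function.iterate_succ_apply', ← openBox_eq_of_mem ha]
      exact map_add_mem_openBox (comp_mem_sub_self hL) (exists_int_of_mem_sub_self hm) ih
  obtain ⟨c, hc⟩ := exists_iterate_add L m N
  simp only [hLN, Module.End.one_apply] at hc
  have hcj (j : ℕ) : g^[N * j] a = a + (j : ℝ) • c := by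
    induction j with
    | zero => simp
    | succ j ih =>
      rw [Nat.mul_succ, add_comm, Function.iterate_add_apply, ih, hc]
      push_cast
      rw [add_smul, one_smul, add_assoc]
  refine sub_eq_zero.1 (hT _ fun f hf => ?_)
  rw [map_sub, sub_eq_zero]
  -- After `N * j` steps the point has moved by `j • c`. Each functional of `T` varies by at most 1
  -- on the box, so it must kill `c`.
  have hfc : f c = 0 := by
    by_contra hne
    obtain ⟨j, hj⟩ := exists_nat_gt (1 / |f c|)
    have h1 := abs_sub_le_one_of_floor (hiter (N * j) f (subset_sub_self h0 hf)).1
    rw [hcj, map_add, map_smul, add_sub_cancel_left, smul_eq_mul, abs_mul, Nat.abs_cast] at h1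
    rw [div_lt_iff₀ (abs_pos.2 hne)] at hj
    linarith
  have hfN : f (g^[N] a) = f a := by rw [hc, map_add, hfc, add_zero]
  obtain ⟨k, hk⟩ := hm f hf
  -- The increment of `f` along the orbit is, up to an integer constant, the difference `f - f ∘ₗ L`
  -- in `T - T`. Its sign is therefore constant on the box, and `f` is strictly monotone along the
  -- orbit unless `g` preserves its value; monotonicity contradicts the return after `N` steps.
  have hψ : f - f ∘ₗ L ∈ T - T := ⟨f, hf, _, hL f hf, rfl⟩
  have hδ (x : E) : f x - f (g x) = (f - f ∘ₗ L) x - k := by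
    simp [hg, ← hk, sub_sub]
  rcases lt_trichotomy (f (g a)) (f a) with h | h | h
  · have hdec : StrictAnti fun i : ℕ => f (g^[i] a) := by
      refine strictAnti_nat_of_succ_lt fun i => ?_
      rw [Function.iterate_succ_apply', ← sub_pos, hδ, sub_pos, ← Int.lt_ceil,
        (hiter i _ hψ).2, Int.lt_ceil, ← sub_pos, ← hδ, sub_pos]
      exact h
    exact absurd hfN (hdec hN).ne
  · exact h
  · have hinc : StrictMono fun i : ℕ => f (g^[i] a) := by
      refine strictMono_nat_of_lt_succ fun i => ?_
      rw [Function.iterate_succ_apply', ← sub_neg, hδ, sub_neg, ← Int.floor_lt,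
        (hiter i _ hψ).1, Int.floor_lt, ← sub_neg, ← hδ, sub_neg]
      exact h
    exact absurd hfN (hinc hN).ne'

end Box

end Crystal

namespace Crystal

open Set Topology Metric Module
open scoped Pointwise

theorem isClosed_of_inter_closedBall {X : Type*} [PseudoMetricSpace X] {S : Set X} (x₀ : X)
    (h : ∀ R, IsClosed (S ∩ closedBall x₀ R)) : IsClosed S := by
  refine isClosed_of_closure_subset fun x hx => ?_
  have : x ∈ closure (ball x₀ (dist x x₀ + 1) ∩ S) := by
    rw [_root_.mem_closure_iff] at hx ⊢
    intro o ho hxo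
    have := hx (o ∩ ball x₀ (dist x x₀ + 1)) (ho.inter isOpen_ball) ⟨hxo, by simp⟩
    rwa [inter_assoc] at this
  refine ((h (dist x x₀ + 1)).closure_subset_iff.2 ?_ this).1
  exact fun y hy => ⟨hy.2, ball_subset_closedBall hy.1⟩

/-! ### Projection along a vector, and the abstract collapse model -/

section Perp

variable {E : Type*} [NormedAddCommGroup E] [InnerProductSpace ℝ E]

/-- The orthogonal projection along `z`. -/
noncomputable def perp (z : E) : E →ₗ[ℝ] E :=
  LinearMap.id - ((‖z‖ ^ 2)⁻¹ • innerₛₗ ℝ z).smulRight z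

theorem perp_apply (z y : E) : perp z y = y - ((‖z‖ ^ 2)⁻¹ * inner ℝ z y) • z := rfl

theorem inner_perp (z y : E) : inner ℝ z (perp z y) = 0 := by
  rcases eq_or_ne z 0 with rfl | hz
  · simp
  · have : ‖z‖ ≠ 0 := norm_ne_zero_iff.2 hz
    rw [perp_apply, inner_sub_right, inner_smul_right, real_inner_self_eq_norm_sq]
    field_simp
    ring

theorem perp_of_inner_eq_zero {z y : E} (h : inner ℝ z y = 0) : perp z y = y := by
  simp [perp_apply, h]

theorem perp_self (z : E) : perp z z = 0 := by
  rcases eq_or_ne z 0 with rfl | hz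
  · simp
  · have : ‖z‖ ≠ 0 := norm_ne_zero_iff.2 hz
    rw [perp_apply, real_inner_self_eq_norm_sq, inv_mul_cancel₀ (by positivity), one_smul, sub_self]

theorem sub_perp_mem (z y : E) : y - perp z y ∈ Submodule.span ℝ {z} := by
  rw [perp_apply, sub_sub_cancel]
  exact Submodule.smul_mem _ _ (Submodule.mem_span_singleton_self z)

theorem perp_eq_iff {z y y' : E} : perp z y = perp z y' ↔ y - y' ∈ Submodule.span ℝ {z} := by
  constructor
  · intro h
    have := Submodule.sub_mem _ (sub_perp_mem z y) (sub_perp_mem z y')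
    rwa [h, sub_sub_sub_cancel_right] at this
  · intro h
    obtain ⟨c, hc⟩ := Submodule.mem_span_singleton.1 h
    rw [← sub_eq_zero, ← map_sub, ← hc, map_smul, perp_self, smul_zero]

theorem perp_neg (z : E) : perp (-z) = perp z := by
  ext y
  simp [perp_apply]

theorem perp_map (J : E ≃ₗᵢ[ℝ] E) (z y : E) : perp (J z) (J y) = J (perp z y) := by
  simp [perp_apply]

end Perp

/-- A description of a space `A` with an action of `G` as the quotient of `E × E` obtained by
identifying `(u, y)` with `(-u, y)`, and collapsing the line `{z} × (y + ℝ z)` for all `y` and all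
`z` in some set `Z`; the action comes from an isometric affine action on the second factor and its
linear part on the first factor.  There is a finite family of functionals which is compatible with
all data. -/
structure CollapseModel (G E A : Type*) [Group G] [NormedAddCommGroup E] [InnerProductSpace ℝ E]
    [TopologicalSpace A] [MulAction G A] where
  /-- The linear part of the action. -/
  J : G →* (E ≃ₗᵢ[ℝ] E)
  /-- The translational part of the action. -/
  m : G → E
  /-- The quotient map. -/
  q : E × E → A
  /-- The set of points where lines are collapsed. -/
  Z : Set E
  /-- The family of functionals. -/
  T : Set (Dual ℝ E)
  finite_T : T.Finite
  zero_mem_T : 0 ∈ T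
  neg_mem_T : ∀ f ∈ T, -f ∈ T
  comp_mem_T : ∀ γ, ∀ f ∈ T, f ∘ₗ ((J γ).toLinearEquiv : E →ₗ[ℝ] E) ∈ T
  separating_T : Separating T
  int_Z : ∀ z ∈ Z, ∀ f ∈ T, ∃ k : ℤ, f z = k
  int_m : ∀ γ, ∀ f ∈ T, ∃ k : ℤ, f (m γ) = k
  zero_notMem_Z : 0 ∉ Z
  neg_mem_Z : ∀ z ∈ Z, -z ∈ Z
  map_mem_Z : ∀ γ, ∀ z ∈ Z, J γ z ∈ Z
  isQuotientMap_q : IsQuotientMap q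
  q_eq_iff : ∀ u y u' y', q (u, y) = q (u', y') ↔ (u = u' ∨ u = -u') ∧
    (y = y' ∨ u ∈ Z ∧ y - y' ∈ Submodule.span ℝ {u})
  smul_q : ∀ γ u y, γ • q (u, y) = q (J γ u, J γ y + m γ)
  exists_pow_J : ∀ γ, ∃ N, 0 < N ∧ J γ ^ N = 1

namespace CollapseModel

variable {G E A : Type*} [Group G] [NormedAddCommGroup E] [InnerProductSpace ℝ E]
    [TopologicalSpace A] [MulAction G A] (M : CollapseModel G E A)

theorem J_inv_apply (γ : G) (x : E) : M.J γ⁻¹ (M.J γ x) = x := by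
  change (M.J γ⁻¹ * M.J γ) x = x
  rw [← map_mul, inv_mul_cancel, map_one]
  rfl

/-- The linear part as a linear equivalence. -/
def L (γ : G) : E ≃ₗ[ℝ] E := (M.J γ).toLinearEquiv

theorem L_apply (γ : G) (x : E) : M.L γ x = M.J γ x := rfl

theorem L_symm (γ : G) : (M.L γ).symm = M.L γ⁻¹ := by
  ext x
  rw [LinearEquiv.symm_apply_eq, L_apply, L_apply]
  simp

theorem continuousConstSMul (M : CollapseModel G E A) : ContinuousConstSMul G A where
  continuous_const_smul γ := by
    rw [M.isQuotientMap_q.continuous_iff]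
    have : (fun a => γ • a) ∘ M.q = M.q ∘ fun p : E × E => (M.J γ p.1, M.J γ p.2 + M.m γ) := by
      ext p
      exact M.smul_q γ p.1 p.2
    rw [this]
    refine M.isQuotientMap_q.continuous.comp ?_
    fun_prop

theorem q_neg (u y : E) : M.q (-u, y) = M.q (u, y) :=
  (M.q_eq_iff _ _ _ _).2 ⟨Or.inr rfl, Or.inl rfl⟩

theorem q_perp {z : E} (hz : z ∈ M.Z) (y : E) : M.q (z, perp z y) = M.q (z, y) :=
  (M.q_eq_iff _ _ _ _).2 ⟨Or.inl rfl, Or.inr ⟨hz, by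
    rw [← neg_mem_iff, neg_sub]; exact sub_perp_mem z y⟩⟩

/-- The functionals on the product. -/
def prodT : Set (Dual ℝ (E × E)) :=
  (fun f => f ∘ₗ LinearMap.fst ℝ E E) '' M.T ∪ (fun f => f ∘ₗ LinearMap.snd ℝ E E) '' M.T

theorem fst_mem {f : Dual ℝ E} (hf : f ∈ M.T) : f ∘ₗ LinearMap.fst ℝ E E ∈ M.prodT :=
  Or.inl ⟨f, hf, rfl⟩

theorem snd_mem {f : Dual ℝ E} (hf : f ∈ M.T) : f ∘ₗ LinearMap.snd ℝ E E ∈ M.prodT :=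
  Or.inr ⟨f, hf, rfl⟩

theorem finite_prodT : M.prodT.Finite :=
  (M.finite_T.image _).union (M.finite_T.image _)

theorem zero_mem_prodT : 0 ∈ M.prodT := Or.inl ⟨0, M.zero_mem_T, rfl⟩

theorem separating_prodT : Separating M.prodT := by
  rintro ⟨u, y⟩ h
  refine Prod.ext (M.separating_T _ fun f hf => ?_) (M.separating_T _ fun f hf => ?_)
  · exact h _ (M.fst_mem hf)
  · exact h _ (M.snd_mem hf)

/-- The functionals used for the lines parallel to `z`. -/
def lineT (z : E) : Set (Dual ℝ E) :=
  -- The inner product keeps the boxes inside the orthogonal complement of `z`. The remaining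
  -- functionals vanish on `z`, so they are functions of the line; the integer coefficients `f z`
  -- and `g z` preserve integrality.
  {innerₛₗ ℝ z, -innerₛₗ ℝ z} ∪ ({f ∈ M.T - M.T | f z = 0} ∪
    image2 (fun f g : Dual ℝ E => f z • g - g z • f) (M.T - M.T) (M.T - M.T))

theorem finite_lineT (z : E) : (M.lineT z).Finite := by
  have : (M.T - M.T).Finite := M.finite_T.sub M.finite_T
  exact (Set.toFinite _).union ((this.subset (sep_subset _ _)).union (this.image2 _ this))

theorem zero_mem_lineT (z : E) : 0 ∈ M.lineT z :=
  Or.inr (Or.inl ⟨⟨0, M.zero_mem_T, 0, M.zero_mem_T, sub_zero 0⟩, rfl⟩)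

theorem inner_mem_lineT (z : E) : innerₛₗ ℝ z ∈ M.lineT z := Or.inl (Or.inl rfl)

theorem ne_zero_of_mem_Z {z : E} (hz : z ∈ M.Z) : z ≠ 0 := by
  rintro rfl
  exact M.zero_notMem_Z hz

/-- Choosing `f` with `f z ≠ 0`, the combinations `f z • g - g z • f` can all vanish only on
multiples of `z`, and the inner product with `z` excludes the nonzero ones. -/
theorem separating_lineT {z : E} (hz : z ∈ M.Z) : Separating (M.lineT z) := by
  intro w hw
  have hz0 := M.ne_zero_of_mem_Z hz
  have hsub := subset_sub_self M.zero_mem_T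
  obtain ⟨f, hf, hfz⟩ : ∃ f ∈ M.T, f z ≠ 0 := by
    by_contra! h
    exact hz0 (M.separating_T z h)
  have hws : w = (f w / f z) • z := by
    refine sub_eq_zero.1 (M.separating_T _ fun g hg => ?_)
    have := hw _ (Or.inr (Or.inr ⟨f, hsub hf, g, hsub hg, rfl⟩))
    simp only [LinearMap.sub_apply, LinearMap.smul_apply, smul_eq_mul] at this
    rw [map_sub, map_smul, smul_eq_mul]
    field_simp
    linarith
  have h := hw _ (M.inner_mem_lineT z)
  rw [innerₛₗ_apply_apply, hws, inner_smul_right, mul_eq_zero, inner_self_eq_zero] at h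
  rw [hws, h.resolve_right hz0, zero_smul]

theorem lineT_neg (z : E) : M.lineT (-z) = M.lineT z := by
  have (z : E) : M.lineT (-z) ⊆ M.lineT z := by
    rintro f ((rfl | rfl) | ⟨hf, hfz⟩ | ⟨f, hf, g, hg, rfl⟩)
    · exact Or.inl (Or.inr (by simp))
    · exact Or.inl (Or.inl (by simp))
    · exact Or.inr (Or.inl ⟨hf, by simpa using hfz⟩)
    · refine Or.inr (Or.inr ⟨g, hg, f, hf, ?_⟩)
      ext x
      simp
      ring
  refine (this z).antisymm ?_
  have h := this (-z)
  rwa [neg_neg] at h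

theorem comp_mem_lineT (γ : G) (z : E) :
    ∀ f ∈ M.lineT (M.J γ z), f ∘ₗ (M.L γ : E →ₗ[ℝ] E) ∈ M.lineT z := by
  have hT := comp_mem_sub_self (M.comp_mem_T γ)
  rintro f ((rfl | rfl) | ⟨hf, hfz⟩ | ⟨f, hf, g, hg, rfl⟩)
  · refine Or.inl (Or.inl ?_)
    ext x
    simp [L_apply]
  · refine Or.inl (Or.inr ?_)
    ext x
    simp [L_apply]
  · exact Or.inr (Or.inl ⟨hT f hf, hfz⟩)
  · exact Or.inr (Or.inr ⟨_, hT f hf, _, hT g hg, rfl⟩)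

/-- This makes the projected translation parts of the action integral for `lineT z`. A functional
vanishing on `z` does not notice the projection, and the coefficients of the mixed ones are integers
because `z ∈ M.Z`. -/
theorem int_lineT {z x : E} (hz : z ∈ M.Z) (hx : ∀ f ∈ M.T, ∃ k : ℤ, f x = k) :
    ∀ f ∈ M.lineT z, ∃ k : ℤ, f (perp z x) = k := by
  have hx' := exists_int_of_mem_sub_self hx
  have hz' := exists_int_of_mem_sub_self (M.int_Z z hz)
  have hperp (f : Dual ℝ E) (h : f z = 0) : f (perp z x) = f x := by
    rw [perp_apply, map_sub, map_smul, h, smul_zero, sub_zero]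
  rintro f ((rfl | rfl) | ⟨hf, hfz⟩ | ⟨f, hf, g, hg, rfl⟩)
  · exact ⟨0, by simp [inner_perp]⟩
  · exact ⟨0, by simp [inner_perp]⟩
  · rw [hperp f hfz]
    exact hx' f hf
  · obtain ⟨a, ha⟩ := hz' f hf
    obtain ⟨b, hb⟩ := hz' g hg
    obtain ⟨c, hc⟩ := hx' f hf
    obtain ⟨d, hd⟩ := hx' g hg
    refine ⟨a * d - b * c, ?_⟩
    rw [hperp]
    · simp [ha, hb, hc, hd]
    · simp [mul_comm]

open scoped Classical in
/-- The open cell of `A` belonging to a point of `E × E`. -/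
noncomputable def cell (p : E × E) : Set A :=
  if p.1 ∈ M.Z then
    (fun y => M.q (p.1, y)) '' openBox (M.lineT p.1 - M.lineT p.1) (perp p.1 p.2)
  else M.q '' openBox (M.prodT - M.prodT) p

open scoped Classical in
/-- The dimension of the open cell of a point. -/
noncomputable def dim (p : E × E) : ℕ :=
  if p.1 ∈ M.Z then boxDim (M.lineT p.1 - M.lineT p.1) (perp p.1 p.2)
  else boxDim (M.prodT - M.prodT) p

theorem cell_of_mem {p : E × E} (hp : p.1 ∈ M.Z) : M.cell p =
    (fun y => M.q (p.1, y)) '' openBox (M.lineT p.1 - M.lineT p.1) (perp p.1 p.2) := if_pos hp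

theorem cell_of_notMem {p : E × E} (hp : p.1 ∉ M.Z) :
    M.cell p = M.q '' openBox (M.prodT - M.prodT) p := if_neg hp

theorem dim_of_mem {p : E × E} (hp : p.1 ∈ M.Z) : M.dim p =
    boxDim (M.lineT p.1 - M.lineT p.1) (perp p.1 p.2) := if_pos hp

theorem dim_of_notMem {p : E × E} (hp : p.1 ∉ M.Z) :
    M.dim p = boxDim (M.prodT - M.prodT) p := if_neg hp

theorem q_mem_cell (p : E × E) : M.q p ∈ M.cell p := by
  by_cases hp : p.1 ∈ M.Z
  · rw [M.cell_of_mem hp]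
    exact ⟨_, mem_openBox_self, M.q_perp hp p.2⟩
  · rw [M.cell_of_notMem hp]
    exact ⟨p, mem_openBox_self, rfl⟩

/-- The affine maps through which `G` acts on the product. -/
def prodL (γ : G) : (E × E) ≃ₗ[ℝ] (E × E) := (M.L γ).prodCongr (M.L γ)

theorem prodL_comp_mem (γ : G) :
    ∀ f ∈ M.prodT, f ∘ₗ (M.prodL γ : E × E →ₗ[ℝ] E × E) ∈ M.prodT := by
  rintro _ (⟨f, hf, rfl⟩ | ⟨f, hf, rfl⟩)
  · exact Or.inl ⟨_, M.comp_mem_T γ f hf, rfl⟩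
  · exact Or.inr ⟨_, M.comp_mem_T γ f hf, rfl⟩

theorem prodL_symm (γ : G) : (M.prodL γ).symm = M.prodL γ⁻¹ := by
  rw [prodL, prodL, ← L_symm]
  rfl

theorem int_prod_m (γ : G) : ∀ f ∈ M.prodT, ∃ k : ℤ, f ((0, M.m γ) : E × E) = k := by
  rintro _ (⟨f, hf, rfl⟩ | ⟨f, hf, rfl⟩)
  · exact ⟨0, by simp⟩
  · exact M.int_m γ f hf

/-- The affine action on the product. -/
def act (γ : G) (p : E × E) : E × E := (M.J γ p.1, M.J γ p.2 + M.m γ)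

theorem act_eq (γ : G) (p : E × E) : M.act γ p = M.prodL γ p + (0, M.m γ) := by
  ext <;> simp [act, prodL, L_apply]

theorem smul_q' (γ : G) (p : E × E) : γ • M.q p = M.q (M.act γ p) := M.smul_q γ p.1 p.2

theorem map_mem_Z_iff (γ : G) {z : E} : M.J γ z ∈ M.Z ↔ z ∈ M.Z := by
  refine ⟨fun h => ?_, M.map_mem_Z γ z⟩
  have := M.map_mem_Z γ⁻¹ _ h
  rwa [J_inv_apply] at this

theorem neg_mem_Z_iff {z : E} : -z ∈ M.Z ↔ z ∈ M.Z :=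
  ⟨fun h => neg_neg z ▸ M.neg_mem_Z _ h, M.neg_mem_Z z⟩

theorem lineT_comp_symm_mem (γ : G) (z : E) :
    ∀ f ∈ M.lineT z, f ∘ₗ ((M.L γ).symm : E →ₗ[ℝ] E) ∈ M.lineT (M.J γ z) := by
  have := M.comp_mem_lineT γ⁻¹ (M.J γ z)
  rw [L_symm]
  rwa [J_inv_apply] at this

/-- The group acts on `E × E` by affine maps permuting `prodT` with integral translation part, hence
permutes the boxes. Over `Z` the same argument applies after projection, because isometries commute
with `perp`. -/
theorem smul_cell (γ : G) (p : E × E) :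
    (fun a => γ • a) '' M.cell p = M.cell (M.act γ p) ∧ M.dim (M.act γ p) = M.dim p := by
  have hperp : perp (M.J γ p.1) (M.J γ p.2 + M.m γ) =
      M.L γ (perp p.1 p.2) + perp (M.J γ p.1) (M.m γ) := by
    rw [map_add, perp_map, L_apply]
  by_cases hp : p.1 ∈ M.Z
  · have hp' : (M.act γ p).1 ∈ M.Z := (M.map_mem_Z_iff γ).2 hp
    have h1 := comp_mem_sub_self (M.comp_mem_lineT γ p.1)
    have h2 := comp_mem_sub_self (M.lineT_comp_symm_mem γ p.1)
    have h3 := exists_int_of_mem_sub_self (M.int_lineT hp' (M.int_m γ))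
    constructor
    · rw [M.cell_of_mem hp, M.cell_of_mem hp', image_image]
      simp only [act] at *
      rw [hperp, ← openBox_image (M.L γ) h1 h2 h3, image_image]
      refine image_congr fun y _ => ?_
      rw [M.smul_q, L_apply, ← M.q_perp hp', ← M.q_perp hp' (_ + perp _ _), map_add, map_add,
        perp_of_inner_eq_zero (inner_perp _ (M.m γ))]
    · rw [M.dim_of_mem hp, M.dim_of_mem hp']
      simp only [act] at *
      rw [hperp, boxDim_image (M.L γ) h1 h2 h3]
  · have hp' : (M.act γ p).1 ∉ M.Z := fun h => hp ((M.map_mem_Z_iff γ).1 h)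
    have h1 := comp_mem_sub_self (M.prodL_comp_mem γ)
    have h2 := comp_mem_sub_self (M.prodL_comp_mem γ⁻¹)
    rw [← prodL_symm] at h2
    have h3 := exists_int_of_mem_sub_self (M.int_prod_m γ)
    constructor
    · rw [M.cell_of_notMem hp, M.cell_of_notMem hp', image_image, act_eq,
        ← openBox_image (M.prodL γ) h1 h2 h3, image_image]
      refine image_congr fun y _ => ?_
      rw [M.smul_q', act_eq]
    · rw [M.dim_of_notMem hp, M.dim_of_notMem hp', act_eq,
        boxDim_image (M.prodL γ) h1 h2 h3]

/-- The family `T` is symmetric, so negating the first coordinate permutes `prodT`; hence the cell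
survives the identification of `u` with `-u`. -/
theorem cell_neg (u y : E) :
    M.cell (-u, y) = M.cell (u, y) ∧ M.dim (-u, y) = M.dim (u, y) := by
  by_cases hu : u ∈ M.Z
  · have hu' := M.neg_mem_Z u hu
    rw [M.cell_of_mem (p := (-u, y)) hu', M.cell_of_mem (p := (u, y)) hu,
      M.dim_of_mem (p := (-u, y)) hu', M.dim_of_mem (p := (u, y)) hu]
    simp only [lineT_neg, perp_neg, q_neg, and_self]
  · have hu' : -u ∉ M.Z := fun h => hu (M.neg_mem_Z_iff.1 h)
    rw [M.cell_of_notMem (p := (-u, y)) hu', M.cell_of_notMem (p := (u, y)) hu,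
      M.dim_of_notMem (p := (-u, y)) hu', M.dim_of_notMem (p := (u, y)) hu]
    let σ : (E × E) ≃ₗ[ℝ] (E × E) := (LinearEquiv.neg ℝ).prodCongr (LinearEquiv.refl ℝ E)
    have hσ : ∀ f ∈ M.prodT, f ∘ₗ (σ : E × E →ₗ[ℝ] E × E) ∈ M.prodT := by
      rintro _ (⟨f, hf, rfl⟩ | ⟨f, hf, rfl⟩)
      · exact Or.inl ⟨_, M.neg_mem_T f hf, by ext <;> simp [σ]⟩
      · exact Or.inr ⟨_, hf, by ext <;> simp [σ]⟩
    have h1 := comp_mem_sub_self hσ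
    have h2 : ∀ f ∈ M.prodT - M.prodT, f ∘ₗ (σ.symm : E × E →ₗ[ℝ] E × E) ∈ M.prodT - M.prodT := by
      have : σ.symm = σ := by ext p <;> simp [σ]
      rwa [this]
    have h3 : ∀ f ∈ M.prodT - M.prodT, ∃ k : ℤ, f 0 = k := fun f _ => ⟨0, by simp⟩
    have hσu : ((-u, y) : E × E) = σ (u, y) + 0 := by simp [σ]
    constructor
    · rw [hσu, ← openBox_image σ h1 h2 h3, image_image]
      refine image_congr fun p _ => ?_
      simp only [add_zero]
      exact M.q_neg p.1 p.2
    · rw [hσu, boxDim_image σ h1 h2 h3]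

end CollapseModel

end Crystal

namespace Crystal

open Set Topology Metric Module
open scoped Pointwise

/-! ### The cell decomposition of the quotient and its Hausdorff property -/

namespace CollapseModel

variable {G E A : Type*} [Group G] [NormedAddCommGroup E] [InnerProductSpace ℝ E]
    [TopologicalSpace A] [MulAction G A] (M : CollapseModel G E A)

theorem eq_of_mem_openBox_of_mem_Z {z x : E} (hz : z ∈ M.Z)
    (h : ∀ f ∈ M.T, ⌊f x⌋ = ⌊f z⌋ ∧ ⌈f x⌉ = ⌈f z⌉) : x = z :=
  eq_of_mem_openBox_of_int M.separating_T (M.int_Z z hz) h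

theorem fst_floor_ceil {p r : E × E} (h : r ∈ openBox (M.prodT - M.prodT) p) {f : Dual ℝ E}
    (hf : f ∈ M.T) : ⌊f r.1⌋ = ⌊f p.1⌋ ∧ ⌈f r.1⌉ = ⌈f p.1⌉ :=
  h _ (subset_sub_self M.zero_mem_prodT (M.fst_mem hf))

/-- A point of `Z` is integral for the separating family `T`, so it is the only point in its box. A
box of the product thus projects into `Z` only if its first coordinate is constantly that point. -/
theorem notMem_Z_of_mem_openBox {p r : E × E} (hp : p.1 ∉ M.Z)
    (h : r ∈ openBox (M.prodT - M.prodT) p) : r.1 ∉ M.Z := by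
  intro hr
  have := M.eq_of_mem_openBox_of_mem_Z hr (x := p.1) fun f hf =>
    ⟨(M.fst_floor_ceil h hf).1.symm, (M.fst_floor_ceil h hf).2.symm⟩
  exact hp (this ▸ hr)

theorem inner_eq_zero_of_mem_closure [FiniteDimensional ℝ E] {z y w : E}
    (h : w ∈ closure (openBox (M.lineT z - M.lineT z) (perp z y))) : inner ℝ z w = 0 := by
  have := eq_int_of_mem_closure (subset_sub_self (M.zero_mem_lineT z) (M.inner_mem_lineT z)) h
    (k := 0) (by simp [inner_perp])
  simpa using this

theorem perp_eq_of_mem_closure [FiniteDimensional ℝ E] {z y w : E}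
    (h : w ∈ closure (openBox (M.lineT z - M.lineT z) (perp z y))) : perp z w = w :=
  perp_of_inner_eq_zero (M.inner_eq_zero_of_mem_closure h)

theorem cell_congr {r r' : E × E} (h : M.q r = M.q r') :
    M.cell r = M.cell r' ∧ M.dim r = M.dim r' := by
  obtain ⟨u, y⟩ := r
  obtain ⟨u', y'⟩ := r'
  have key (y') (h : M.q (u, y) = M.q (u, y')) :
      M.cell (u, y) = M.cell (u, y') ∧ M.dim (u, y) = M.dim (u, y') := by
    obtain ⟨-, rfl | ⟨hu, hy⟩⟩ := (M.q_eq_iff _ _ _ _).1 h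
    · exact ⟨rfl, rfl⟩
    · rw [M.cell_of_mem (p := (u, y)) hu, M.cell_of_mem (p := (u, y')) hu,
        M.dim_of_mem (p := (u, y)) hu, M.dim_of_mem (p := (u, y')) hu]
      simp only [perp_eq_iff.2 hy, and_self]
  obtain ⟨rfl | rfl, -⟩ := (M.q_eq_iff _ _ _ _).1 h
  · exact key _ h
  · rw [← (M.cell_neg u' y').1, ← (M.cell_neg u' y').2]
    rw [← M.q_neg u' y'] at h
    exact key _ h

variable [FiniteDimensional ℝ E]

theorem cell_eq_of_mem {p r : E × E} (h : M.q r ∈ M.cell p) :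
    M.cell r = M.cell p ∧ M.dim r = M.dim p := by
  by_cases hp : p.1 ∈ M.Z
  · rw [M.cell_of_mem hp] at h
    obtain ⟨w, hw, hwr⟩ := h
    have hw' := M.perp_eq_of_mem_closure (subset_closure hw)
    rw [← (M.cell_congr hwr).1, ← (M.cell_congr hwr).2, M.cell_of_mem hp, M.dim_of_mem hp,
      M.cell_of_mem (p := (p.1, w)) hp, M.dim_of_mem (p := (p.1, w)) hp]
    simp only [hw', openBox_eq_of_mem hw, boxDim_eq_of_mem hw, and_self]
  · rw [M.cell_of_notMem hp] at h
    obtain ⟨a, ha, har⟩ := h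
    have ha' := M.notMem_Z_of_mem_openBox hp ha
    rw [← (M.cell_congr har).1, ← (M.cell_congr har).2, M.cell_of_notMem hp, M.dim_of_notMem hp,
      M.cell_of_notMem ha', M.dim_of_notMem ha', openBox_eq_of_mem ha, boxDim_eq_of_mem ha]
    exact ⟨rfl, rfl⟩

/-- The boundary of an ordinary box may run into `Z × E`, where cells are defined by `lineT`
instead. Collapsing must not raise the dimension there; this is shown by embedding the directions of
the collapsed cell into those of the box of `r`. -/
theorem dim_le (r : E × E) : M.dim r ≤ boxDim (M.prodT - M.prodT) r := by
  by_cases hr : r.1 ∈ M.Z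
  swap
  · rw [M.dim_of_notMem hr]
  rw [M.dim_of_mem hr]
  obtain ⟨z, y⟩ := r
  change z ∈ M.Z at hr
  change boxDim (M.lineT z - M.lineT z) (perp z y) ≤ _
  have hT0 := M.zero_mem_T
  have hl0 := M.zero_mem_lineT z
  set W := dirSpace (M.lineT z - M.lineT z) (perp z y) with hW
  have hz' := exists_int_of_mem_sub_self (M.int_Z z hr)
  have hperp (f : Dual ℝ E) (h : f z = 0) : f (perp z y) = f y := by
    rw [perp_apply, map_sub, map_smul, h, smul_zero, sub_zero]
  have hWz (w) (hw : w ∈ W) : inner ℝ z w = 0 := by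
    have := hw _ (subset_sub_self hl0 (M.inner_mem_lineT z)) ⟨0, by simp [inner_perp]⟩
    simpa using this
  -- it suffices to compare with the directions of the box of `y`
  have hprod (w : E) (hw : w ∈ dirSpace (M.T - M.T) y) :
      ((0 : E), w) ∈ dirSpace (M.prodT - M.prodT) (z, y) := by
    have hsub := subset_sub_self M.zero_mem_T
    rintro _ ⟨_, ⟨f, hf, rfl⟩ | ⟨f, hf, rfl⟩, _, ⟨g, hg, rfl⟩ | ⟨g, hg, rfl⟩, rfl⟩ ⟨k, hk⟩
    · simp
    · obtain ⟨l, hl⟩ := M.int_Z z hr f hf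
      have := hw g (hsub hg) ⟨l - k, by simp [hl] at hk; push_cast; linarith⟩
      simp [this]
    · obtain ⟨l, hl⟩ := M.int_Z z hr g hg
      have := hw f (hsub hf) ⟨l + k, by simp [hl] at hk; push_cast; linarith⟩
      simp [this]
    · exact hw _ ⟨f, hf, g, hg, rfl⟩ ⟨k, hk⟩
  suffices h : ∃ φ : E →ₗ[ℝ] E, (∀ w ∈ W, φ w ∈ dirSpace (M.T - M.T) y) ∧
      ∀ w ∈ W, φ w = 0 → w = 0 by
    obtain ⟨φ, h1, h2⟩ := h
    let ψ : W →ₗ[ℝ] dirSpace (M.prodT - M.prodT) (z, y) :=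
      ((LinearMap.inr ℝ E E ∘ₗ φ).domRestrict W).codRestrict _ fun w => hprod _ (h1 w w.2)
    refine LinearMap.finrank_le_finrank_of_injective (f := ψ)
      ((injective_iff_map_eq_zero ψ).2 fun w hw => ?_)
    refine Subtype.ext (h2 w w.2 ?_)
    have := congrArg Subtype.val hw
    exact congrArg Prod.snd this
  by_cases hcase : ∃ f ∈ M.T - M.T, (∃ k : ℤ, f y = k) ∧ f z ≠ 0
  · obtain ⟨f, hf, ⟨k, hk⟩, hfz⟩ := hcase
    -- This is the projection along `z` onto the kernel of `f`, injective on the orthogonal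
    -- complement of `z`. For `g` integral at `y`, the functional `f z • g - g z • f` in `lineT z`
    -- is integral at `perp z y`, hence vanishes on `W`; so `g` vanishes on the projected vectors.
    refine ⟨LinearMap.id - ((f z)⁻¹ • f).smulRight z, fun w hw => ?_, fun w hw hw0 => ?_⟩
    · rintro g hg ⟨l, hl⟩
      have hmem : f z • g - g z • f ∈ M.lineT z := Or.inr (Or.inr ⟨f, hf, g, hg, rfl⟩)
      obtain ⟨a, ha⟩ := hz' f hf
      obtain ⟨b, hb⟩ := hz' g hg
      have := hw _ (subset_sub_self hl0 hmem) ⟨a * l - b * k, by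
        rw [hperp _ (by simp [mul_comm])]
        simp [ha, hb, hk, hl]⟩
      simp only [LinearMap.sub_apply, LinearMap.smul_apply, smul_eq_mul, LinearMap.id_apply,
        LinearMap.smulRight_apply, map_sub, map_smul] at this ⊢
      field_simp
      linarith
    · simp only [LinearMap.sub_apply, LinearMap.smul_apply, smul_eq_mul, LinearMap.id_apply,
        LinearMap.smulRight_apply, sub_eq_zero] at hw0
      have h := hWz w hw
      rw [hw0, inner_smul_right, mul_eq_zero, inner_self_eq_zero] at h
      rw [hw0, h.resolve_right (M.ne_zero_of_mem_Z hr), zero_smul]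
  · push Not at hcase
    -- Here every functional of `T - T` integral at `y` vanishes on `z`, so it already belongs to
    -- `lineT z` and no correction is needed.
    refine ⟨LinearMap.id, fun w hw => ?_, fun w _ h => h⟩
    rintro g hg ⟨l, hl⟩
    have hgz := hcase g hg ⟨l, hl⟩
    exact hw g (subset_sub_self hl0 (Or.inr (Or.inl ⟨hg, hgz⟩))) ⟨l, by rw [hperp g hgz, hl]⟩

/-- Different points of `Z` lie in different boxes of `T`, and a bounded set meets only finitely
many boxes. -/
theorem finite_Z_inter {B : Set E} (hB : Bornology.IsBounded B) : (M.Z ∩ B).Finite := by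
  refine ((finite_image_openBox M.finite_T hB).subset (image_mono inter_subset_right)).of_finite_image
    fun z hz z' hz' h => ?_
  exact M.eq_of_mem_openBox_of_mem_Z hz'.1 (h ▸ mem_openBox_self : z ∈ openBox M.T z')

theorem isClosed_of_subset_Z {S : Set E} (hS : S ⊆ M.Z) : IsClosed S :=
  isClosed_of_inter_closedBall 0 fun _ =>
    ((M.finite_Z_inter isBounded_closedBall).subset (inter_subset_inter_left _ hS)).isClosed

theorem finite_image_cell {B : Set (E × E)} (hB : Bornology.IsBounded B) :
    (M.cell '' B).Finite := by
  have h1 : ((fun S => M.q '' S) '' (openBox (M.prodT - M.prodT) '' B)).Finite :=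
    (finite_image_openBox (M.finite_prodT.sub M.finite_prodT) hB).image _
  have hB1 : Bornology.IsBounded (Prod.fst '' B) := hB.image_fst
  have hB2 : Bornology.IsBounded (Prod.snd '' B) := hB.image_snd
  have h2 : (⋃ z ∈ M.Z ∩ Prod.fst '' B, (fun S => (fun y => M.q (z, y)) '' S) ''
      (openBox (M.lineT z - M.lineT z) '' (perp z '' (Prod.snd '' B)))).Finite := by
    refine (M.finite_Z_inter hB1).biUnion fun z _ => ?_
    refine (finite_image_openBox ((M.finite_lineT z).sub (M.finite_lineT z)) ?_).image _
    exact (LinearMap.toContinuousLinearMap (perp z)).lipschitz.isBounded_image hB2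
  refine (h1.union h2).subset ?_
  rintro _ ⟨p, hp, rfl⟩
  by_cases hpZ : p.1 ∈ M.Z
  · refine Or.inr ?_
    rw [M.cell_of_mem hpZ]
    simp only [mem_iUnion]
    exact ⟨p.1, ⟨hpZ, mem_image_of_mem _ hp⟩, mem_image_of_mem _ (mem_image_of_mem _
      (mem_image_of_mem _ (mem_image_of_mem _ hp)))⟩
  · refine Or.inl ?_
    rw [M.cell_of_notMem hpZ]
    exact mem_image_of_mem _ (mem_image_of_mem _ hp)

theorem exists_charMap_cell (p : E × E) : ∃ f : (Fin (M.dim p) → ℝ) → A,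
    ContinuousOn f (closedBall 0 1) ∧ InjOn f (ball 0 1) ∧ f '' ball 0 1 = M.cell p ∧
      ∃ J : Set (E × E), (M.cell '' J).Finite ∧ (∀ j ∈ J, M.dim j < M.dim p) ∧
        f '' sphere 0 1 ⊆ ⋃ j ∈ J, M.cell j := by
  have hqc := M.isQuotientMap_q.continuous
  by_cases hp : p.1 ∈ M.Z
  · rw [M.dim_of_mem hp, M.cell_of_mem hp]
    set F := M.lineT p.1 - M.lineT p.1
    set x := perp p.1 p.2
    have hfin : F.Finite := (M.finite_lineT p.1).sub (M.finite_lineT p.1)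
    have hsep : Separating F :=
      (M.separating_lineT hp).mono (subset_sub_self (M.zero_mem_lineT p.1))
    obtain ⟨f, hfc, hfi, hf1, hf2⟩ := exists_charMap hfin hsep x
    refine ⟨fun w => M.q (p.1, f w), (by fun_prop), ?_, ?_,
      (fun w => (p.1, w)) '' (closure (openBox F x) \ openBox F x), ?_, ?_, ?_⟩
    · intro w hw w' hw' h
      have h1 := M.perp_eq_of_mem_closure (subset_closure (hf1 ▸ mem_image_of_mem f hw))
      have h2 := M.perp_eq_of_mem_closure (subset_closure (hf1 ▸ mem_image_of_mem f hw'))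
      refine hfi ?_
      rcases ((M.q_eq_iff _ _ _ _).1 h).2 with h | ⟨-, h⟩
      · exact h
      · rw [← h1, ← h2, perp_eq_iff.2 h]
    · rw [← hf1, image_image]
    · refine M.finite_image_cell ?_
      have : Bornology.IsBounded (closure (openBox F x) \ openBox F x) :=
        (isBounded_openBox hfin hsep x).closure.subset sdiff_subset
      refine ((Bornology.isBounded_singleton (x := p.1)).prod this).subset ?_
      rintro _ ⟨w, hw, rfl⟩
      exact ⟨rfl, hw⟩
    · rintro _ ⟨w, hw, rfl⟩
      rw [M.dim_of_mem (p := (p.1, w)) hp]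
      change boxDim F (perp p.1 w) < _
      rw [M.perp_eq_of_mem_closure hw.1]
      exact boxDim_lt hw.1 hw.2
    · rintro _ ⟨w, hw, rfl⟩
      simp only [mem_iUnion]
      exact ⟨_, mem_image_of_mem _ (hf2 (mem_image_of_mem f hw)), M.q_mem_cell _⟩
  · rw [M.dim_of_notMem hp, M.cell_of_notMem hp]
    set F := M.prodT - M.prodT
    have hfin : F.Finite := M.finite_prodT.sub M.finite_prodT
    have hsep : Separating F := M.separating_prodT.mono (subset_sub_self M.zero_mem_prodT)
    obtain ⟨f, hfc, hfi, hf1, hf2⟩ := exists_charMap hfin hsep p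
    refine ⟨fun w => M.q (f w), (by fun_prop), ?_, ?_,
      closure (openBox F p) \ openBox F p, ?_, ?_, ?_⟩
    · intro w hw w' hw' h
      have h1 : f w ∈ openBox F p := hf1 ▸ mem_image_of_mem f hw
      have h2 : f w' ∈ openBox F p := hf1 ▸ mem_image_of_mem f hw'
      have hZ := M.notMem_Z_of_mem_openBox hp h1
      obtain ⟨h3, h4⟩ := (M.q_eq_iff (f w).1 (f w).2 (f w').1 (f w').2).1 h
      have h5 : (f w).2 = (f w').2 := h4.resolve_right fun h => hZ h.1
      refine hfi (Prod.ext ?_ h5)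
      rcases h3 with h3 | h3
      · exact h3
      -- If both `u` and `-u` lie in one box, then for each `g` the floor of `g u` equals minus its
      -- ceiling. As these integers differ by at most one, both vanish and `g u = 0`.
      have h0 : (f w).1 = 0 := by
        refine M.separating_T _ fun g hg => ?_
        have e1 := M.fst_floor_ceil h1 hg
        have e2 := M.fst_floor_ceil h2 hg
        rw [← e1.1, ← e1.2, neg_eq_iff_eq_neg.1 h3.symm, map_neg, Int.floor_neg, Int.ceil_neg] at e2
        have l1 := Int.floor_le (g (f w).1)
        have l2 := Int.le_ceil (g (f w).1)
        have l3 := Int.ceil_le_floor_add_one (g (f w).1)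
        have l4 := Int.floor_le_ceil (g (f w).1)
        have l5 : ⌊g (f w).1⌋ = 0 := by omega
        have l6 : ⌈g (f w).1⌉ = 0 := by omega
        rw [l5] at l1
        rw [l6] at l2
        exact le_antisymm (by simpa using l2) (by simpa using l1)
      rw [neg_eq_iff_eq_neg.1 h3.symm, h0, neg_zero]
    · rw [← hf1, image_image]
    · exact M.finite_image_cell ((isBounded_openBox hfin hsep p).closure.subset sdiff_subset)
    · exact fun r hr => (M.dim_le r).trans_lt (boxDim_lt hr.1 hr.2)
    · rintro _ ⟨w, hw, rfl⟩
      simp only [mem_iUnion]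
      exact ⟨_, hf2 (mem_image_of_mem f hw), M.q_mem_cell _⟩

/-- Closedness can be tested on closed balls upstairs, and each of these meets only finitely many
cells. -/
theorem isClosed_of_inter_closure_cell {B : Set A}
    (h : ∀ p, IsClosed (B ∩ closure (M.cell p))) : IsClosed B := by
  rw [← M.isQuotientMap_q.isClosed_preimage]
  refine isClosed_of_inter_closedBall 0 fun R => ?_
  have hU : IsClosed (⋃ S ∈ M.cell '' closedBall 0 R, B ∩ closure S) := by
    refine (M.finite_image_cell isBounded_closedBall).isClosed_biUnion ?_
    rintro _ ⟨p, -, rfl⟩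
    exact h p
  have : M.q ⁻¹' B ∩ closedBall 0 R =
      M.q ⁻¹' (⋃ S ∈ M.cell '' closedBall 0 R, B ∩ closure S) ∩ closedBall 0 R := by
    ext p
    refine ⟨fun ⟨h1, h2⟩ => ⟨?_, h2⟩, fun ⟨h1, h2⟩ => ⟨?_, h2⟩⟩
    · exact mem_biUnion (mem_image_of_mem _ h2) ⟨h1, subset_closure (M.q_mem_cell p)⟩
    · obtain ⟨S, -, hS⟩ := mem_iUnion₂.1 h1
      exact hS.1
  rw [this]
  exact (hU.preimage M.isQuotientMap_q.continuous).inter isClosed_closedBall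

/-- The element is lifted to an affine map returning a point to its own box, adjusted by the sign
identification or by the projection along `z`. Its linear part still has finite order, so the
rigidity of boxes applies. -/
theorem smul_eq_of_mem_cell (γ : G) (p : E × E)
    (h : (fun a => γ • a) '' M.cell p = M.cell p) : ∀ a ∈ M.cell p, γ • a = a := by
  intro a ha
  have hγ : γ • a ∈ M.cell p := h ▸ mem_image_of_mem _ ha
  obtain ⟨N, hN, hJN⟩ := M.exists_pow_J γ
  have hJpow (k : ℕ) (x : E) : ((M.L γ : E →ₗ[ℝ] E) ^ k) x = (M.J γ ^ k) x := by
    induction k generalizing x with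
    | zero => rfl
    | succ k ih =>
      rw [pow_succ, pow_succ, Module.End.mul_apply, ih]
      rfl
  have hLN : (M.L γ : E →ₗ[ℝ] E) ^ N = 1 := by
    ext x
    rw [hJpow, hJN]
    rfl
  by_cases hp : p.1 ∈ M.Z
  · rw [M.cell_of_mem hp] at ha hγ
    obtain ⟨w, hw, rfl⟩ := ha
    obtain ⟨b, hb, hbγ⟩ := hγ
    dsimp only at hbγ ⊢
    have hpw := M.perp_eq_of_mem_closure (subset_closure hw)
    have hpb := M.perp_eq_of_mem_closure (subset_closure hb)
    obtain ⟨z, y⟩ := p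
    dsimp only at *
    rw [M.smul_q, M.q_eq_iff] at hbγ
    obtain ⟨hJz, hdiff⟩ := hbγ
    have hlin : M.lineT (M.J γ z) = M.lineT z := by
      rcases hJz with h | h
      · rw [← h]
      · rw [neg_eq_iff_eq_neg.1 h.symm, lineT_neg]
    have hperp : perp (M.J γ z) = perp z := by
      rcases hJz with h | h
      · rw [← h]
      · rw [neg_eq_iff_eq_neg.1 h.symm, perp_neg]
    have hbw : b = M.L γ w + perp z (M.m γ) := by
      have h1 : perp z b = perp z (M.J γ w + M.m γ) := by
        rcases hdiff with h | ⟨-, h⟩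
        · rw [h]
        · exact perp_eq_iff.2 h
      rw [hpb, map_add] at h1
      rw [h1, ← hperp, perp_map, hpw, L_apply]
    have hbb : b ∈ openBox (M.lineT z - M.lineT z) w := by rwa [openBox_eq_of_mem hw]
    rw [hbw] at hbb
    have hc := M.comp_mem_lineT γ z
    rw [hlin] at hc
    have := map_add_eq_of_mem_openBox (L := (M.L γ : E →ₗ[ℝ] E)) (M.zero_mem_lineT z)
      (M.separating_lineT hp) hc (M.int_lineT hp (M.int_m γ)) hN hLN hbb
    rw [M.smul_q]
    refine ((M.q_eq_iff z b _ _).2 ⟨hJz, hdiff⟩).symm.trans ?_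
    rw [hbw]
    exact congrArg (fun x => M.q (z, x)) this
  · rw [M.cell_of_notMem hp] at ha hγ
    obtain ⟨a, ha, rfl⟩ := ha
    obtain ⟨b, hb, hbγ⟩ := hγ
    have hγa : γ • M.q a = M.q b := hbγ.symm
    rw [hγa]
    rw [M.smul_q'] at hbγ
    have hbZ := M.notMem_Z_of_mem_openBox hp hb
    obtain ⟨h1, h2⟩ := (M.q_eq_iff b.1 b.2 _ _).1 hbγ
    have h2 : b.2 = M.J γ a.2 + M.m γ := h2.resolve_right fun h => hbZ h.1
    obtain ⟨c, hc, h1⟩ : ∃ c : ℝ, (c = 1 ∨ c = -1) ∧ b.1 = c • M.J γ a.1 := by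
      rcases h1 with h | h
      · exact ⟨1, Or.inl rfl, by rw [h, one_smul]⟩
      · exact ⟨-1, Or.inr rfl, by rw [h, neg_one_smul]⟩
    -- The sign `c` accounts for a lift that may hit `(-u, y)` instead of `(u, y)`. It costs a
    -- factor 2 in the order of the linear part.
    let R : E × E →ₗ[ℝ] E × E := (c • (M.L γ : E →ₗ[ℝ] E)).prodMap (M.L γ : E →ₗ[ℝ] E)
    have hba : b = R a + (0, M.m γ) := by
      ext <;> simp [R, h1, h2, L_apply]
    have hRT : ∀ f ∈ M.prodT, f ∘ₗ R ∈ M.prodT := by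
      rintro _ (⟨f, hf, rfl⟩ | ⟨f, hf, rfl⟩)
      · have hcf : c • f ∈ M.T := by
          rcases hc with rfl | rfl
          · rwa [one_smul]
          · have : (-1 : ℝ) • f = -f := by ext x; simp
            exact this ▸ M.neg_mem_T f hf
        refine Or.inl ⟨_, M.comp_mem_T γ _ hcf, ?_⟩
        ext x <;> simp [R, L_apply]
      · exact Or.inr ⟨_, M.comp_mem_T γ f hf, rfl⟩
    have hRpow (k : ℕ) (x : E × E) :
        (R ^ k) x = (c ^ k • ((M.L γ : E →ₗ[ℝ] E) ^ k) x.1, ((M.L γ : E →ₗ[ℝ] E) ^ k) x.2) := by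
      induction k with
      | zero => simp
      | succ k ih =>
        simp only [pow_succ', Module.End.mul_apply, ih, R, LinearMap.prodMap_apply,
          LinearMap.smul_apply, map_smul, mul_smul]
        rw [smul_comm]
    have hR : R ^ (2 * N) = 1 := by
      refine LinearMap.ext fun x => ?_
      have hc2 : c ^ (2 * N) = 1 := by
        rw [pow_mul]
        rcases hc with rfl | rfl <;> simp
      rw [hRpow, hc2, mul_comm 2 N, pow_mul, hLN, one_pow]
      simp
    have hbb : R a + (0, M.m γ) ∈ openBox (M.prodT - M.prodT) a := by
      rwa [← hba, openBox_eq_of_mem ha]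
    rw [hba, map_add_eq_of_mem_openBox M.zero_mem_prodT M.separating_prodT hRT (M.int_prod_m γ)
      (by omega) hR hbb]

theorem exists_isCellularAction (M : CollapseModel G E A) [T2Space A] :
    ∃ _K : CWComplex (univ : Set A), IsCellularAction G A := by
  obtain ⟨K, h1, h2⟩ := exists_cwComplex_of_cells M.cell M.dim
    (by
      rintro p p' ⟨a, ha, ha'⟩
      obtain ⟨r, rfl⟩ := M.isQuotientMap_q.surjective a
      have e := M.cell_eq_of_mem ha
      have e' := M.cell_eq_of_mem ha'
      exact ⟨e.1.symm.trans e'.1, e.2.symm.trans e'.2⟩)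
    (by
      intro a
      obtain ⟨r, rfl⟩ := M.isQuotientMap_q.surjective a
      exact ⟨r, M.q_mem_cell r⟩)
    M.exists_charMap_cell (fun B => M.isClosed_of_inter_closure_cell)
  refine ⟨K, fun γ k i => ?_⟩
  obtain ⟨p, rfl, hp⟩ := h1 k i
  rw [hp]
  refine ⟨?_, M.smul_eq_of_mem_cell γ p⟩
  rw [(M.smul_cell γ p).1, ← (M.smul_cell γ p).2]
  obtain ⟨j, hj⟩ := h2 (M.act γ p)
  exact ⟨j, hj.symm⟩

theorem t2Space (M : CollapseModel G E A) : T2Space A := by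
  have hq := M.isQuotientMap_q
  -- functions which only depend on the class of the first coordinate
  have sep1 (u u' y y' : E) (h1 : u ≠ u') (h2 : u ≠ -u') :
      ∃ g : A → ℝ, Continuous g ∧ g (M.q (u, y)) ≠ g (M.q (u', y')) := by
    let F : E × E → ℝ := fun p => min ‖p.1 - u‖ ‖p.1 + u‖
    have hF (a b : E × E) (hab : M.q a = M.q b) : F a = F b := by
      obtain ⟨h | h, -⟩ := (M.q_eq_iff a.1 a.2 b.1 b.2).1 hab
      · simp only [F, h]
      · simp only [F, h]
        rw [min_comm, ← norm_neg, neg_add, neg_neg, ← sub_eq_add_neg, ← norm_neg (-b.1 - u),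
          neg_sub, sub_neg_eq_add, add_comm u]
    let g : A → ℝ := fun a => F (Function.surjInv hq.surjective a)
    have hg (p : E × E) : g (M.q p) = F p := hF _ _ (Function.surjInv_eq hq.surjective _)
    refine ⟨g, ?_, ?_⟩
    · rw [hq.continuous_iff]
      have : g ∘ M.q = F := funext hg
      rw [this]
      fun_prop
    · rw [hg, hg]
      have e1 : F (u, y) = 0 := by simp [F]
      have e2 : 0 < F (u', y') := by
        refine lt_min (norm_pos_iff.2 (sub_ne_zero.2 h1.symm)) (norm_pos_iff.2 fun h => h2 ?_)
        exact (neg_eq_of_add_eq_zero_right h).symm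
      rw [e1]
      exact e2.ne
  -- Over a fixed `u` the second coordinate is separated by `π`, which kills `u` when lines are
  -- collapsed there. An even cutoff, equal to 1 at `u` and `-u` and 0 on the rest of `Z`, makes the
  -- function constant on all other collapsed lines. The cutoff exists because all subsets of `Z`
  -- are closed.
  have sep2 (u y y' : E) (h : M.q (u, y) ≠ M.q (u, y')) :
      ∃ g : A → E, Continuous g ∧ g (M.q (u, y)) ≠ g (M.q (u, y')) := by
    obtain ⟨π, hπ, hπz⟩ : ∃ π : E →ₗ[ℝ] E, π y ≠ π y' ∧ (u ∈ M.Z → π u = 0) := by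
      rw [Ne, M.q_eq_iff] at h
      by_cases hu : u ∈ M.Z
      · refine ⟨perp u, fun h' => h ⟨Or.inl rfl, Or.inr ⟨hu, perp_eq_iff.1 h'⟩⟩,
          fun _ => perp_self u⟩
      · exact ⟨LinearMap.id, fun h' => h ⟨Or.inl rfl, Or.inl h'⟩, fun h' => absurd h' hu⟩
    obtain ⟨ρ, hρ0, hρ1, -⟩ := exists_continuous_zero_one_of_isClosed
      (M.isClosed_of_subset_Z (S := M.Z \ {u, -u}) sdiff_subset)
      (Set.toFinite {u, -u}).isClosed disjoint_sdiff_left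
    let F : E × E → E := fun p => (ρ p.1 * ρ (-p.1)) • π p.2
    have hF (a b : E × E) (hab : M.q a = M.q b) : F a = F b := by
      obtain ⟨a, x⟩ := a
      obtain ⟨b, x'⟩ := b
      obtain ⟨h1, h2⟩ := (M.q_eq_iff _ _ _ _).1 hab
      have e1 : ρ b * ρ (-b) = ρ a * ρ (-a) := by
        rcases h1 with h | h
        · rw [h]
        · rw [h, neg_neg, mul_comm]
      dsimp only [F]
      rw [e1]
      rcases h2 with h2 | ⟨haZ, h2⟩
      · rw [h2]
      by_cases hau : a = u ∨ a = -u
      · have : π a = 0 := by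
          rcases hau with rfl | rfl
          · exact hπz haZ
          · rw [map_neg, hπz (M.neg_mem_Z_iff.1 haZ), neg_zero]
        obtain ⟨c, hc⟩ := Submodule.mem_span_singleton.1 h2
        have e2 : π x - π x' = 0 := by rw [← map_sub, ← hc, map_smul, this, smul_zero]
        rw [sub_eq_zero.1 e2]
      · have : ρ a = 0 := hρ0 ⟨haZ, hau⟩
        simp [this]
    let g : A → E := fun a => F (Function.surjInv hq.surjective a)
    have hg (p : E × E) : g (M.q p) = F p := hF _ _ (Function.surjInv_eq hq.surjective _)
    refine ⟨g, ?_, ?_⟩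
    · rw [hq.continuous_iff]
      have : g ∘ M.q = F := funext hg
      rw [this]
      have := LinearMap.continuous_of_finiteDimensional π
      fun_prop
    · rw [hg, hg]
      have e1 : ρ u = 1 := hρ1 (Or.inl rfl)
      have e2 : ρ (-u) = 1 := hρ1 (Or.inr rfl)
      simpa [F, e1, e2] using hπ
  refine ⟨fun a b hab => ?_⟩
  obtain ⟨⟨u, y⟩, rfl⟩ := hq.surjective a
  obtain ⟨⟨u', y'⟩, rfl⟩ := hq.surjective b
  have sep2' (y y') (h : M.q (u, y) ≠ M.q (u, y')) : ∃ U V : Set A, IsOpen U ∧ IsOpen V ∧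
      M.q (u, y) ∈ U ∧ M.q (u, y') ∈ V ∧ Disjoint U V := by
    obtain ⟨g, hg, hne⟩ := sep2 u y y' h
    exact separated_by_continuous hg hne
  by_cases h1 : u = u'
  · subst h1
    exact sep2' y y' hab
  by_cases h2 : u = -u'
  · rw [← M.q_neg u' y', ← h2] at hab ⊢
    exact sep2' y y' hab
  obtain ⟨g, hg, hne⟩ := sep1 u u' y y' h1 h2
  exact separated_by_continuous hg hne

end CollapseModel

end Crystal

namespace Crystal

open Set Topology Metric Module
open scoped Pointwise unitInterval

/-! ### Contractibility of fixed sets in the collapse model -/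

theorem homotopic_of_mapsTo {X : Type*} [TopologicalSpace X] {S : Set X} {H : I × X → X}
    (hH : Continuous H) (hS : ∀ t, ∀ x ∈ S, H (t, x) ∈ S) (f g : C(S, S))
    (hf : ∀ x : S, H (0, x) = f x) (hg : ∀ x : S, H (1, x) = g x) : f.Homotopic g :=
  ⟨{ toFun := fun p => ⟨H (p.1, p.2), hS p.1 p.2 p.2.2⟩
     continuous_toFun := by fun_prop
     map_zero_left := fun x => Subtype.ext (hf x)
     map_one_left := fun x => Subtype.ext (hg x) }⟩

namespace CollapseModel

variable {G E A : Type*} [Group G] [NormedAddCommGroup E] [InnerProductSpace ℝ E]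
    [TopologicalSpace A] [MulAction G A] (M : CollapseModel G E A)

/-- Continuous families of maps compatible with the identifications descend to `A`. -/
theorem exists_homotopy {F : I → E × E → E × E} (hF : Continuous fun p : I × (E × E) => F p.1 p.2)
    (h : ∀ t p p', M.q p = M.q p' → M.q (F t p) = M.q (F t p')) :
    ∃ H : I × A → A, Continuous H ∧ ∀ t p, H (t, M.q p) = M.q (F t p) := by
  have hq := M.isQuotientMap_q
  refine ⟨fun x => M.q (F x.1 (Function.surjInv hq.surjective x.2)), ?_, fun t p => ?_⟩
  -- The product of a quotient map with the locally compact interval is again a quotient map.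
  · refine hq.continuous_lift_prod_right ?_
    have : (fun p : I × (E × E) => M.q (F p.1 (Function.surjInv hq.surjective (M.q p.2)))) =
        fun p : I × (E × E) => M.q (F p.1 p.2) :=
      funext fun p => h _ _ _ (Function.surjInv_eq hq.surjective _)
    exact this ▸ hq.continuous.comp hF
  · exact h _ _ _ (Function.surjInv_eq hq.surjective _)

/-- The contraction of the second factor. -/
theorem exists_homotopy_snd (y₀ : E) : ∃ H : I × A → A, Continuous H ∧
    ∀ (t : I) u y, H (t, M.q (u, y)) = M.q (u, (1 - t : ℝ) • y + (t : ℝ) • y₀) := by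
  obtain ⟨H, hH, h⟩ := M.exists_homotopy
    (F := fun t p => (p.1, (1 - t : ℝ) • p.2 + (t : ℝ) • y₀)) (by fun_prop) (by
      rintro t ⟨u, y⟩ ⟨u', y'⟩ h
      obtain ⟨h1, h2⟩ := (M.q_eq_iff _ _ _ _).1 h
      refine (M.q_eq_iff _ _ _ _).2 ⟨h1, ?_⟩
      rcases h2 with rfl | ⟨hu, hy⟩
      · exact Or.inl rfl
      · refine Or.inr ⟨hu, ?_⟩
        rw [add_sub_add_right_eq_sub, ← smul_sub]
        exact Submodule.smul_mem _ _ hy)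
  exact ⟨H, hH, fun t u y => h t (u, y)⟩

/-- The contraction of the first factor. -/
theorem exists_homotopy_fst (y₀ : E) : ∃ H : I × A → A, Continuous H ∧
    ∀ (t : I) u y, H (t, M.q (u, y)) = M.q ((1 - t : ℝ) • u, y₀) := by
  -- The second coordinate must be held at `y₀`: moving `u` out of `Z` would otherwise separate
  -- points of one collapsed line.
  obtain ⟨H, hH, h⟩ := M.exists_homotopy
    (F := fun t p => ((1 - t : ℝ) • p.1, y₀)) (by fun_prop) (by
      rintro t ⟨u, y⟩ ⟨u', y'⟩ h
      obtain ⟨h1, h2⟩ := (M.q_eq_iff _ _ _ _).1 h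
      refine (M.q_eq_iff _ _ _ _).2 ⟨?_, Or.inl rfl⟩
      rcases h1 with rfl | rfl
      · exact Or.inl rfl
      · exact Or.inr (smul_neg _ _))
  exact ⟨H, hH, fun t u y => h t (u, y)⟩

variable {M} {V : Subgroup G}

theorem q_mem_fixedPoints_iff {u y : E} : M.q (u, y) ∈ MulAction.fixedPoints V A ↔
    ∀ γ ∈ V, (M.J γ u = u ∨ M.J γ u = -u) ∧
      (M.J γ y + M.m γ = y ∨ u ∈ M.Z ∧ M.J γ y + M.m γ - y ∈ Submodule.span ℝ {u}) := by
  have key (γ : G) : γ • M.q (u, y) = M.q (u, y) ↔ (M.J γ u = u ∨ M.J γ u = -u) ∧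
      (M.J γ y + M.m γ = y ∨ u ∈ M.Z ∧ M.J γ y + M.m γ - y ∈ Submodule.span ℝ {u}) := by
    rw [M.smul_q, eq_comm, M.q_eq_iff, eq_comm (a := u), eq_comm (a := u) (b := -M.J γ u),
      neg_eq_iff_eq_neg, eq_comm (a := y), ← neg_mem_iff (x := y - _), neg_sub]
  exact ⟨fun h γ hγ => (key γ).1 (h ⟨γ, hγ⟩), fun h γ => (key γ).2 (h γ γ.2)⟩

/-- For fixed `u`, being fixed is an affine condition on `y`: the displacement is zero, or lies in
the span of `u` when `u ∈ M.Z`. -/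
theorem segment_mem_fixedPoints {u y y₀ : E} (h : M.q (u, y) ∈ MulAction.fixedPoints V A)
    (h₀ : M.q (u, y₀) ∈ MulAction.fixedPoints V A) (t : I) :
    M.q (u, (1 - t : ℝ) • y + (t : ℝ) • y₀) ∈ MulAction.fixedPoints V A := by
  rw [q_mem_fixedPoints_iff] at *
  intro γ hγ
  obtain ⟨h1, h2⟩ := h γ hγ
  obtain ⟨-, h3⟩ := h₀ γ hγ
  refine ⟨h1, ?_⟩
  have e : M.J γ ((1 - t : ℝ) • y + (t : ℝ) • y₀) + M.m γ - ((1 - t : ℝ) • y + (t : ℝ) • y₀) =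
      (1 - t : ℝ) • (M.J γ y + M.m γ - y) + (t : ℝ) • (M.J γ y₀ + M.m γ - y₀) := by
    rw [map_add, map_smul, map_smul]
    module
  by_cases hu : u ∈ M.Z
  · refine Or.inr ⟨hu, ?_⟩
    rw [e]
    have aux {x : E} (hx : M.J γ x + M.m γ = x ∨
        u ∈ M.Z ∧ M.J γ x + M.m γ - x ∈ Submodule.span ℝ {u}) :
        M.J γ x + M.m γ - x ∈ Submodule.span ℝ {u} := by
      rcases hx with hx | hx
      · rw [hx, sub_self]
        exact zero_mem _
      · exact hx.2
    exact add_mem (Submodule.smul_mem _ _ (aux h2)) (Submodule.smul_mem _ _ (aux h3))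
  · refine Or.inl (sub_eq_zero.1 ?_)
    rw [e, h2.resolve_right fun h => hu h.1, h3.resolve_right fun h => hu h.1]
    simp

theorem homotopic_fixedPoints {y₀ : E}
    (h₀ : ∀ u y, M.q (u, y) ∈ MulAction.fixedPoints V A →
      M.q (u, y₀) ∈ MulAction.fixedPoints V A)
    (g : C(MulAction.fixedPoints V A, MulAction.fixedPoints V A))
    (hg : ∀ (x : MulAction.fixedPoints V A) u y, x.1 = M.q (u, y) → (g x).1 = M.q (u, y₀)) :
    (ContinuousMap.id _).Homotopic g := by
  obtain ⟨H, hH, h⟩ := M.exists_homotopy_snd y₀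
  refine homotopic_of_mapsTo hH (fun t x hx => ?_) _ _ (fun x => ?_) fun x => ?_
  · obtain ⟨⟨u, y⟩, rfl⟩ := M.isQuotientMap_q.surjective x
    rw [h]
    exact segment_mem_fixedPoints hx (h₀ u y hx) t
  · obtain ⟨⟨u, y⟩, hx⟩ := M.isQuotientMap_q.surjective x.1
    rw [← hx, h]
    simp [hx]
  · obtain ⟨⟨u, y⟩, hx⟩ := M.isQuotientMap_q.surjective x.1
    rw [← hx, h, hg x u y hx.symm]
    simp

/-- The fixed set of a group with a fixed point in Euclidean space is contractible. -/
theorem contractibleSpace_fixedPoints {y₀ : E} (h₀ : ∀ γ ∈ V, M.J γ y₀ + M.m γ = y₀) :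
    ContractibleSpace (MulAction.fixedPoints V A) := by
  have hfix (u y : E) (hu : M.q (u, y) ∈ MulAction.fixedPoints V A) (t : ℝ) :
      M.q (t • u, y₀) ∈ MulAction.fixedPoints V A := by
    rw [q_mem_fixedPoints_iff] at *
    intro γ hγ
    refine ⟨?_, Or.inl (h₀ γ hγ)⟩
    rw [map_smul]
    rcases (hu γ hγ).1 with h | h
    · exact Or.inl (by rw [h])
    · exact Or.inr (by rw [h, smul_neg])
  obtain ⟨H, hH, h⟩ := M.exists_homotopy_fst y₀
  have hmaps (t : I) (x) (hx : x ∈ MulAction.fixedPoints V A) :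
      H (t, x) ∈ MulAction.fixedPoints V A := by
    obtain ⟨⟨u, y⟩, rfl⟩ := M.isQuotientMap_q.surjective x
    rw [h]
    exact hfix u y hx _
  let g : C(MulAction.fixedPoints V A, MulAction.fixedPoints V A) :=
    ⟨fun x => ⟨H (0, x), hmaps 0 x x.2⟩, by fun_prop⟩
  have hpt : M.q (0, y₀) ∈ MulAction.fixedPoints V A := by
    rw [q_mem_fixedPoints_iff]
    exact fun γ hγ => ⟨Or.inl (map_zero _), Or.inl (h₀ γ hγ)⟩
  rw [contractible_iff_id_nullhomotopic]
  -- The second coordinate is first slid to `y₀`; then the first coordinate is scaled to 0. The map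
  -- `g` is where the two homotopies meet.
  refine ⟨⟨_, hpt⟩, (homotopic_fixedPoints (M := M) (y₀ := y₀) ?_ g ?_).trans
    (homotopic_of_mapsTo hH hmaps _ _ (fun x => rfl) fun x => ?_)⟩
  · intro u y hu
    simpa using hfix u y hu 1
  · intro x u y hx
    change H (0, x.1) = _
    rw [hx, h]
    simp
  · obtain ⟨⟨u, y⟩, hx⟩ := M.isQuotientMap_q.surjective x.1
    rw [← hx, h]
    simp

/-- The fixed set of a group fixing a line, but no points of Euclidean space, is contractible. -/
theorem contractibleSpace_fixedPoints_of_line {z y₀ : E}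
    (hz : ∀ u y, M.q (u, y) ∈ MulAction.fixedPoints V A → u = z ∨ u = -z)
    (h₀ : M.q (z, y₀) ∈ MulAction.fixedPoints V A) :
    ContractibleSpace (MulAction.fixedPoints V A) := by
  have hq (u y : E) (h : M.q (u, y) ∈ MulAction.fixedPoints V A) :
      M.q (u, y₀) = M.q (z, y₀) := by
    rcases hz u y h with rfl | rfl
    · rfl
    · exact M.q_neg _ _
  rw [contractible_iff_id_nullhomotopic]
  refine ⟨⟨_, h₀⟩, homotopic_fixedPoints (M := M) (y₀ := y₀) ?_ _ ?_⟩
  · intro u y hu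
    rwa [hq u y hu]
  · intro x u y hx
    rw [hq u y (hx ▸ x.2)]
    rfl

end CollapseModel

end Crystal

namespace Crystal

open Set Topology Metric Module

/-! ### Maximal displacement of linear isometries -/

section LinearAlgebra

variable {E : Type*} [NormedAddCommGroup E] [InnerProductSpace ℝ E]

theorem eq_zero_of_forall_quadratic_nonneg {a b : ℝ} (h : ∀ t : ℝ, 0 ≤ t * a + t ^ 2 * b) :
    a = 0 := by
  have hb : 0 < |b| + 1 := by positivity
  have h1 := h (-a / (|b| + 1))
  have h2 : -a / (|b| + 1) * a + (-a / (|b| + 1)) ^ 2 * b =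
      -(a ^ 2 * (|b| + 1 - b) / (|b| + 1) ^ 2) := by
    field_simp
    ring
  rw [h2] at h1
  have h3 : 0 < |b| + 1 - b := by linarith [le_abs_self b]
  by_contra ha
  have : 0 < a ^ 2 * (|b| + 1 - b) / (|b| + 1) ^ 2 := by positivity
  linarith

/-- The vectors on which the displacement `A x - x` behaves like a conformal map of factor `m`. -/
def maxRotationSpace (A : E ≃ₗᵢ[ℝ] E) (m : ℝ) : Submodule ℝ E where
  carrier := {x | ∀ y, inner ℝ (A x - x) (A y - y) = m ^ 2 * inner ℝ x y}
  zero_mem' := by simp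
  add_mem' := by
    intro a b ha hb y
    rw [map_add, add_sub_add_comm, inner_add_left, inner_add_left, ha y, hb y]
    ring
  smul_mem' := by
    intro c a ha y
    rw [map_smul, ← smul_sub, inner_smul_left, inner_smul_left, ha y]
    simp
    ring

/-- The quadratic form `m ^ 2 * ‖x‖ ^ 2 - ‖A x - x‖ ^ 2` is nonnegative, so any vector on which it
vanishes lies in its radical. This follows by varying `x` in the direction of `y`. -/
theorem mem_maxRotationSpace_of_norm_eq {A : E ≃ₗᵢ[ℝ] E} {m : ℝ}
    (hm : ∀ x, ‖A x - x‖ ≤ m * ‖x‖) {x : E} (hx : ‖A x - x‖ = m * ‖x‖) :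
    x ∈ maxRotationSpace A m := by
  intro y
  have key (t : ℝ) : 0 ≤ t * (2 * (m ^ 2 * inner ℝ x y - inner ℝ (A x - x) (A y - y))) +
      t ^ 2 * (m ^ 2 * ‖y‖ ^ 2 - ‖A y - y‖ ^ 2) := by
    have h1 := hm (x + t • y)
    have e1 : A (x + t • y) - (x + t • y) = (A x - x) + t • (A y - y) := by
      rw [map_add, map_smul]
      module
    have h2 := pow_le_pow_left₀ (norm_nonneg _) h1 2
    rw [e1, mul_pow, norm_add_sq_real, norm_add_sq_real, hx, norm_smul, norm_smul,
      inner_smul_right, inner_smul_right, mul_pow, mul_pow, mul_pow, Real.norm_eq_abs, sq_abs] at h2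
    linarith
  have := eq_zero_of_forall_quadratic_nonneg key
  linarith

theorem map_mem_maxRotationSpace {A : E ≃ₗᵢ[ℝ] E} {m : ℝ} {x : E}
    (hx : x ∈ maxRotationSpace A m) : A x ∈ maxRotationSpace A m := by
  intro y
  have h := hx (A.symm y)
  rw [← A.inner_map_map (A x - x), ← A.inner_map_map x] at h
  simpa using h

theorem symm_mem_maxRotationSpace {A : E ≃ₗᵢ[ℝ] E} {m : ℝ} {x : E}
    (hx : x ∈ maxRotationSpace A m) : A.symm x ∈ maxRotationSpace A m := by
  intro y
  have h := hx (A y)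
  rw [← A.inner_map_map, ← A.inner_map_map (A.symm x)]
  simpa using h

theorem norm_eq_of_mem_maxRotationSpace {A : E ≃ₗᵢ[ℝ] E} {m : ℝ} (hm : 0 ≤ m) {x : E}
    (hx : x ∈ maxRotationSpace A m) : ‖A x - x‖ = m * ‖x‖ := by
  have := hx x
  rw [real_inner_self_eq_norm_sq, real_inner_self_eq_norm_sq, ← mul_pow] at this
  exact (pow_left_inj₀ (norm_nonneg _) (by positivity) two_ne_zero).1 this

theorem map_mem_orthogonal {A : E ≃ₗᵢ[ℝ] E} {m : ℝ} {x : E}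
    (hx : x ∈ (maxRotationSpace A m)ᗮ) : A x ∈ (maxRotationSpace A m)ᗮ := by
  intro w hw
  have := hx _ (symm_mem_maxRotationSpace hw)
  rw [← A.inner_map_map] at this
  simpa using this

theorem exists_max_displacement [FiniteDimensional ℝ E] (A : E ≃ₗᵢ[ℝ] E) (W : Submodule ℝ E)
    (hW : W ≠ ⊥) : ∃ x ∈ W, ‖x‖ = 1 ∧ ∀ y ∈ W, ‖A y - y‖ ≤ ‖A x - x‖ * ‖y‖ := by
  obtain ⟨w, hw, hw0⟩ := W.exists_mem_ne_zero_of_ne_bot hW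
  have hc : IsCompact ((W : Set E) ∩ sphere 0 1) :=
    (isCompact_sphere 0 1).inter_left W.closed_of_finiteDimensional
  obtain ⟨x, hx, hmax⟩ := hc.exists_isMaxOn (f := fun x => ‖A x - x‖)
    ⟨‖w‖⁻¹ • w, W.smul_mem _ hw, by simp [norm_smul, hw0]⟩ (by fun_prop)
  refine ⟨x, hx.1, by simpa using hx.2, fun y hy => ?_⟩
  rcases eq_or_ne y 0 with rfl | hy0
  · simp
  have hyn : 0 < ‖y‖ := norm_pos_iff.2 hy0
  have := hmax (a := ‖y‖⁻¹ • y) ⟨W.smul_mem _ hy, by simp [norm_smul, hy0]⟩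
  simp only [mem_ofPred_eq, map_smul, ← smul_sub, norm_smul, norm_inv, norm_norm] at this
  rwa [inv_mul_le_iff₀ hyn, mul_comm] at this

/-- A nontrivial rotation has a subspace of maximal displacement with a spectral gap. -/
theorem exists_maxRotation [FiniteDimensional ℝ E] {A : E ≃ₗᵢ[ℝ] E} (hA : A ≠ 1) :
    ∃ m m' : ℝ, 0 ≤ m' ∧ m' < m ∧ (∀ x, ‖A x - x‖ ≤ m * ‖x‖) ∧
      (∃ u ∈ maxRotationSpace A m, ‖u‖ = 1) ∧
      ∀ x ∈ (maxRotationSpace A m)ᗮ, ‖A x - x‖ ≤ m' * ‖x‖ := by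
  obtain ⟨v, hv⟩ : ∃ v, A v ≠ v := by
    by_contra! h
    exact hA (LinearIsometryEquiv.ext h)
  have htop : (⊤ : Submodule ℝ E) ≠ ⊥ := by
    intro h
    have h0 : v ∈ (⊥ : Submodule ℝ E) := h ▸ Submodule.mem_top
    rw [(Submodule.mem_bot ℝ).1 h0, map_zero] at hv
    exact hv rfl
  obtain ⟨x, -, hx1, hx⟩ := exists_max_displacement A ⊤ htop
  set m := ‖A x - x‖ with hmdef
  have hm (y : E) : ‖A y - y‖ ≤ m * ‖y‖ := hx y Submodule.mem_top
  have hmpos : 0 < m := by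
    refine lt_of_le_of_ne (norm_nonneg _) fun h => ?_
    have := hm v
    rw [← h, zero_mul] at this
    exact hv (sub_eq_zero.1 (norm_le_zero_iff.1 this))
  have hxW : x ∈ maxRotationSpace A m := mem_maxRotationSpace_of_norm_eq hm (by rw [hx1, mul_one])
  by_cases hW : (maxRotationSpace A m)ᗮ = ⊥
  · refine ⟨m, 0, le_rfl, hmpos, hm, ⟨x, hxW, hx1⟩, fun y hy => ?_⟩
    rw [hW, Submodule.mem_bot] at hy
    simp [hy]
  · obtain ⟨x', hx'W, hx'1, hx'⟩ := exists_max_displacement A _ hW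
    refine ⟨m, ‖A x' - x'‖, norm_nonneg _, ?_, hm, ⟨x, hxW, hx1⟩, hx'⟩
    refine lt_of_le_of_ne (by simpa [hx'1] using hm x') fun h => ?_
    have := mem_maxRotationSpace_of_norm_eq hm (x := x') (by rw [hx'1, mul_one, h])
    have h0 : inner ℝ x' x' = 0 := hx'W x' this
    rw [inner_self_eq_zero] at h0
    rw [h0, norm_zero] at hx'1
    exact zero_ne_one hx'1

/-- Isometries lie in the compact unit ball of operators. Only the Cauchy property of a convergent
subsequence is needed. -/
theorem exists_subseq_isometry [FiniteDimensional ℝ E] (A : ℕ → (E ≃ₗᵢ[ℝ] E)) :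
    ∃ φ : ℕ → ℕ, StrictMono φ ∧ ∀ ε > 0, ∃ N, ∀ i ≥ N, ∀ j ≥ N, ∀ x,
      ‖A (φ i) x - A (φ j) x‖ ≤ ε * ‖x‖ := by
  let B : ℕ → (E →L[ℝ] E) := fun k => (A k).toContinuousLinearEquiv
  have hB (k) : B k ∈ closedBall (0 : E →L[ℝ] E) 1 := by
    rw [mem_closedBall_zero_iff]
    exact ContinuousLinearMap.opNorm_le_bound _ zero_le_one fun x => by simp [B]
  have : ProperSpace (E →L[ℝ] E) := FiniteDimensional.proper ℝ _
  obtain ⟨C, -, φ, hφ, hC⟩ := (isCompact_closedBall (0 : E →L[ℝ] E) 1).tendsto_subseq hB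
  refine ⟨φ, hφ, fun ε hε => ?_⟩
  obtain ⟨N, hN⟩ := Metric.cauchySeq_iff.1 hC.cauchySeq ε hε
  refine ⟨N, fun i hi j hj x => ?_⟩
  have := hN i hi j hj
  rw [dist_eq_norm] at this
  exact (ContinuousLinearMap.le_opNorm (B (φ i) - B (φ j)) x).trans
    (mul_le_mul_of_nonneg_right this.le (norm_nonneg x))

/-- The best constant for the displacement of an isometry. -/
theorem exists_displacement_bound [FiniteDimensional ℝ E] (B : E ≃ₗᵢ[ℝ] E) {ε : ℝ} (hε0 : 0 ≤ ε)
    (hε : ∀ x, ‖B x - x‖ ≤ ε * ‖x‖) :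
    ∃ κ, 0 ≤ κ ∧ κ ≤ ε ∧ (∀ x, ‖B x - x‖ ≤ κ * ‖x‖) ∧ (B = 1 → κ = 0) := by
  by_cases hB : B = 1
  · exact ⟨0, le_rfl, hε0, fun x => by simp [hB], fun _ => rfl⟩
  · exact ⟨ε, hε0, le_rfl, hε, fun h => absurd h hB⟩

end LinearAlgebra

/-! ### Bieberbach's theorem -/

section Bieberbach

variable {n : ℕ} {Γ : Subgroup (Isom n)}

theorem isom_apply (γ : Isom n) (x : Euc n) : γ x = linearPart γ x + γ 0 := by
  simpa using isom_add γ x 0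

theorem norm_isom_sub (γ : Isom n) (x y : Euc n) : ‖γ x - γ y‖ = ‖x - y‖ := by
  rw [← dist_eq_norm, ← dist_eq_norm, γ.dist_map]

theorem isom_mul_apply (γ γ' : Isom n) (x : Euc n) : (γ * γ') x = γ (γ' x) := rfl

theorem isom_inv_apply (γ : Isom n) (x : Euc n) : γ⁻¹ (γ x) = x := γ.symm_apply_apply x

theorem isom_apply_inv (γ : Isom n) (x : Euc n) : γ (γ⁻¹ x) = x := γ.apply_symm_apply x

theorem norm_inv_zero (γ : Isom n) : ‖γ⁻¹ (0 : Euc n)‖ = ‖γ (0 : Euc n)‖ := by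
  rw [← sub_zero (γ⁻¹ (0 : Euc n)), ← norm_isom_sub γ, isom_apply_inv, zero_sub, norm_neg]

theorem eq_constVAdd_of_linearPart_eq_one {γ : Isom n} (h : linearPart γ = 1) :
    γ = AffineIsometryEquiv.constVAdd ℝ (Euc n) (γ 0) := by
  ext1 x
  rw [isom_apply, h]
  exact add_comm _ _

theorem zero_mem_translationVectors_of_linearPart {γ : Isom n} (hγ : γ ∈ Γ)
    (h : linearPart γ = 1) : γ (0 : Euc n) ∈ translationVectors Γ := by
  change _ ∈ Γ
  rwa [← eq_constVAdd_of_linearPart_eq_one h]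

theorem IsCrystallographic.finite_inter (hΓ : IsCrystallographic Γ) {K : Set (Euc n)} (hK : IsCompact K) :
    {γ : Γ | ∃ x ∈ K, (γ : Isom n) x ∈ K}.Finite := by
  have := hΓ.properlyDiscontinuous
  refine (ProperlyDiscontinuousSMul.finite_disjoint_inter_image (Γ := Γ) hK hK).subset ?_
  rintro γ ⟨x, hx, hγ⟩
  exact ⟨(γ : Isom n) x, ⟨x, hx, rfl⟩, hγ⟩

theorem IsCrystallographic.finite_norm_le (hΓ : IsCrystallographic Γ) (R : ℝ) :
    {γ : Γ | ‖(γ : Isom n) (0 : Euc n)‖ ≤ R}.Finite := by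
  refine (hΓ.finite_inter (isCompact_closedBall (0 : Euc n) |R|)).subset fun γ hγ => ?_
  exact ⟨0, by simp, by simpa using hγ.trans (le_abs_self R)⟩

theorem IsCrystallographic.exists_dense (hΓ : IsCrystallographic Γ) :
    ∃ d : ℝ, ∀ x : Euc n, ∃ γ ∈ Γ, ‖γ (0 : Euc n) - x‖ ≤ d := by
  obtain ⟨K, hK, h⟩ := hΓ.cocompact
  obtain ⟨d, hd⟩ := hK.isBounded.exists_norm_le
  refine ⟨d, fun x => ?_⟩
  obtain ⟨γ, hγ⟩ := h x
  refine ⟨(γ : Isom n)⁻¹, Γ.inv_mem γ.2, ?_⟩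
  rw [← norm_isom_sub (γ : Isom n), isom_apply_inv, zero_sub, norm_neg]
  exact hd _ hγ

theorem IsCrystallographic.exists_min (hΓ : IsCrystallographic Γ) {S : Set Γ} (hS : S.Nonempty) :
    ∃ γ ∈ S, ∀ γ' ∈ S, ‖(γ : Isom n) (0 : Euc n)‖ ≤ ‖(γ' : Isom n) (0 : Euc n)‖ := by
  obtain ⟨γ₀, h₀⟩ := hS
  obtain ⟨γ, hγ, hmin⟩ := Set.exists_min_image
    (S ∩ {γ : Γ | ‖(γ : Isom n) (0 : Euc n)‖ ≤ ‖(γ₀ : Isom n) (0 : Euc n)‖})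
    (fun γ => ‖(γ : Isom n) (0 : Euc n)‖) ((hΓ.finite_norm_le _).inter_of_right _)
    ⟨γ₀, h₀, le_refl ‖(γ₀ : Isom n) (0 : Euc n)‖⟩
  refine ⟨γ, hγ.1, fun γ' hγ' => ?_⟩
  rcases le_total ‖(γ' : Isom n) (0 : Euc n)‖ ‖(γ₀ : Isom n) (0 : Euc n)‖ with h | h
  · exact hmin γ' ⟨hγ', h⟩
  · exact hγ.2.trans h

/-- There are group elements with nearly trivial linear part and translational part pointing
nearly into any prescribed direction. -/
theorem IsCrystallographic.exists_near_translation (hΓ : IsCrystallographic Γ) (u : Euc n)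
    {ε δ : ℝ} (hε : 0 < ε) (hδ : 0 < δ) : ∃ β ∈ Γ, (∀ x, ‖linearPart β x - x‖ ≤ ε * ‖x‖) ∧
      ∃ s : ℝ, 0 < s ∧ ‖β (0 : Euc n) - s • u‖ ≤ δ * s := by
  obtain ⟨d, hd⟩ := hΓ.exists_dense
  -- The element `g k` moves the origin to within `d` of `k • u`. Two members of a subsequence with
  -- nearby linear parts have a quotient with almost trivial linear part, and taking `j` large makes
  -- the bounded error small relative to `j`.
  choose g hg hgd using fun k : ℕ => hd ((k : ℝ) • u)
  obtain ⟨φ, hφ, hA⟩ := exists_subseq_isometry fun k => linearPart (g k)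
  obtain ⟨N, hN⟩ := hA ε hε
  obtain ⟨M, hM⟩ := exists_nat_gt ((‖g (φ N) (0 : Euc n)‖ + d) / δ)
  set j := φ (max N (M + 1))
  have hj : M + 1 ≤ j := (le_max_right _ _).trans (hφ.id_le _)
  have hj' : ((M : ℝ) + 1) ≤ j := by exact_mod_cast hj
  refine ⟨g j * (g (φ N))⁻¹, Γ.mul_mem (hg _) (Γ.inv_mem (hg _)), fun x => ?_, j, ?_, ?_⟩
  · obtain ⟨y, rfl⟩ := (linearPart (g (φ N))).surjective x
    have e : linearPart (g j * (g (φ N))⁻¹) (linearPart (g (φ N)) y) = linearPart (g j) y := by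
      change (linearPart (g j * (g (φ N))⁻¹) * linearPart (g (φ N))) y = _
      rw [← map_mul, inv_mul_cancel_right]
    rw [e, LinearIsometryEquiv.norm_map]
    exact hN _ (le_max_left _ _) _ le_rfl y
  · have : (0 : ℝ) ≤ M := Nat.cast_nonneg M
    linarith
  · rw [div_lt_iff₀ hδ] at hM
    have h1 : ‖g j ((g (φ N))⁻¹ (0 : Euc n)) - g j 0‖ = ‖g (φ N) (0 : Euc n)‖ := by
      rw [norm_isom_sub, sub_zero, norm_inv_zero]
    rw [isom_mul_apply]
    calc ‖g j ((g (φ N))⁻¹ (0 : Euc n)) - (j : ℝ) • u‖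
        ≤ ‖g j ((g (φ N))⁻¹ (0 : Euc n)) - g j 0‖ + ‖g j 0 - (j : ℝ) • u‖ := norm_sub_le_norm_sub_add_norm_sub _ _ _
      _ ≤ ‖g (φ N) (0 : Euc n)‖ + d := by rw [h1]; linarith [hgd j]
      _ ≤ δ * j := by nlinarith

/-- Group elements with linear part close to the identity are translations. -/
theorem IsCrystallographic.linearPart_eq_one (hΓ : IsCrystallographic Γ) {α : Isom n} (hα : α ∈ Γ)
    (h : ∀ x, ‖linearPart α x - x‖ ≤ 1 / 2 * ‖x‖) : linearPart α = 1 := by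
  by_contra hne
  -- A counterexample `α` is taken with minimal translational part. Commuting it with a suitable `β`
  -- will produce an element contradicting the minimality of `β`.
  obtain ⟨⟨α, hα⟩, ⟨hhalf, hne⟩, hmin⟩ := hΓ.exists_min (S := {γ : Γ |
    (∀ x, ‖linearPart (γ : Isom n) x - x‖ ≤ 1 / 2 * ‖x‖) ∧ linearPart (γ : Isom n) ≠ 1})
    ⟨⟨α, hα⟩, h, hne⟩
  dsimp only at hhalf hne hmin
  obtain ⟨m, m', hm'0, hm'm, hm, ⟨u, huW, hu1⟩, hm'⟩ := exists_maxRotation hne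
  set A := linearPart α with hA
  set W := maxRotationSpace A m with hW
  have hmhalf : m ≤ 1 / 2 := by
    have := hhalf u
    rwa [norm_eq_of_mem_maxRotationSpace (hm'0.trans hm'm.le) huW, hu1, mul_one, mul_one] at this
  -- The spectral gap divided by 8 makes the error `r` below at most `(m - m') / 4 * ‖b‖`, so that
  -- the commutator still points mainly into `W`.
  set ε := (m - m') / 8 with hεdef
  have hε : 0 < ε := by rw [hεdef]; linarith
  let π : Euc n →L[ℝ] Euc n := W.starProjection
  let π' : Euc n →L[ℝ] Euc n := Wᗮ.starProjection
  have hππ' (x) : π x + π' x = x := W.starProjection_add_starProjection_orthogonal x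
  have hπn (x) : ‖π x‖ ≤ ‖x‖ := W.norm_starProjection_apply_le x
  have hπ'n (x) : ‖π' x‖ ≤ ‖x‖ := Wᗮ.norm_starProjection_apply_le x
  -- Among elements with linear part near the identity and translational part mainly along `W`, `β`
  -- has the shortest translational part. Such elements exist by approximating the direction of `u ∈
  -- W`.
  obtain ⟨⟨β, hβ⟩, ⟨hβε, hβW⟩, hβmin⟩ := hΓ.exists_min (S := {γ : Γ |
    (∀ x, ‖linearPart (γ : Isom n) x - x‖ ≤ ε * ‖x‖) ∧
      ‖π' ((γ : Isom n) (0 : Euc n))‖ < ‖π ((γ : Isom n) (0 : Euc n))‖}) (by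
    obtain ⟨β, hβ, h1, s, hs, h2⟩ := hΓ.exists_near_translation u hε (δ := 1 / 4) (by norm_num)
    refine ⟨⟨β, hβ⟩, h1, ?_⟩
    have hπu : π u = u := Submodule.starProjection_eq_self_iff.2 huW
    have hπ'u : π' u = 0 := by simpa [hπu] using hππ' u
    have e1 := hπn (β (0 : Euc n) - s • u)
    have e2 := hπ'n (β (0 : Euc n) - s • u)
    rw [map_sub, map_smul, hπu] at e1
    rw [map_sub, map_smul, hπ'u, smul_zero, sub_zero] at e2
    have e3 := norm_sub_norm_le (s • u) (π (β (0 : Euc n)))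
    rw [norm_smul, hu1, mul_one, Real.norm_of_nonneg hs.le, norm_sub_rev] at e3
    change ‖π' (β (0 : Euc n))‖ < ‖π (β (0 : Euc n))‖
    linarith)
  dsimp only at hβε hβW hβmin
  set B := linearPart β with hB
  set a := α (0 : Euc n) with ha
  set b := β (0 : Euc n) with hb
  obtain ⟨κ, hκ0, hκε, hκ, hκ1⟩ := exists_displacement_bound B hε.le hβε
  set c : Isom n := α * β * α⁻¹ * β⁻¹ with hc
  have hcΓ : c ∈ Γ := Γ.mul_mem (Γ.mul_mem (Γ.mul_mem hα hβ) (Γ.inv_mem hα)) (Γ.inv_mem hβ)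
  have hcαβ : c * (β * α) = α * β := by rw [hc]; group
  set C := linearPart c with hC
  have hCBA (x) : C (B (A x)) = A (B x) := by
    have := congrArg linearPart hcαβ
    rw [map_mul, map_mul, map_mul] at this
    exact congrArg (fun J : Euc n ≃ₗᵢ[ℝ] Euc n => J x) this
  have hCκ (x) : ‖C x - x‖ ≤ 2 * m * κ * ‖x‖ := by
    obtain ⟨y, rfl⟩ : ∃ y, x = B (A y) := ⟨A.symm (B.symm x), by simp⟩
    rw [hCBA, LinearIsometryEquiv.norm_map, LinearIsometryEquiv.norm_map]
    have e : A (B y) - B (A y) = (A (B y - y) - (B y - y)) - (B (A y - y) - (A y - y)) := by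
      rw [map_sub, map_sub]
      abel
    rw [e]
    have e1 := (hm (B y - y)).trans (mul_le_mul_of_nonneg_left (hκ y) (hm'0.trans hm'm.le))
    have e2 := (hκ (A y - y)).trans (mul_le_mul_of_nonneg_left (hm y) hκ0)
    refine (norm_sub_le _ _).trans ((add_le_add e1 e2).trans (le_of_eq ?_))
    ring
  have hc0 : c (0 : Euc n) = (A b - b) + ((b - C b) + (a - C (B a))) := by
    have h1 : c (β (α (0 : Euc n))) = α (β 0) := congrArg (fun γ : Isom n => γ 0) hcαβ
    rw [isom_apply c, isom_apply β (α 0), isom_apply α (β 0), map_add] at h1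
    change C (B a) + C b + c 0 = A b + a at h1
    rw [← sub_eq_iff_eq_add'.2 h1.symm]
    abel
  set r := (b - C b) + (a - C (B a)) with hr
  -- Either `B = 1` and `κ = 0`, or `β` competes with `α` in the first minimality, so `‖a‖ ≤ ‖b‖`.
  have hκa : κ * ‖a‖ ≤ κ * ‖b‖ := by
    by_cases hB1 : B = 1
    · simp [hκ1 hB1]
    · refine mul_le_mul_of_nonneg_left (hmin ⟨β, hβ⟩ ⟨fun x => (hβε x).trans ?_, hB1⟩) hκ0
      refine mul_le_mul_of_nonneg_right ?_ (norm_nonneg x)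
      linarith
  have hrle : ‖r‖ ≤ 2 * κ * ‖b‖ := by
    have e1 : ‖b - C b‖ ≤ 2 * m * κ * ‖b‖ := by rw [norm_sub_rev]; exact hCκ b
    have e2 : ‖a - C (B a)‖ ≤ κ * ‖a‖ := by
      obtain ⟨y, hy⟩ := A.surjective a
      rw [← hy, hCBA, ← map_sub, LinearIsometryEquiv.norm_map, LinearIsometryEquiv.norm_map,
        norm_sub_rev]
      exact hκ y
    have e3 : 2 * m * (κ * ‖b‖) ≤ 1 * (κ * ‖b‖) :=
      mul_le_mul_of_nonneg_right (by linarith) (by positivity)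
    calc ‖r‖ ≤ ‖b - C b‖ + ‖a - C (B a)‖ := norm_add_le _ _
      _ ≤ 2 * m * κ * ‖b‖ + κ * ‖b‖ := add_le_add e1 (e2.trans hκa)
      _ ≤ 2 * κ * ‖b‖ := by linarith
  have hrle' : ‖r‖ ≤ (m - m') / 4 * ‖b‖ := by
    refine hrle.trans (mul_le_mul_of_nonneg_right ?_ (norm_nonneg b))
    linarith
  have hble : ‖b‖ < 2 * ‖π b‖ := by
    have := norm_add_le (π b) (π' b)
    rw [hππ'] at this
    linarith
  have hrlt : ‖r‖ < (m - m') / 2 * ‖π b‖ := by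
    have : (m - m') / 4 * ‖b‖ < (m - m') / 4 * (2 * ‖π b‖) :=
      mul_lt_mul_of_pos_left hble (by linarith)
    linarith
  have hπb : π b ∈ W := W.starProjection_apply_mem b
  have hπ'b : π' b ∈ Wᗮ := Wᗮ.starProjection_apply_mem b
  have hdec : A b - b = (A (π b) - π b) + (A (π' b) - π' b) := by
    conv_lhs => rw [← hππ' b, map_add]
    abel
  have hmemW : A (π b) - π b ∈ W := W.sub_mem (map_mem_maxRotationSpace hπb) hπb
  have hmemW' : A (π' b) - π' b ∈ Wᗮ := Wᗮ.sub_mem (map_mem_orthogonal hπ'b) hπ'b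
  have hπ'0 {x} (hx : x ∈ W) : π' x = 0 := by
    have h1 : π x = x := Submodule.starProjection_eq_self_iff.2 hx
    simpa [h1] using hππ' x
  have hπ0 {x} (hx : x ∈ Wᗮ) : π x = 0 := by
    have h1 : π' x = x := Submodule.starProjection_eq_self_iff.2 hx
    simpa [h1] using hππ' x
  have hπid {x} (hx : x ∈ W) : π x = x := Submodule.starProjection_eq_self_iff.2 hx
  have hπ'id {x} (hx : x ∈ Wᗮ) : π' x = x := Submodule.starProjection_eq_self_iff.2 hx
  have hπc : π (c 0) = (A (π b) - π b) + π r := by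
    rw [hc0, hdec, map_add, map_add, hπid hmemW, hπ0 hmemW', add_zero]
  have hπ'c : π' (c 0) = (A (π' b) - π' b) + π' r := by
    rw [hc0, hdec, map_add, map_add, hπ'0 hmemW, hπ'id hmemW', zero_add]
  have h1 : m * ‖π b‖ - ‖r‖ ≤ ‖π (c 0)‖ := by
    rw [hπc, ← norm_eq_of_mem_maxRotationSpace (hm'0.trans hm'm.le) hπb]
    have := norm_sub_le (A (π b) - π b + π r) (π r)
    rw [add_sub_cancel_right] at this
    linarith [hπn r]
  have h2 : ‖π' (c 0)‖ ≤ m' * ‖π' b‖ + ‖r‖ := by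
    rw [hπ'c]
    exact (norm_add_le _ _).trans (add_le_add (hm' _ hπ'b) (hπ'n r))
  have h3 : m' * ‖π' b‖ ≤ m' * ‖π b‖ := mul_le_mul_of_nonneg_left hβW.le hm'0
  -- The commutator meets the conditions imposed on `β`: `2 * m ≤ 1` bounds its linear part, and `2
  -- * ‖r‖ < (m - m') * ‖π b‖` keeps its translational part mainly along `W`. But its length is at
  -- most `m * ‖b‖ + ‖r‖ < ‖b‖`, a contradiction.
  have hcS := hβmin ⟨c, hcΓ⟩ ⟨fun x => (hCκ x).trans
    (mul_le_mul_of_nonneg_right (by nlinarith) (norm_nonneg x)), by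
      change ‖π' (c 0)‖ < ‖π (c 0)‖
      linarith⟩
  change ‖b‖ ≤ ‖c 0‖ at hcS
  have hbpos : 0 < ‖b‖ := by
    have := norm_nonneg (π' b)
    exact lt_of_lt_of_le (lt_of_le_of_lt this hβW) (hπn b)
  have h4 : ‖c 0‖ ≤ m * ‖b‖ + ‖r‖ := by
    rw [hc0]
    exact (norm_add_le _ _).trans (add_le_add (hm b) le_rfl)
  nlinarith

/-- Bieberbach: the group of linear parts is finite. -/
theorem IsCrystallographic.finite_linearPart (hΓ : IsCrystallographic Γ) : (linearPart '' (Γ : Set (Isom n))).Finite := by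
  by_contra hinf
  let g := Set.Infinite.natEmbedding _ hinf
  choose γ hγ hγg using fun k => (g k).2
  obtain ⟨φ, hφ, hA⟩ := exists_subseq_isometry fun k => linearPart (γ k)
  obtain ⟨N, hN⟩ := hA (1 / 2) (by norm_num)
  have h1 := hΓ.linearPart_eq_one (Γ.mul_mem (hγ (φ (N + 1))) (Γ.inv_mem (hγ (φ N)))) (by
    intro x
    obtain ⟨y, rfl⟩ := (linearPart (γ (φ N))).surjective x
    have e : linearPart (γ (φ (N + 1)) * (γ (φ N))⁻¹) (linearPart (γ (φ N)) y) =
        linearPart (γ (φ (N + 1))) y := by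
      change (linearPart (γ (φ (N + 1)) * (γ (φ N))⁻¹) * linearPart (γ (φ N))) y = _
      rw [← map_mul, inv_mul_cancel_right]
    rw [e, LinearIsometryEquiv.norm_map]
    exact hN _ (by omega) _ le_rfl y)
  rw [map_mul, map_inv, mul_inv_eq_one, hγg, hγg] at h1
  have := hφ.injective (g.injective (Subtype.ext h1))
  omega

theorem IsCrystallographic.exists_pow_linearPart (hΓ : IsCrystallographic Γ) :
    ∃ N : ℕ, 0 < N ∧ ∀ γ ∈ Γ, linearPart γ ^ N = 1 := by
  have hfin : Finite (Γ.map linearPart) := hΓ.finite_linearPart.to_subtype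
  refine ⟨Nat.card (Γ.map linearPart), Nat.card_pos, fun γ hγ => ?_⟩
  have := pow_card_eq_one' (x := (⟨linearPart γ, Subgroup.mem_map_of_mem _ hγ⟩ : Γ.map linearPart))
  exact congrArg Subtype.val this

theorem sub_mem_translationVectors {γ γ' : Isom n} (hγ : γ ∈ Γ) (hγ' : γ' ∈ Γ)
    (h : linearPart γ = linearPart γ') :
    γ (0 : Euc n) - γ' (0 : Euc n) ∈ translationVectors Γ := by
  have h0 : linearPart (γ * γ'⁻¹) = 1 := by rw [map_mul, map_inv, h, mul_inv_cancel]
  have h1 := isom_apply (γ * γ'⁻¹) (γ' 0)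
  rw [h0, isom_mul_apply, isom_inv_apply] at h1
  have h2 : γ (0 : Euc n) - γ' 0 = (γ * γ'⁻¹) 0 := sub_eq_iff_eq_add'.2 h1
  rw [h2]
  exact zero_mem_translationVectors_of_linearPart (Γ.mul_mem hγ (Γ.inv_mem hγ')) h0

/-- Two elements with the same linear part differ by a translation. For `v` orthogonal to all
translation vectors, the inner product of `v` with the orbit of 0 thus takes finitely many values,
although that orbit comes within bounded distance of every multiple of `v`. -/
theorem IsCrystallographic.span_translationVectors (hΓ : IsCrystallographic Γ) :
    Submodule.span ℝ (translationVectors Γ) = ⊤ := by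
  by_contra hne
  set W := Submodule.span ℝ (translationVectors Γ)
  obtain ⟨v, hv, hv0⟩ := Wᗮ.exists_mem_ne_zero_of_ne_bot
    fun h => hne (Submodule.orthogonal_eq_bot_iff.1 h)
  obtain ⟨d, hd⟩ := hΓ.exists_dense
  choose! g hg hgJ using fun J (hJ : J ∈ linearPart '' (Γ : Set (Isom n))) => hJ
  obtain ⟨C, hC⟩ := (hΓ.finite_linearPart.image fun J => ‖g J (0 : Euc n)‖).bddAbove
  have hvn : 0 < ‖v‖ := norm_pos_iff.2 hv0
  obtain ⟨R, hR⟩ := exists_gt ((C + d) / ‖v‖)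
  rw [div_lt_iff₀ hvn] at hR
  obtain ⟨γ, hγ, hγd⟩ := hd (R • v)
  have hJ : linearPart γ ∈ linearPart '' (Γ : Set (Isom n)) := ⟨γ, hγ, rfl⟩
  set γ' := g (linearPart γ)
  have hγ' : γ' ∈ Γ := hg _ hJ
  have hh := sub_mem_translationVectors hγ hγ' (hgJ _ hJ).symm
  have h1 : inner ℝ v (γ (0 : Euc n)) = inner ℝ v (γ' (0 : Euc n)) := by
    rw [← sub_eq_zero, ← inner_sub_right, real_inner_comm, hv _ (Submodule.subset_span hh)]
  have h2 : ‖γ' (0 : Euc n)‖ ≤ C := hC ⟨_, hJ, rfl⟩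
  have h3 := real_inner_le_norm v (γ' (0 : Euc n))
  have h4 := real_inner_le_norm v (R • v - γ (0 : Euc n))
  rw [inner_sub_right, h1, inner_smul_right, real_inner_self_eq_norm_sq, norm_sub_rev] at h4
  nlinarith [mul_le_mul_of_nonneg_left h2 hvn.le, mul_le_mul_of_nonneg_left hγd hvn.le]

end Bieberbach

end Crystal

namespace Crystal

open Set Topology Metric Module

variable {n : ℕ}

/-! ### The translation lattice, integral functionals and orbit enumerations -/

/-- The translation vectors form a subgroup. -/
def translationLattice (Γ : Subgroup (Isom n)) : Submodule ℤ (Euc n) :=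
  AddSubgroup.toIntSubmodule
    { carrier := translationVectors Γ
      zero_mem' := by
        have : AffineIsometryEquiv.constVAdd ℝ (Euc n) (0 : Euc n) = 1 := by
          ext1 x
          exact zero_add x
        change _ ∈ Γ
        rw [this]
        exact Γ.one_mem
      add_mem' := by
        intro a b ha hb
        have : AffineIsometryEquiv.constVAdd ℝ (Euc n) (a + b) =
            AffineIsometryEquiv.constVAdd ℝ (Euc n) a *
              AffineIsometryEquiv.constVAdd ℝ (Euc n) b := by
          ext1 x
          exact add_assoc a b x
        change _ ∈ Γ
        rw [this]
        exact Γ.mul_mem ha hb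
      neg_mem' := by
        intro a ha
        have : AffineIsometryEquiv.constVAdd ℝ (Euc n) (-a) =
            (AffineIsometryEquiv.constVAdd ℝ (Euc n) a)⁻¹ := by
          rw [eq_inv_iff_mul_eq_one]
          ext1 x
          exact neg_add_cancel_left a x
        change _ ∈ Γ
        rw [this]
        exact Γ.inv_mem ha }

variable {Γ : Subgroup (Isom n)}

theorem IsCrystallographic.finite_translationVectors (hΓ : IsCrystallographic Γ) (R : ℝ) :
    (translationVectors Γ ∩ closedBall 0 R).Finite := by
  refine Set.Finite.subset ((hΓ.finite_norm_le R).image fun γ : Γ => (γ : Isom n) (0 : Euc n)) ?_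
  rintro h ⟨hh, hR⟩
  have e : AffineIsometryEquiv.constVAdd ℝ (Euc n) h (0 : Euc n) = h := add_zero h
  exact ⟨⟨_, hh⟩, by simpa [e] using hR, e⟩

theorem IsCrystallographic.discreteTopology (hΓ : IsCrystallographic Γ) :
    DiscreteTopology (translationLattice Γ) := by
  refine discreteTopology_of_isOpen_singleton_zero ?_
  let s : Set (translationLattice Γ) := {x | (x : Euc n) ∈ ball 0 1}
  have hs : IsOpen s := isOpen_ball.preimage continuous_subtype_val
  have hfin : s.Finite := by
    refine Set.Finite.of_finite_image (f := Subtype.val) ((hΓ.finite_translationVectors 1).subset ?_)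
      Subtype.val_injective.injOn
    rintro _ ⟨x, hx, rfl⟩
    exact ⟨x.2, ball_subset_closedBall hx⟩
  have : ({0} : Set (translationLattice Γ)) = s \ (s \ {0}) := by
    rw [sdiff_sdiff_right_self]
    exact (inter_eq_right.2 (singleton_subset_iff.2 (by simp [s]))).symm
  rw [this]
  exact hs.sdiff (hfin.subset sdiff_subset).isClosed

/-- There is a finite set of functionals and a choice of the origin, such that the functionals are
integral on all translation vectors and on all displacements of the origin. -/
theorem IsCrystallographic.exists_functionals (hΓ : IsCrystallographic Γ) :
    ∃ (o : Euc n) (T : Set (Dual ℝ (Euc n))), T.Finite ∧ 0 ∈ T ∧ (∀ f ∈ T, -f ∈ T) ∧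
      (∀ γ ∈ Γ, ∀ f ∈ T, f ∘ₗ ((linearPart γ).toLinearEquiv : Euc n →ₗ[ℝ] Euc n) ∈ T) ∧
      Separating T ∧ (∀ h ∈ translationVectors Γ, ∀ f ∈ T, ∃ k : ℤ, f h = k) ∧
      ∀ γ ∈ Γ, ∀ f ∈ T, ∃ k : ℤ, f (γ o - o) = k := by
  have hdisc := hΓ.discreteTopology
  have hZ : IsZLattice ℝ (translationLattice Γ) := ⟨hΓ.span_translationVectors⟩
  have hfree : Module.Free ℤ (translationLattice Γ) := ZLattice.module_free ℝ _
  have hfg : Module.Finite ℤ (translationLattice Γ) := ZLattice.module_finite ℝ _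
  let b₀ := Module.Free.chooseBasis ℤ (translationLattice Γ)
  let b := b₀.ofZLatticeBasis ℝ (translationLattice Γ)
  have hb {h : Euc n} (hh : h ∈ translationVectors Γ) (i) : ∃ k : ℤ, b.coord i h = k :=
    ⟨_, b₀.ofZLatticeBasis_repr_apply ℝ (translationLattice Γ) ⟨h, hh⟩ i⟩
  let P := Γ.map linearPart
  have hPfin : Finite P := hΓ.finite_linearPart.to_subtype
  have := Fintype.ofFinite P
  choose g hg hgJ using fun J : P => J.2
  set N : ℝ := (Fintype.card P : ℝ) with hN
  have hN0 : N ≠ 0 := by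
    rw [hN, Nat.cast_ne_zero]
    exact Fintype.card_ne_zero
  -- The origin is the average of one orbit point of 0 per linear part. Each group element permutes
  -- the summands up to translation vectors, so its displacement of `o` lies in the lattice scaled
  -- by `1 / N`.
  set o : Euc n := N⁻¹ • ∑ J : P, g J 0 with ho
  have hmo (γ) (hγ : γ ∈ Γ) : N • (γ o - o) ∈ translationVectors Γ := by
    let J₀ : P := ⟨linearPart γ, Subgroup.mem_map_of_mem _ hγ⟩
    have e1 : N • o = ∑ J : P, g J 0 := by rw [ho, smul_inv_smul₀ hN0]
    have e2 : N • o = ∑ J : P, g (J₀ * J) 0 := by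
      rw [e1]
      exact (Equiv.sum_comp (Equiv.mulLeft J₀) fun J => g J 0).symm
    have e3 : N • (γ o - o) = ∑ J : P, ((γ * g J) 0 - g (J₀ * J) 0) := by
      rw [Finset.sum_sub_distrib, ← e2, smul_sub, isom_apply γ o, smul_add, ← map_smul, e1,
        map_sum, hN, Nat.cast_smul_eq_nsmul, ← Finset.card_univ, ← Finset.sum_const,
        ← Finset.sum_add_distrib]
      congr 1
      refine Finset.sum_congr rfl fun J _ => ?_
      rw [isom_mul_apply, isom_apply γ (g J 0)]
    rw [e3]
    refine (translationLattice Γ).sum_mem fun J _ => ?_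
    refine sub_mem_translationVectors (Γ.mul_mem hγ (hg J)) (hg _) ?_
    rw [map_mul, hgJ, hgJ]
    rfl
  -- Lattice coordinates are moved around by the finite group of linear parts for invariance; the
  -- factor `N` clears the denominators coming from `o`.
  let F : (Module.Free.ChooseBasisIndex ℤ (translationLattice Γ) × P) → Dual ℝ (Euc n) :=
    fun x => N • (b.coord x.1 ∘ₗ ((x.2 : Euc n ≃ₗᵢ[ℝ] Euc n).toLinearEquiv : Euc n →ₗ[ℝ] Euc n))
  have hF (i J x) : F (i, J) x = N * b.coord i (J.1 x) := rfl
  have hFL (p) {h : Euc n} (hh : h ∈ translationVectors Γ) : ∃ k : ℤ, F p h = k := by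
    obtain ⟨i, J⟩ := p
    have := linearPart_mem Γ ⟨g J, hg J⟩ hh
    rw [hgJ] at this
    obtain ⟨k, hk⟩ := hb this i
    exact ⟨Fintype.card P * k, by rw [hF, hk, hN]; push_cast; rfl⟩
  have hFo (p) {γ} (hγ : γ ∈ Γ) : ∃ k : ℤ, F p (γ o - o) = k := by
    obtain ⟨i, J⟩ := p
    have := linearPart_mem Γ ⟨g J, hg J⟩ (hmo γ hγ)
    rw [hgJ] at this
    obtain ⟨k, hk⟩ := hb this i
    rw [(J.1).map_smul N, (b.coord i).map_smul, smul_eq_mul] at hk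
    exact ⟨k, hk⟩
  have hneg {f : Dual ℝ (Euc n)} {x : Euc n} (h : ∃ k : ℤ, f x = k) : ∃ k : ℤ, (-f) x = k := by
    obtain ⟨k, hk⟩ := h
    exact ⟨-k, by simp [hk]⟩
  refine ⟨o, {0} ∪ (range F ∪ range fun p => -F p), ?_, Or.inl rfl, ?_, ?_, ?_, ?_, ?_⟩
  · exact (finite_singleton 0).union ((finite_range F).union (finite_range _))
  · rintro f (rfl | ⟨p, rfl⟩ | ⟨p, rfl⟩)
    · exact Or.inl neg_zero
    · exact Or.inr (Or.inr ⟨p, rfl⟩)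
    · exact Or.inr (Or.inl ⟨p, (neg_neg _).symm⟩)
  · intro γ hγ
    let J₀ : P := ⟨linearPart γ, Subgroup.mem_map_of_mem _ hγ⟩
    rintro f (rfl | ⟨⟨i, J⟩, rfl⟩ | ⟨⟨i, J⟩, rfl⟩)
    · exact Or.inl (LinearMap.zero_comp _)
    · exact Or.inr (Or.inl ⟨(i, J * J₀), rfl⟩)
    · exact Or.inr (Or.inr ⟨(i, J * J₀), rfl⟩)
  · intro w hw
    refine b.ext_elem fun i => ?_
    have := hw _ (Or.inr (Or.inl ⟨(i, 1), rfl⟩))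
    rw [hF] at this
    simpa using (mul_eq_zero.1 this).resolve_left hN0
  · rintro h hh f (rfl | ⟨p, rfl⟩ | ⟨p, rfl⟩)
    · exact ⟨0, by simp⟩
    · exact hFL p hh
    · exact hneg (hFL p hh)
  · rintro γ hγ f (rfl | ⟨p, rfl⟩ | ⟨p, rfl⟩)
    · exact ⟨0, by simp⟩
    · exact hFo p hγ
    · exact hneg (hFo p hγ)

/-- Crystallographic groups are countable. -/
theorem IsCrystallographic.countable (hΓ : IsCrystallographic Γ) : Countable Γ := by
  rw [← countable_univ_iff]
  have : (univ : Set Γ) = ⋃ R : ℕ, {γ : Γ | ‖(γ : Isom n) (0 : Euc n)‖ ≤ R} := by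
    refine (eq_univ_of_forall fun γ => ?_).symm
    obtain ⟨R, hR⟩ := exists_nat_ge ‖(γ : Isom n) (0 : Euc n)‖
    exact mem_iUnion.2 ⟨R, hR⟩
  rw [this]
  exact countable_iUnion fun R => (hΓ.finite_norm_le R).countable

theorem IsCrystallographic.countable_direction (hΓ : IsCrystallographic Γ) :
    Countable (Direction Γ) := by
  have := hΓ.countable
  choose γ hγ using fun D : Direction Γ => (show ∃ γ : Γ,
      D.1 = Submodule.span ℝ {(γ : Isom n) (0 : Euc n)} by
    obtain ⟨h, hh, -, hD⟩ := D.2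
    have e : AffineIsometryEquiv.constVAdd ℝ (Euc n) h (0 : Euc n) = h := add_zero h
    exact ⟨⟨_, hh⟩, by rw [hD]; simp [e]⟩)
  refine Function.Injective.countable (f := γ) fun D D' h => Subtype.ext ?_
  rw [hγ, hγ, h]

theorem exists_injective_no_gaps (Q : Type*) [Countable Q] :
    ∃ f : Q → ℕ, Function.Injective f ∧ ∀ q, ∀ k ≤ f q, ∃ q', f q' = k := by
  rcases finite_or_infinite Q with hQ | hQ
  · obtain ⟨N, ⟨e⟩⟩ := Finite.exists_equiv_fin Q
    exact ⟨fun q => e q, Fin.val_injective.comp e.injective, fun q k hk =>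
      ⟨e.symm ⟨k, hk.trans_lt (e q).2⟩, by simp⟩⟩
  · obtain ⟨e⟩ := nonempty_equiv_of_countable (α := Q) (β := ℕ)
    exact ⟨e, e.injective, fun q k _ => ⟨e.symm k, by simp⟩⟩

theorem IsCrystallographic.nonempty_orbitEnumeration (hΓ : IsCrystallographic Γ) :
    Nonempty (OrbitEnumeration Γ) := by
  have := hΓ.countable_direction
  obtain ⟨f, hf, hgaps⟩ := exists_injective_no_gaps (MulAction.orbitRel.Quotient Γ (Direction Γ))
  -- The numbering of orbits starts at 1, whereas the injection into the natural numbers starts at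
  -- 0.
  refine ⟨⟨fun D => f (Quotient.mk _ D) + 1, fun D => Nat.le_add_left _ _, fun D D' => ?_,
    fun D k hk hkD => ?_⟩⟩
  · rw [add_left_inj, hf.eq_iff, Quotient.eq]
    exact MulAction.orbitRel_apply
  · obtain ⟨q, hq⟩ := hgaps (Quotient.mk _ D) (k - 1) (by omega)
    obtain ⟨D', rfl⟩ := Quotient.exists_rep q
    exact ⟨D', by omega⟩

end Crystal

namespace Crystal

/-! ### Radial rescaling of heights to lattice vectors -/

open Set Topology Metric Filter

/-- Any sequence of positive reals has positive integral multiples which are the values at the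
positive integers of some order isomorphism fixing zero. -/
theorem exists_orderIso_natCast (ℓ : ℕ → ℝ) (hℓ : ∀ k, 0 < ℓ k) :
    ∃ (N : ℕ → ℕ) (e : ℝ ≃o ℝ), e 0 = 0 ∧ (∀ k, 1 ≤ k → 0 < N k) ∧
      ∀ k : ℕ, e k = N k * ℓ k := by
  -- Each multiple is chosen so that `N (k + 1) * ℓ (k + 1)` exceeds `N k * ℓ k` by at least 1. The
  -- values `a k` are then strictly increasing and unbounded.
  obtain ⟨N, hN0, hN⟩ : ∃ N : ℕ → ℕ, N 0 = 0 ∧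
      ∀ k, N (k + 1) = ⌈((N k : ℝ) * ℓ k + 1) / ℓ (k + 1)⌉₊ :=
    ⟨fun k => Nat.rec 0 (fun k (x : ℕ) => ⌈((x : ℝ) * ℓ k + 1) / ℓ (k + 1)⌉₊) k, rfl, fun _ => rfl⟩
  have hNsucc (k : ℕ) : (N k : ℝ) * ℓ k + 1 ≤ N (k + 1) * ℓ (k + 1) := by
    rw [hN k, ← div_le_iff₀ (hℓ (k + 1))]
    exact Nat.le_ceil _
  let a : ℕ → ℝ := fun k => N k * ℓ k
  have ha0 : a 0 = 0 := by simp [a, hN0]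
  have hd (k : ℕ) : 0 < a (k + 1) - a k := by
    have : a k + 1 ≤ a (k + 1) := hNsucc k
    linarith
  have hak (k : ℕ) : (k : ℝ) ≤ a k := by
    induction k with
    | zero => simp [ha0]
    | succ k ih =>
      have : a k + 1 ≤ a (k + 1) := hNsucc k
      push_cast
      linarith
  let c : ℝ → ℝ := fun t => max 0 (min 1 t)
  have hc0 {t : ℝ} (ht : t ≤ 0) : c t = 0 := max_eq_left ((min_le_right _ _).trans ht)
  have hc1 {t : ℝ} (ht : 1 ≤ t) : c t = 1 := by simp [c, ht]
  have hcmono : Monotone c := fun s t hst => max_le_max le_rfl (min_le_min le_rfl hst)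
  have hclt {s t : ℝ} (hs0 : 0 ≤ s) (hs1 : s < 1) (hst : s < t) : c s < c t := by
    have h1 : c s = s := by simp [c, hs0, hs1.le]
    rw [h1]
    exact (lt_min hs1 hst).trans_le (le_max_right _ _)
  -- Piecewise linear interpolation: the identity on negative numbers, then one ramp of height `a (k
  -- + 1) - a k` on each unit interval. Later ramps vanish at `t`, so the number of summands may be
  -- increased freely.
  let R : ℕ → ℝ → ℝ := fun m t => min t 0 + ∑ k ∈ Finset.range m, (a (k + 1) - a k) * c (t - k)
  have hRc (m) : Continuous (R m) := by
    simp only [R, c]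
    fun_prop
  let r : ℝ → ℝ := fun t => R ⌈t⌉₊ t
  have hrR {m : ℕ} {t : ℝ} (ht : t ≤ m) : r t = R m t := by
    have hle : ⌈t⌉₊ ≤ m := Nat.ceil_le.2 ht
    simp only [r, R]
    rw [← Finset.sum_subset (Finset.range_mono hle)]
    intro k _ hk
    rw [Finset.mem_range, not_lt, Nat.ceil_le] at hk
    rw [hc0 (by linarith), mul_zero]
  have hrneg {t : ℝ} (ht : t ≤ 0) : r t = t := by
    rw [hrR (m := 0) (by simpa using ht)]
    simp [R, ht]
  have hrnat (k : ℕ) : r k = a k := by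
    rw [hrR le_rfl]
    simp only [R]
    rw [min_eq_right (Nat.cast_nonneg k), zero_add, ← sub_zero (a k), ← ha0,
      ← Finset.sum_range_sub]
    refine Finset.sum_congr rfl fun i hi => ?_
    rw [Finset.mem_range] at hi
    have : (i : ℝ) + 1 ≤ k := by exact_mod_cast hi
    rw [hc1 (by linarith), mul_one]
  have hrc : Continuous r := by
    refine continuous_iff_continuousAt.2 fun t => ?_
    obtain ⟨m, hm⟩ := exists_nat_gt t
    refine (hRc m).continuousAt.congr ?_
    filter_upwards [Iio_mem_nhds hm] with s hs
    exact (hrR (le_of_lt hs)).symm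
  have hrmono : StrictMono r := by
    intro s t hst
    obtain ⟨m, hm⟩ := exists_nat_ge t
    rw [hrR hm, hrR (hst.le.trans hm)]
    have hle : ∀ k ∈ Finset.range m,
        (a (k + 1) - a k) * c (s - k) ≤ (a (k + 1) - a k) * c (t - k) := fun k _ =>
      mul_le_mul_of_nonneg_left (hcmono (by linarith)) (hd k).le
    rcases lt_or_ge s 0 with hs | hs
    · refine add_lt_add_of_lt_of_le ?_ (Finset.sum_le_sum hle)
      rw [min_eq_left hs.le]
      exact lt_min hst hs
    · refine add_lt_add_of_le_of_lt (min_le_min_right 0 hst.le) (Finset.sum_lt_sum hle ?_)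
      refine ⟨⌊s⌋₊, ?_, mul_lt_mul_of_pos_left (hclt ?_ ?_ ?_) (hd _)⟩
      · rw [Finset.mem_range, Nat.floor_lt hs]
        exact hst.trans_le hm
      · linarith [Nat.floor_le hs]
      · linarith [Nat.lt_floor_add_one s]
      · linarith
  have hrsurj : Function.Surjective r := by
    refine hrc.surjective ?_ ?_
    · refine tendsto_atTop_atTop_of_monotone hrmono.monotone fun b => ?_
      obtain ⟨m, hm⟩ := exists_nat_ge b
      exact ⟨m, by rw [hrnat]; exact hm.trans (hak m)⟩
    · refine tendsto_atBot_atBot_of_monotone hrmono.monotone fun b => ⟨min b 0, ?_⟩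
      rw [hrneg (min_le_right _ _)]
      exact min_le_left _ _
  refine ⟨N, hrmono.orderIsoOfSurjective r hrsurj, hrneg le_rfl, fun k hk => ?_, hrnat⟩
  obtain ⟨k, rfl⟩ := Nat.exists_eq_add_of_le' hk
  have h1 := hak (k + 1)
  refine Nat.pos_of_ne_zero fun h0 => ?_
  simp only [a, h0] at h1
  push_cast at h1
  have : (0 : ℝ) ≤ k := Nat.cast_nonneg k
  linarith

section Radial

variable {E : Type*} [NormedAddCommGroup E] [NormedSpace ℝ E]

/-- The radial rescaling of a normed space by a function of the norm. -/
noncomputable def radial (e : ℝ ≃o ℝ) (x : E) : E := (e ‖x‖ / ‖x‖) • x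

theorem radial_nonneg {E : Type*} [NormedAddCommGroup E] {e : ℝ ≃o ℝ} (he : e 0 = 0) (x : E) : 0 ≤ e ‖x‖ := by
  rw [← he]
  exact e.monotone (norm_nonneg x)

theorem norm_radial {e : ℝ ≃o ℝ} (he : e 0 = 0) (x : E) : ‖radial e x‖ = e ‖x‖ := by
  rcases eq_or_ne x 0 with rfl | hx
  · simp [radial, he]
  · rw [radial, norm_smul, norm_div, norm_norm, Real.norm_of_nonneg (radial_nonneg he x),
      div_mul_cancel₀ _ (norm_ne_zero_iff.2 hx)]

theorem radial_symm_radial {e : ℝ ≃o ℝ} (he : e 0 = 0) (x : E) :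
    radial e.symm (radial e x) = x := by
  rcases eq_or_ne x 0 with rfl | hx
  · simp [radial]
  · have hx' : ‖x‖ ≠ 0 := norm_ne_zero_iff.2 hx
    have hex : e ‖x‖ ≠ 0 := fun h => hx' (e.injective (h.trans he.symm))
    rw [radial, norm_radial he, e.symm_apply_apply, radial, smul_smul,
      div_mul_div_cancel₀ hex, div_self hx', one_smul]

theorem continuous_radial {e : ℝ ≃o ℝ} (he : e 0 = 0) : Continuous (radial e : E → E) := by
  refine continuous_iff_continuousAt.2 fun x => ?_
  rcases eq_or_ne x 0 with rfl | hx
  · have h0 : radial e (0 : E) = 0 := by simp [radial]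
    rw [ContinuousAt, h0, tendsto_zero_iff_norm_tendsto_zero]
    have : Tendsto (fun x : E => e ‖x‖) (𝓝 0) (𝓝 (e ‖(0 : E)‖)) :=
      (e.continuous.comp continuous_norm).tendsto 0
    rw [norm_zero, he] at this
    simpa only [norm_radial he] using this
  · exact ((e.continuous.comp continuous_norm).continuousAt.div continuous_norm.continuousAt
      (norm_ne_zero_iff.2 hx)).smul continuousAt_id

/-- Radial rescaling as a homeomorphism. -/
noncomputable def radialHomeomorph (e : ℝ ≃o ℝ) (he : e 0 = 0) : E ≃ₜ E where
  toFun := radial e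
  invFun := radial e.symm
  left_inv := radial_symm_radial he
  right_inv := radial_symm_radial (e := e.symm) (by rw [e.symm_apply_eq, he])
  continuous_toFun := continuous_radial he
  continuous_invFun := continuous_radial (by rw [e.symm_apply_eq, he])

theorem radial_neg (e : ℝ ≃o ℝ) (x : E) : radial e (-x) = -radial e x := by
  simp [radial]

theorem radial_map (e : ℝ ≃o ℝ) (J : E ≃ₗᵢ[ℝ] E) (x : E) : radial e (J x) = J (radial e x) := by
  simp [radial]

end Radial

end Crystal

namespace Crystal

open Set Topology Metric Module

variable {n : ℕ} {Γ : Subgroup (Isom n)}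

/-! ### The model space as a collapse model -/

theorem Cone.mk_neg (x : Euc n) : Cone.mk (-x) = Cone.mk x := Cone.mk_eq_iff.2 (Or.inr rfl)

/-- Openness is what makes the product with the identity of Euclidean space a quotient map again. -/
theorem Cone.isOpenQuotientMap_mk : IsOpenQuotientMap (Cone.mk : Euc n → Cone n) := by
  have hq : IsQuotientMap (Cone.mk : Euc n → Cone n) := isQuotientMap_quotient_mk'
  refine ⟨hq.surjective, hq.continuous, fun U hU => ?_⟩
  rw [← hq.isOpen_preimage]
  have : Cone.mk ⁻¹' (Cone.mk '' U) = U ∪ (fun x => -x) ⁻¹' U := by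
    ext x
    constructor
    · rintro ⟨y, hy, hyx⟩
      rcases Cone.mk_eq_iff.1 hyx with rfl | rfl
      · exact Or.inl hy
      · exact Or.inr hy
    · rintro (h | h)
      · exact ⟨x, h, rfl⟩
      · exact ⟨-x, h, Cone.mk_neg x⟩
  rw [this]
  exact hU.union (hU.preimage continuous_neg)

theorem ModelSpace.isQuotientMap_mk (e : OrbitEnumeration Γ) :
    IsQuotientMap (ModelSpace.mk e) := isQuotientMap_quotient_mk'

theorem ModelSpace.mk_eq_iff (e : OrbitEnumeration Γ) {c c' : Cone n} {x x' : Euc n} :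
    ModelSpace.mk e (c, x) = ModelSpace.mk e (c', x') ↔ c = c' ∧ (x = x' ∨
      ∃ D : Direction Γ, c = e.height D ∧ x - x' ∈ D.1) := by
  have : ModelSpace.mk e (c, x) = ModelSpace.mk e (c', x') ↔ ((c, x) = (c', x') ∨
    ∃ l : Line Γ, (c, x) ∈ e.liftedLine l ∧ (c', x') ∈ e.liftedLine l) :=
    Quotient.eq (r := e.setoid)
  rw [this]
  constructor
  · rintro (h | ⟨l, ⟨h1, h2⟩, h3, h4⟩)
    · rw [Prod.mk.injEq] at h
      exact ⟨h.1, Or.inl h.2⟩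
    · exact ⟨h1.trans h3.symm, Or.inr ⟨l.dir, h1, AffineSubspace.vsub_mem_direction h2 h4⟩⟩
  · rintro ⟨rfl, rfl | ⟨D, rfl, hD⟩⟩
    · exact Or.inl rfl
    · let l : Line Γ := ⟨AffineSubspace.mk' x' D.1, ⟨x', AffineSubspace.self_mem_mk' _ _⟩, by
        rw [AffineSubspace.direction_mk']
        exact D.2⟩
      have hl : l.dir = D := Subtype.ext (AffineSubspace.direction_mk' _ _)
      exact Or.inr ⟨l, ⟨congrArg e.height hl.symm, AffineSubspace.mem_mk'.2 hD⟩,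
        congrArg e.height hl.symm, AffineSubspace.self_mem_mk' _ _⟩

/-- Translation vectors of constant length on each orbit of directions. -/
theorem OrbitEnumeration.exists_vectors (e : OrbitEnumeration Γ) :
    ∃ ℓ : ℕ → ℝ, (∀ k, 0 < ℓ k) ∧ ∀ D : Direction Γ, ∃ v ∈ translationVectors Γ,
      v ≠ 0 ∧ D.1 = Submodule.span ℝ {v} ∧ ‖v‖ = ℓ (e.index D) := by
  have key (k : ℕ) : ∃ ℓ : ℝ, 0 < ℓ ∧ ∀ D : Direction Γ, e.index D = k →
      ∃ v ∈ translationVectors Γ, v ≠ 0 ∧ D.1 = Submodule.span ℝ {v} ∧ ‖v‖ = ℓ := by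
    by_cases h : ∃ D, e.index D = k
    · obtain ⟨D₀, rfl⟩ := h
      obtain ⟨v, hv, hv0, hD⟩ := D₀.2
      refine ⟨‖v‖, norm_pos_iff.2 hv0, fun D hDk => ?_⟩
      obtain ⟨γ, rfl⟩ := (e.index_eq_iff _ _).1 hDk
      refine ⟨_, linearPart_mem Γ γ hv, by simpa using hv0, ?_, LinearIsometryEquiv.norm_map _ _⟩
      change (γ • D₀).1 = _
      rw [smul_direction_val, hD, map_span_singleton]
    · exact ⟨1, one_pos, fun D hD => absurd ⟨D, hD⟩ h⟩
  choose ℓ hℓ h using key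
  exact ⟨ℓ, hℓ, fun D => h _ D rfl⟩

/-- A homeomorphism of Euclidean space which moves heights to translation vectors. -/
theorem OrbitEnumeration.exists_homeomorph (e : OrbitEnumeration Γ) :
    ∃ θ : Euc n ≃ₜ Euc n, (∀ x, θ (-x) = -θ x) ∧ (∀ (J : Euc n ≃ₗᵢ[ℝ] Euc n) x, θ (J x) = J (θ x)) ∧
      (∀ D : Direction Γ, ∃ u, Cone.mk (θ u) = e.height D) ∧
      ∀ (D : Direction Γ) u, Cone.mk (θ u) = e.height D →
        u ∈ translationVectors Γ ∧ u ≠ 0 ∧ D.1 = Submodule.span ℝ {u} := by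
  obtain ⟨ℓ, hℓ, hv⟩ := e.exists_vectors
  obtain ⟨N, r, hr0, hN, hr⟩ := exists_orderIso_natCast ℓ hℓ
  have hr0' : r.symm 0 = 0 := by rw [r.symm_apply_eq, hr0]
  -- The inverse rescaling shrinks the lattice vector `N k • v`, of length `N k * ℓ k`, to length
  -- `k`; this is precisely the height of its direction.
  let θ : Euc n ≃ₜ Euc n := radialHomeomorph r.symm hr0'
  have hneg (x) : θ (-x) = -θ x := radial_neg _ _
  have key (D : Direction Γ) : ∃ u ∈ translationVectors Γ, u ≠ 0 ∧ D.1 = Submodule.span ℝ {u} ∧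
      e.height D = Cone.mk (θ u) := by
    obtain ⟨v, hvΓ, hv0, hvD, hvn⟩ := hv D
    set k := e.index D with hk
    have hk1 : 1 ≤ k := e.one_le_index D
    have hNk : (N k : ℝ) ≠ 0 := Nat.cast_ne_zero.2 (hN k hk1).ne'
    have hvn0 : ‖v‖ ≠ 0 := norm_ne_zero_iff.2 hv0
    refine ⟨(N k : ℝ) • v, ?_, smul_ne_zero hNk hv0, ?_, ?_⟩
    · rw [Nat.cast_smul_eq_nsmul]
      exact (translationLattice Γ).nsmul_mem hvΓ _
    · rw [hvD, Submodule.span_singleton_smul_eq (IsUnit.mk0 _ hNk)]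
    · rw [e.height_eq D hv0 hvD, ← hk]
      congr 1
      change _ = radial r.symm ((N k : ℝ) • v)
      rw [radial, norm_smul, Real.norm_natCast, hvn, ← hr k, r.symm_apply_apply, hr k, ← hvn,
        smul_smul]
      congr 1
      field_simp
  refine ⟨θ, hneg, fun J x => radial_map _ _ _, fun D => ?_, fun D u hu => ?_⟩
  · obtain ⟨u, -, -, -, hu⟩ := key D
    exact ⟨u, hu.symm⟩
  · obtain ⟨w, hw1, hw2, hw3, hw4⟩ := key D
    rw [hw4, Cone.mk_eq_iff, ← hneg, θ.injective.eq_iff, θ.injective.eq_iff] at hu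
    rcases hu with rfl | rfl
    · exact ⟨hw1, hw2, hw3⟩
    · refine ⟨(translationLattice Γ).neg_mem hw1, neg_ne_zero.2 hw2, ?_⟩
      rw [hw3, ← Set.neg_singleton, Submodule.span_neg]

/-- The space `A` as a quotient of the product of two Euclidean spaces. -/
theorem OrbitEnumeration.exists_collapseModel (e : OrbitEnumeration Γ)
    (hΓ : IsCrystallographic Γ) : ∃ (M : CollapseModel Γ (Euc n) (ModelSpace e)) (o : Euc n),
      (∀ γ, M.J γ = linearPart (γ : Isom n)) ∧ (∀ γ : Γ, M.m γ = (γ : Isom n) o - o) ∧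
      (∀ z ∈ M.Z, z ∈ translationVectors Γ) ∧
      (∀ h ∈ translationVectors Γ, h ≠ 0 →
        ∃ z ∈ M.Z, Submodule.span ℝ {h} = Submodule.span ℝ {z}) ∧
      ∀ z ∈ M.Z, ∀ z' ∈ M.Z, Submodule.span ℝ {z} = Submodule.span ℝ {z'} →
        z' = z ∨ z' = -z := by
  obtain ⟨o, T, hTfin, hT0, hTneg, hTcomp, hTsep, hTL, hTo⟩ := hΓ.exists_functionals
  obtain ⟨N, hN, hNpow⟩ := hΓ.exists_pow_linearPart
  obtain ⟨θ, hθneg, hθJ, hθD, hθu⟩ := e.exists_homeomorph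
  have hθeq (u u' : Euc n) : Cone.mk (θ u) = Cone.mk (θ u') ↔ u = u' ∨ u = -u' := by
    rw [Cone.mk_eq_iff, ← hθneg, θ.injective.eq_iff, θ.injective.eq_iff]
  refine ⟨
    { J := linearPart.comp Γ.subtype
      m := fun γ => (γ : Isom n) o - o
      -- The second coordinate is measured from `o`, so that the translational part becomes the
      -- displacement of `o`, on which `T` is integral.
      q := fun p => ModelSpace.mk e (Cone.mk (θ p.1), p.2 + o)
      Z := {u | ∃ D, Cone.mk (θ u) = e.height D}
      T := T
      finite_T := hTfin
      zero_mem_T := hT0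
      neg_mem_T := hTneg
      comp_mem_T := fun γ f hf => hTcomp γ γ.2 f hf
      separating_T := hTsep
      int_Z := fun z ⟨D, hD⟩ f hf => hTL z (hθu D z hD).1 f hf
      int_m := fun γ f hf => hTo γ γ.2 f hf
      zero_notMem_Z := fun ⟨D, hD⟩ => (hθu D 0 hD).2.1 rfl
      neg_mem_Z := fun z ⟨D, hD⟩ => ⟨D, by rw [hθneg, Cone.mk_neg, hD]⟩
      map_mem_Z := fun γ z ⟨D, hD⟩ => ⟨γ • D, by
        rw [← e.smul_height, ← hD]
        exact congrArg Cone.mk (hθJ _ z)⟩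
      isQuotientMap_q := ?_
      q_eq_iff := ?_
      smul_q := ?_
      exists_pow_J := fun γ => ⟨N, hN, hNpow γ γ.2⟩ }, o, fun _ => rfl, fun _ => rfl, ?_, ?_, ?_⟩
  · have h1 : IsQuotientMap (Prod.map (Cone.mk : Euc n → Cone n) (id : Euc n → Euc n)) :=
      (Cone.isOpenQuotientMap_mk.prodMap IsOpenQuotientMap.id).isQuotientMap
    exact ((ModelSpace.isQuotientMap_mk e).comp h1).comp
      (θ.prodCongr (Homeomorph.addRight o)).isQuotientMap
  · intro u y u' y'
    rw [ModelSpace.mk_eq_iff, hθeq, add_left_inj, add_sub_add_right_eq_sub]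
    refine and_congr_right fun _ => or_congr_right ?_
    constructor
    · rintro ⟨D, hD, h⟩
      rw [(hθu D u hD).2.2] at h
      exact ⟨⟨D, hD⟩, h⟩
    · rintro ⟨⟨D, hD⟩, h⟩
      refine ⟨D, hD, ?_⟩
      rwa [(hθu D u hD).2.2]
  · intro γ u y
    rw [ModelSpace.smul_mk]
    refine congrArg (ModelSpace.mk e) (Prod.ext ?_ ?_)
    · exact congrArg Cone.mk (hθJ _ u).symm
    · change (γ : Isom n) (y + o) = linearPart (γ : Isom n) y + ((γ : Isom n) o - o) + o
      rw [isom_add, add_assoc, sub_add_cancel]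
  · rintro z ⟨D, hD⟩
    exact (hθu D z hD).1
  · intro h hh h0
    obtain ⟨z, hz⟩ := hθD ⟨_, h, hh, h0, rfl⟩
    exact ⟨z, ⟨_, hz⟩, (hθu _ z hz).2.2⟩
  · rintro z ⟨D, hD⟩ z' ⟨D', hD'⟩ h
    have : D = D' := Subtype.ext (by rw [(hθu D z hD).2.2, (hθu D' z' hD').2.2, h])
    rw [← hθeq, hD, hD', this]

end Crystal

namespace Crystal

open Set Topology Metric Module

variable {n : ℕ} {Γ : Subgroup (Isom n)}

/-! ### Virtually cyclic groups of isometries, and the universal property -/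

/-- If every element is a product of an element of a finite set and a power of `g`, then the
cyclic subgroup generated by `g` has finite index. -/
theorem finiteIndex_zpowers_of_finite {S : Type*} [Group S] {g : S} {F : Set S} (hF : F.Finite)
    (h : ∀ s, ∃ f ∈ F, ∃ k : ℤ, s = f * g ^ k) : (Subgroup.zpowers g).FiniteIndex := by
  have := hF.to_subtype
  have hsurj : Function.Surjective (fun f : F => (QuotientGroup.mk f.1 : S ⧸ Subgroup.zpowers g)) := by
    intro c
    obtain ⟨s, rfl⟩ := QuotientGroup.mk_surjective c
    obtain ⟨f, hf, k, rfl⟩ := h s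
    exact ⟨⟨f, hf⟩, QuotientGroup.eq.2 (by simp)⟩
  have := Finite.of_surjective _ hsurj
  exact Subgroup.finiteIndex_of_finite_quotient

theorem constVAdd_pow (h : Euc n) (k : ℕ) :
    AffineIsometryEquiv.constVAdd ℝ (Euc n) h ^ k =
      AffineIsometryEquiv.constVAdd ℝ (Euc n) ((k : ℝ) • h) := by
  induction k with
  | zero =>
    ext1 x
    simp
  | succ k ih =>
    rw [pow_succ', ih]
    ext1 x
    change h + ((k : ℝ) • h + x) = ((k + 1 : ℕ) : ℝ) • h + x
    push_cast
    module

theorem constVAdd_zpow (h : Euc n) (k : ℤ) :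
    AffineIsometryEquiv.constVAdd ℝ (Euc n) h ^ k =
      AffineIsometryEquiv.constVAdd ℝ (Euc n) ((k : ℝ) • h) := by
  obtain ⟨k, rfl | rfl⟩ := k.eq_nat_or_neg
  · rw [zpow_natCast, constVAdd_pow]
    simp
  · rw [zpow_neg, zpow_natCast, constVAdd_pow, inv_eq_iff_mul_eq_one]
    ext1 x
    change (k : ℝ) • h + (((-(k : ℤ) : ℤ) : ℝ) • h + x) = x
    push_cast
    module

theorem constVAdd_injective :
    Function.Injective (AffineIsometryEquiv.constVAdd ℝ (Euc n) : Euc n → Isom n) := by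
  intro a b h
  have h1 : a + 0 = b + 0 := congrArg (fun γ : Isom n => γ 0) h
  simpa using h1

theorem linearPart_constVAdd (h : Euc n) :
    linearPart (AffineIsometryEquiv.constVAdd ℝ (Euc n) h) = 1 := rfl

theorem conj_constVAdd (γ : Isom n) (h : Euc n) :
    γ * AffineIsometryEquiv.constVAdd ℝ (Euc n) h * γ⁻¹ =
      AffineIsometryEquiv.constVAdd ℝ (Euc n) (linearPart γ h) := by
  rw [mul_inv_eq_iff_eq_mul]
  ext1 x
  exact isom_add γ h x

/-- A group of isometries preserving a line, and containing a translation along this line, is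
virtually cyclic. -/
theorem IsCrystallographic.isVirtuallyCyclic_of_line (hΓ : IsCrystallographic Γ) {S : Subgroup Γ}
    {z x₀ : Euc n} (hz0 : z ≠ 0)
    (hz : ∃ t ∈ S, (t : Isom n) = AffineIsometryEquiv.constVAdd ℝ (Euc n) z)
    (hS : ∀ γ ∈ S, (γ : Isom n) x₀ - x₀ ∈ Submodule.span ℝ {z}) : IsVirtuallyCyclic S := by
  obtain ⟨t, htS, ht⟩ := hz
  refine Or.inr ⟨⟨t, htS⟩, fun hfin => ?_, ?_⟩
  · obtain ⟨k, hk, hpow⟩ := isOfFinOrder_iff_pow_eq_one.1 hfin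
    have h1 : (t : Isom n) ^ k = 1 := congrArg (fun s : S => ((s : Γ) : Isom n)) hpow
    rw [ht, constVAdd_pow] at h1
    have h2 : (k : ℝ) • z + 0 = 0 := congrArg (fun γ : Isom n => γ 0) h1
    rw [add_zero] at h2
    exact (smul_ne_zero (Nat.cast_ne_zero.2 hk.ne') hz0) h2
  · have hfin := hΓ.finite_inter (isCompact_closedBall x₀ ‖z‖)
    have hF : {s : S | ∃ x ∈ closedBall x₀ ‖z‖, ((s : Γ) : Isom n) x ∈ closedBall x₀ ‖z‖}.Finite :=
      Set.Finite.preimage (f := fun s : S => (s : Γ)) Subtype.val_injective.injOn hfin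
    refine finiteIndex_zpowers_of_finite hF fun s => ?_
    obtain ⟨c, hc⟩ := Submodule.mem_span_singleton.1 (hS _ (S.inv_mem s.2))
    -- Writing the preimage of `x₀` under `s` as `x₀ + c • z`, the integral part of `c` is absorbed
    -- by a power of the translation. The corrected element takes `x₀ + Int.fract c • z` to `x₀`,
    -- both within `‖z‖` of `x₀`, so it belongs to a finite set.
    refine ⟨s * ⟨t, htS⟩ ^ ⌊c⌋, ?_, -⌊c⌋, by simp⟩
    refine ⟨x₀ + Int.fract c • z, ?_, ?_⟩
    · rw [mem_closedBall, dist_eq_norm, add_sub_cancel_left, norm_smul,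
        Real.norm_of_nonneg (Int.fract_nonneg c)]
      exact mul_le_of_le_one_left (norm_nonneg z) (Int.fract_lt_one c).le
    · have e1 : (((s * ⟨t, htS⟩ ^ ⌊c⌋ : S) : Γ) : Isom n) =
          (s : Γ) * AffineIsometryEquiv.constVAdd ℝ (Euc n) z ^ ⌊c⌋ := by
        rw [← ht]
        rfl
      have e2 : AffineIsometryEquiv.constVAdd ℝ (Euc n) ((⌊c⌋ : ℝ) • z) (x₀ + Int.fract c • z) =
          (((s : Γ) : Isom n)⁻¹ : Isom n) x₀ := by
        change (⌊c⌋ : ℝ) • z + (x₀ + Int.fract c • z) = _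
        refine Eq.trans ?_ (eq_sub_iff_add_eq.1 hc)
        rw [Int.fract, sub_smul]
        abel
      rw [e1, constVAdd_zpow, isom_mul_apply, e2, isom_apply_inv]
      simp

/-- A group acting affinely has a fixed point modulo the kernel of a linear map, if a subgroup of
finite index acts trivially modulo this kernel. -/
theorem exists_fixed_mod {V : Subgroup Γ} (π : Euc n →ₗ[ℝ] Euc n)
    (hπ : ∀ γ ∈ V, ∀ x y, π x = π y → π ((γ : Isom n) x) = π ((γ : Isom n) y))
    (H : Subgroup V) [H.FiniteIndex] (hH : ∀ h ∈ H, π (((h : Γ) : Isom n) 0) = 0) :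
    ∃ x₀, ∀ γ ∈ V, π ((γ : Isom n) x₀) = π x₀ := by
  have := Fintype.ofFinite (V ⧸ H)
  -- Modulo the kernel of `π`, the image of 0 depends only on the coset modulo `H`, and `V` permutes
  -- these images. Their average is the fixed point.
  let φ : V ⧸ H → Euc n := fun c => ((c.out : Γ) : Isom n) 0
  have hφ (γ : V) : π (φ (QuotientGroup.mk γ)) = π (((γ : Γ) : Isom n) 0) := by
    obtain ⟨h, hh⟩ := QuotientGroup.mk_out_eq_mul H γ
    have e : φ (QuotientGroup.mk γ) = ((γ : Γ) : Isom n) ((((h : V) : Γ) : Isom n) 0) := by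
      simp only [φ, hh]
      rfl
    rw [e]
    refine hπ γ γ.2 _ _ ?_
    rw [hH _ h.2, map_zero]
  set N : ℝ := (Fintype.card (V ⧸ H) : ℝ) with hN
  have hN0 : N ≠ 0 := by
    rw [hN, Nat.cast_ne_zero]
    exact Fintype.card_ne_zero
  refine ⟨N⁻¹ • ∑ c, φ c, fun γ hγ => ?_⟩
  have e1 : (γ : Isom n) (N⁻¹ • ∑ c, φ c) = N⁻¹ • ∑ c, (γ : Isom n) (φ c) := by
    rw [isom_apply, eq_inv_smul_iff₀ hN0, smul_add, ← map_smul, smul_inv_smul₀ hN0, map_sum, hN,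
      Nat.cast_smul_eq_nsmul, ← Finset.card_univ, ← Finset.sum_const, ← Finset.sum_add_distrib]
    exact Finset.sum_congr rfl fun c _ => (isom_apply _ _).symm
  have e2 : ∑ c, π ((γ : Isom n) (φ c)) = ∑ c, π (φ ((⟨γ, hγ⟩ : V) • c)) := by
    refine Finset.sum_congr rfl fun c _ => ?_
    have : (⟨γ, hγ⟩ : V) • c = QuotientGroup.mk (⟨γ, hγ⟩ * c.out) := by
      conv_lhs => rw [← QuotientGroup.out_eq' c]
      rfl
    rw [this, hφ]
    rfl
  rw [e1, map_smul, map_smul, map_sum, map_sum, e2]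
  congr 1
  exact Equiv.sum_comp (MulAction.toPerm (⟨γ, hγ⟩ : V)) fun c => π (φ c)

/-- An infinite virtually cyclic group of isometries contains a translation by some `h ≠ 0`, and
all of its elements preserve the direction of `h`. -/
theorem IsCrystallographic.exists_translation (hΓ : IsCrystallographic Γ) {V : Subgroup Γ} {g : V}
    (hg : ¬ IsOfFinOrder g) (hfin : (Subgroup.zpowers g).FiniteIndex) :
    ∃ h : Euc n, h ≠ 0 ∧ ∃ t : V, ((t : Γ) : Isom n) = AffineIsometryEquiv.constVAdd ℝ (Euc n) h ∧
      (Subgroup.zpowers t).FiniteIndex ∧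
      ∀ γ ∈ V, linearPart (γ : Isom n) h ∈ Submodule.span ℝ {h} := by
  obtain ⟨N, hN, hpow⟩ := hΓ.exists_pow_linearPart
  -- With `N` a common exponent of the linear parts, `g ^ N` is a translation, nontrivial because
  -- `g` has infinite order.
  set t : V := g ^ N with ht
  have hlin : linearPart ((t : Γ) : Isom n) = 1 := by
    rw [ht]
    exact (map_pow linearPart _ N).trans (hpow _ (g : Γ).2)
  set h : Euc n := ((t : Γ) : Isom n) 0 with hh
  have hth : ((t : Γ) : Isom n) = AffineIsometryEquiv.constVAdd ℝ (Euc n) h :=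
    eq_constVAdd_of_linearPart_eq_one hlin
  have hh0 : h ≠ 0 := by
    intro h0
    refine hg (isOfFinOrder_iff_pow_eq_one.2 ⟨N, hN, Subtype.ext (Subtype.ext ?_)⟩)
    change ((t : Γ) : Isom n) = 1
    rw [hth, h0]
    ext1 x
    exact zero_add x
  have htfin : (Subgroup.zpowers t).FiniteIndex := by
    have := hfin
    have : (Subgroup.zpowers g).index ≠ 0 := hfin.index_ne_zero
    refine finiteIndex_zpowers_of_finite
      (F := ⋃ i ∈ Finset.range N, range fun c : V ⧸ Subgroup.zpowers g => c.out * g ^ i)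
      ((Finset.range N).finite_toSet.biUnion fun i _ => finite_range _) fun s => ?_
    obtain ⟨⟨_, k, rfl⟩, hk⟩ := QuotientGroup.mk_out_eq_mul (Subgroup.zpowers g) s
    dsimp only at hk
    have hNz : (N : ℤ) ≠ 0 := by exact_mod_cast hN.ne'
    have hmod := Int.emod_nonneg (-k) hNz
    have hmod' := Int.emod_lt_of_pos (-k) (by exact_mod_cast hN : (0 : ℤ) < N)
    refine ⟨(QuotientGroup.mk s : V ⧸ Subgroup.zpowers g).out * g ^ ((-k) % N).toNat, ?_,
      (-k) / N, ?_⟩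
    · simp only [mem_iUnion]
      exact ⟨_, Finset.mem_range.2 (by omega), _, rfl⟩
    · rw [hk, ht, ← zpow_natCast, ← zpow_natCast g N, ← zpow_mul, mul_assoc, mul_assoc, ← zpow_add,
        ← zpow_add, Int.toNat_of_nonneg hmod, Int.emod_add_mul_ediv]
      simp
  refine ⟨h, hh0, t, hth, htfin, fun γ hγ => ?_⟩
  -- By finite index, a positive power of the conjugate of `t` by `γ` is a power of `t`. Comparing
  -- translation vectors, `k` times the image of `h` is `j` times `h`.
  obtain ⟨k, hk, -, j, hj⟩ := Subgroup.exists_pow_mem_of_index_ne_zero htfin.index_ne_zero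
    ((⟨γ, hγ⟩ : V) * t * (⟨γ, hγ⟩ : V)⁻¹)
  have e : ((t : Γ) : Isom n) ^ j =
      ((γ : Isom n) * ((t : Γ) : Isom n) * (γ : Isom n)⁻¹) ^ k :=
    congrArg (fun s : V => ((s : Γ) : Isom n)) hj
  rw [hth, conj_constVAdd, constVAdd_pow, constVAdd_zpow] at e
  have e2 := constVAdd_injective e
  refine Submodule.mem_span_singleton.2 ⟨(k : ℝ)⁻¹ * j, ?_⟩
  rw [mul_smul, e2, inv_smul_smul₀ (Nat.cast_ne_zero.2 (by omega))]

theorem linearIsometry_eq_or_neg_of_mem_span {J : Euc n ≃ₗᵢ[ℝ] Euc n} {z : Euc n}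
    (h : J z ∈ Submodule.span ℝ {z}) : J z = z ∨ J z = -z := by
  rcases eq_or_ne z 0 with rfl | hz
  · exact Or.inl (map_zero J)
  obtain ⟨c, hc⟩ := Submodule.mem_span_singleton.1 h
  have h1 := congrArg norm hc
  rw [norm_smul, LinearIsometryEquiv.norm_map, mul_eq_right₀ (norm_ne_zero_iff.2 hz),
    Real.norm_eq_abs] at h1
  rcases eq_or_eq_neg_of_abs_eq h1 with rfl | rfl
  · exact Or.inl (by rw [← hc, one_smul])
  · exact Or.inr (by rw [← hc, neg_one_smul])

theorem IsCrystallographic.stabilizer_isVirtuallyCyclic (hΓ : IsCrystallographic Γ)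
    {e : OrbitEnumeration Γ} (M : CollapseModel Γ (Euc n) (ModelSpace e)) (o : Euc n)
    (hm : ∀ γ : Γ, M.m γ = (γ : Isom n) o - o) (hJ : ∀ γ, M.J γ = linearPart (γ : Isom n))
    (hZ : ∀ z ∈ M.Z, z ∈ translationVectors Γ) (a : ModelSpace e) :
    IsVirtuallyCyclic (MulAction.stabilizer Γ a) := by
  obtain ⟨⟨u, y⟩, rfl⟩ := M.isQuotientMap_q.surjective a
  have hact (γ : Γ) : M.J γ y + M.m γ - y = (γ : Isom n) (y + o) - (y + o) := by
    rw [hm, hJ, isom_add]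
    abel
  have hstab (γ : Γ) (hγ : γ ∈ MulAction.stabilizer Γ (M.q (u, y))) :
      (γ : Isom n) (y + o) = y + o ∨
        u ∈ M.Z ∧ (γ : Isom n) (y + o) - (y + o) ∈ Submodule.span ℝ {u} := by
    have h : γ • M.q (u, y) = M.q (u, y) := hγ
    rw [M.smul_q, eq_comm, M.q_eq_iff] at h
    rw [← sub_eq_zero, ← hact, sub_eq_zero]
    rcases h.2 with h | ⟨hu, h⟩
    · exact Or.inl h.symm
    · refine Or.inr ⟨hu, ?_⟩
      rwa [← neg_mem_iff, neg_sub] at h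
  by_cases hu : u ∈ M.Z
  · refine hΓ.isVirtuallyCyclic_of_line (z := u) (x₀ := y + o) (M.ne_zero_of_mem_Z hu)
      ⟨⟨_, hZ u hu⟩, ?_, rfl⟩ fun γ hγ => ?_
    · change _ • M.q (u, y) = M.q (u, y)
      rw [M.smul_q, hm, hJ, linearPart_constVAdd]
      refine (M.q_eq_iff _ _ _ _).2 ⟨Or.inl rfl, Or.inr ⟨hu, ?_⟩⟩
      change y + (u + o - o) - y ∈ Submodule.span ℝ {u}
      rw [add_sub_cancel_right, add_sub_cancel_left]
      exact Submodule.mem_span_singleton_self u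
    · rcases hstab γ hγ with h | h
      · rw [h, sub_self]
        exact zero_mem _
      · exact h.2
  · refine Or.inl ((hΓ.finite_inter (isCompact_singleton (x := y + o))).subset
      fun γ hγ => ⟨y + o, rfl, ?_⟩ : (MulAction.stabilizer Γ (M.q (u, y)) : Set Γ).Finite).to_subtype
    exact (hstab γ hγ).resolve_right fun h => hu h.1

theorem IsCrystallographic.contractibleSpace_fixedPoints (hΓ : IsCrystallographic Γ)
    {e : OrbitEnumeration Γ} (M : CollapseModel Γ (Euc n) (ModelSpace e)) (o : Euc n)
    (hm : ∀ γ : Γ, M.m γ = (γ : Isom n) o - o) (hJ : ∀ γ, M.J γ = linearPart (γ : Isom n))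
    (hZdir : ∀ h ∈ translationVectors Γ, h ≠ 0 →
      ∃ z ∈ M.Z, Submodule.span ℝ {h} = Submodule.span ℝ {z})
    (hZinj : ∀ z ∈ M.Z, ∀ z' ∈ M.Z, Submodule.span ℝ {z} = Submodule.span ℝ {z'} →
        z' = z ∨ z' = -z)
    {V : Subgroup Γ} (hV : IsVirtuallyCyclic V) :
    ContractibleSpace (MulAction.fixedPoints V (ModelSpace e)) := by
  have hact (γ : Γ) (x : Euc n) : M.J γ (x - o) + M.m γ = (γ : Isom n) x - o := by
    have := isom_add (γ : Isom n) (x - o) o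
    rw [sub_add_cancel] at this
    rw [hm, hJ, this]
    abel
  rcases hV with hV | ⟨g, hg, hgfin⟩
  -- For finite `V` the trivial subgroup has finite index, so averaging modulo nothing gives an
  -- actual fixed point.
  · obtain ⟨x₀, hx₀⟩ := exists_fixed_mod (V := V) LinearMap.id (fun γ _ x y h =>
        congrArg (fun v => (γ : Isom n) v) (show x = y from h)) ⊥
      (by rintro h hh; rw [Subgroup.mem_bot.1 hh]; rfl)
    refine M.contractibleSpace_fixedPoints (y₀ := x₀ - o) fun γ hγ => ?_
    rw [hact]
    exact congrArg (· - o) (hx₀ γ hγ)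
  · obtain ⟨h, hh0, t, ht, htfin, hspan⟩ := hΓ.exists_translation hg hgfin
    have hhΓ : h ∈ translationVectors Γ := by
      change _ ∈ Γ
      rw [← ht]
      exact (t : Γ).2
    obtain ⟨z, hzZ, hz⟩ := hZdir h hhΓ hh0
    have hJspan (γ : Γ) (hγ : γ ∈ V) {x : Euc n} (hx : x ∈ Submodule.span ℝ {z}) :
        linearPart (γ : Isom n) x ∈ Submodule.span ℝ {z} := by
      rw [← hz] at hx ⊢
      obtain ⟨c, rfl⟩ := Submodule.mem_span_singleton.1 hx
      rw [map_smul]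
      exact Submodule.smul_mem _ _ (hspan γ hγ)
    obtain ⟨x₀, hx₀⟩ := exists_fixed_mod (V := V) (perp z) (fun γ hγ x y hxy => by
        rw [perp_eq_iff] at hxy ⊢
        have e : (γ : Isom n) x - (γ : Isom n) y = linearPart (γ : Isom n) (x - y) := by
          rw [isom_apply _ x, isom_apply _ y, map_sub]
          abel
        rw [e]
        exact hJspan γ hγ hxy) (Subgroup.zpowers t) (by
      intro s hs
      obtain ⟨j, hj⟩ := Subgroup.mem_zpowers_iff.1 hs
      have e : ((s : Γ) : Isom n) = AffineIsometryEquiv.constVAdd ℝ (Euc n) ((j : ℝ) • h) := by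
        rw [← constVAdd_zpow, ← ht, ← hj, Subgroup.coe_zpow, Subgroup.coe_zpow]
      have e0 : ((s : Γ) : Isom n) 0 = (j : ℝ) • h := by
        rw [e]
        exact add_zero ((j : ℝ) • h)
      rw [e0]
      have h0 : perp z ((j : ℝ) • h) = perp z 0 := by
        rw [perp_eq_iff, sub_zero, ← hz]
        exact Submodule.smul_mem _ _ (Submodule.mem_span_singleton_self h)
      exact h0.trans (map_zero _))
    refine M.contractibleSpace_fixedPoints_of_line (z := z) (y₀ := x₀ - o) (fun u y hu => ?_) ?_
    -- The translation by `h ≠ 0` moves every Euclidean point, so it can fix `q (u, y)` only on a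
    -- collapsed line parallel to `h`. This forces `u` to be `z` or `-z`.
    · obtain ⟨-, h2⟩ := CollapseModel.q_mem_fixedPoints_iff.1 hu t t.2
      have e : M.J t y + M.m t = h + y := by
        have := hact t (y + o)
        rw [add_sub_cancel_right] at this
        rw [this, ht]
        change h + (y + o) - o = _
        abel
      rw [e, add_sub_cancel_right] at h2
      obtain ⟨huZ, hhu⟩ := h2.resolve_left fun h' => hh0 (by simpa using h')
      refine hZinj z hzZ u huZ ?_
      rw [← hz]
      obtain ⟨c, hc⟩ := Submodule.mem_span_singleton.1 hhu
      have hc0 : c ≠ 0 := by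
        rintro rfl
        exact hh0 (by rw [← hc, zero_smul])
      rw [← hc, Submodule.span_singleton_smul_eq (IsUnit.mk0 _ hc0)]
    · refine CollapseModel.q_mem_fixedPoints_iff.2 fun γ hγ => ⟨?_, Or.inr ⟨hzZ, ?_⟩⟩
      · rw [hJ]
        exact linearIsometry_eq_or_neg_of_mem_span
          (hJspan γ hγ (Submodule.mem_span_singleton_self z))
      · rw [hact, sub_sub_sub_cancel_right]
        exact perp_eq_iff.1 (hx₀ γ hγ)

theorem IsCrystallographic.isUniversalSpace (hΓ : IsCrystallographic Γ) (e : OrbitEnumeration Γ) :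
    IsUniversalSpace Γ (virtuallyCyclicSubgroups Γ) (ModelSpace e) := by
  obtain ⟨M, o, hJ, hm, hZ, hZdir, hZinj⟩ := e.exists_collapseModel hΓ
  have hT2 : T2Space (ModelSpace e) := M.t2Space
  have hcont : ContinuousConstSMul Γ (ModelSpace e) := M.continuousConstSMul
  have hcontr (V) (hV : V ∈ virtuallyCyclicSubgroups Γ) :
      ContractibleSpace (MulAction.fixedPoints V (ModelSpace e)) :=
    hΓ.contractibleSpace_fixedPoints M o hm hJ hZdir hZinj hV
  refine ⟨hT2, hcont, ?_, fun a => hΓ.stabilizer_isVirtuallyCyclic M o hm hJ hZ a, fun V hV => ?_,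
    hcontr⟩
  · obtain ⟨K, hK⟩ := M.exists_isCellularAction
    exact ⟨K, hK, fun V _ => hK.exists_subcomplex V⟩
  · have := hcontr V hV
    exact nonempty_coe_sort.1 inferInstance

end Crystal

theorem theorem2p1 (n : ℕ) (Γ : Subgroup (Crystal.Isom n))
    (hΓ : Crystal.IsCrystallographic Γ) :
    Nonempty (Crystal.OrbitEnumeration Γ) ∧
    ∀ e : Crystal.OrbitEnumeration Γ,
      Crystal.IsUniversalSpace Γ (Crystal.virtuallyCyclicSubgroups Γ)
        (Crystal.ModelSpace e) :=
  ⟨hΓ.nonempty_orbitEnumeration, hΓ.isUniversalSpace⟩
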